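/- Let $N\ge1$. All functions are complex-valued unless indicated, and all vector spaces, scalar products and duals are real: $L^2(\mathbb R^N)=L^2(\mathbb R^N;\mathbb C)$; $\mathscr D(\mathbb R^N)=C_c^\infty(\mathbb R^N;\mathbb C)$ has its usual inductive limit topology; $\mathscr D'(\mathbb R^N)$ is the space of continuous $\mathbb R$-linear maps $\mathscr D(\mathbb R^N)\to\mathbb R$ with its (strong) dual topology; $X^\star=\mathscr L(X;\mathbb R)$ for a normed space $X$, with the dual norm. $H^1(\mathbb R^N)$ has the scalar product $\mathrm{Re}\int u\bar v\,dx+\mathrm{Re}\int\nabla u\cdot\overline{\nabla v}\,dx$, and $H^{-1}(\mathbb R^N)=H^1(\mathbb R^N)^\star$. For $k\in\mathbb Z^N$ put $Q_k=k+(0,1)^N$. Let $A\in L^2_{\rm loc}(\mathbb R^N;\mathbb R^N)$ and $V\in L^1_{\rm loc}(\mathbb R^N;\mathbb R)$ satisfy * $A\in L^p_{\rm loc}(\mathbb R^N;\mathbb R^N)$ and $\sup_{k\in\mathbb Z^N}\|A\|_{L^p(Q_k)}<\infty$, where $p=N$ if $N\ge3$, $p=2+\varepsilon$ for some $\varepsilon>0$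 if $N=2$, and $p=2$ if $N=1$; * $\operatorname{ess\,inf}_{\mathbb R^N}V>0$. Write $\nabla_Au=(\nabla+\mathrm iA)u$ (in the sense of distributions) and let $$H^1_{A,V}(\mathbb R^N)=\{u\in L^2(\mathbb R^N)\,;\ Vu^2\in L^1(\mathbb R^N)\text{ and }\nabla_Au\in L^2(\mathbb R^N;\mathbb C^N)\},$$ with the scalar product $\langle u,v\rangle_{H^1_{A,V}}=\mathrm{Re}\int Vu\bar v\,dx+\mathrm{Re}\int\nabla_Au\cdot\overline{\nabla_Av}\,dx$ and the corresponding norm; let $H^{-1}_{A,V}(\mathbb R^N)=H^1_{A,V}(\mathbb R^N)^\star$. Then: 1. $H^1_{A,V}(\mathbb R^N)=\{u\in H^1(\mathbb R^N)\,;\ Vu^2\in L^1(\mathbb R^N)\text{ and }Au\in L^2(\mathbb R^N;\mathbb C^N)\}$. 2. $H^1_{A,V}(\mathbb R^N)$ is a separable Hilbert space. 3. The inclusions $\mathscr D(\mathbb R^N)\hookrightarrow H^1_{A,V}(\mathbb R^N)\hookrightarrow H^1(\mathbb R^N)$ are well defined, injective and continuous, and both have dense range. In particular, for all $u,v\in H^1_{A,V}(\mathbb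 R^N)$ we have $\nabla_Au=\nabla u+\mathrm iAu$ a.e., and each term in the integrals of $\langle u,v\rangle_{H^1_{A,V}}$ is integrable: $Vu\bar v$, $\nabla_Au\cdot\overline{\nabla_Av}$, and the four terms $\nabla u\cdot\overline{\nabla v}$, $\nabla u\cdot\overline{\mathrm iAv}$, $\mathrm iAu\cdot\overline{\nabla v}$, $\mathrm iAu\cdot\overline{\mathrm iAv}$ of its expansion belong to $L^1(\mathbb R^N)$. 4. The restriction maps (the transposes of the inclusions in 3) $H^{-1}(\mathbb R^N)\hookrightarrow H^{-1}_{A,V}(\mathbb R^N)\hookrightarrow\mathscr D'(\mathbb R^N)$ are injective and continuous, and both have dense range. -/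

import Mathlib

open MeasureTheory
open scoped ENNReal NNReal Distributions CompactConvergenceCLM ComplexConjugate

noncomputable section

namespace MagneticSobolev

/-- Euclidean space `ℝ^N`. -/
abbrev RN (N : ℕ) : Type := EuclideanSpace ℝ (Fin N)

/-- Hermitian space `ℂ^N`. -/
abbrev CN (N : ℕ) : Type := EuclideanSpace ℂ (Fin N)

/-- `L²(ℝ^N) = L²(ℝ^N; ℂ)`. -/
abbrev L2 (N : ℕ) : Type := Lp ℂ 2 (volume : Measure (RN N))

/-- `L²(ℝ^N; ℂ^N)`. -/
abbrev L2vec (N : ℕ) : Type := Lp (CN N) 2 (volume : Measure (RN N))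

/-- `𝒟(ℝ^N) = 𝒟(ℝ^N; ℂ)` with its canonical LF topology. -/
abbrev TestFn (N : ℕ) : Type := 𝓓((⊤ : TopologicalSpace.Opens (RN N)), ℂ)

/-- `𝒟'(ℝ^N)`: the continuous real-linear forms on `𝒟(ℝ^N; ℂ)`, with the topology of uniform
convergence on compact subsets of `𝒟(ℝ^N; ℂ)` (as for Mathlib's `Distribution`; since
`𝒟(ℝ^N; ℂ)` is a Montel space this is the usual strong dual topology). -/
abbrev Distr (N : ℕ) : Type := TestFn N →L_c[ℝ] ℝ

/-- `f ∈ L^p_loc(ℝ^N; F)`. -/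
def MemLpLoc {N : ℕ} {F : Type*} [NormedAddCommGroup F] (f : RN N → F) (p : ℝ≥0∞) : Prop :=
  ∀ K : Set (RN N), IsCompact K → MemLp f p (volume.restrict K)

/-- The open unit cube `k + (0,1)^N`, for `k ∈ ℤ^N`. -/
def unitCube {N : ℕ} (k : Fin N → ℤ) : Set (RN N) :=
  {x | ∀ j, (k j : ℝ) < x j ∧ x j < (k j : ℝ) + 1}

/-- The integrability exponent required of the magnetic potential: `2` if `N = 1`, some `2 + ε`
with `ε > 0` if `N = 2`, and `N` if `N ≥ 3`. -/
def MagneticExponent (N : ℕ) (p : ℝ≥0∞) : Prop :=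
  (N = 1 ∧ p = 2) ∨ (N = 2 ∧ ∃ ε : ℝ, 0 < ε ∧ p = ENNReal.ofReal (2 + ε)) ∨ (3 ≤ N ∧ p = N)

/-- The hypothesis on the magnetic potential: `A ∈ L^p_loc` and `sup_k ‖A‖_{L^p(k + (0,1)^N)} < ∞`
for an admissible exponent `p`. -/
def MagneticCondition {N : ℕ} (A : RN N → RN N) : Prop :=
  ∃ p : ℝ≥0∞, MagneticExponent N p ∧ MemLpLoc A p ∧
    ⨆ k : Fin N → ℤ, eLpNorm A p (volume.restrict (unitCube k)) < ∞

/-- The hypothesis on the electric potential: `V ∈ L¹_loc(ℝ^N; ℝ)` and `ess inf V > 0`. -/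
def ElectricCondition {N : ℕ} (V : RN N → ℝ) : Prop :=
  LocallyIntegrable V volume ∧ 0 < essInf V volume

/-- The pointwise product `A u`, a `ℂ^N`-valued function. -/
def potMul {N : ℕ} (A : RN N → RN N) (u : RN N → ℂ) (x : RN N) : CN N :=
  WithLp.toLp 2 fun j => (A x j : ℂ) * u x

/-- The Hermitian product `a · conj b` in `ℂ^N`. -/
def hdot {N : ℕ} (a b : CN N) : ℂ := ∑ j, a j * conj (b j)

/-- `(∇ + iA) u = g` in the sense of distributions. -/
def HasMagneticGradient {N : ℕ} (A : RN N → RN N) (u : RN N → ℂ) (g : RN N → CN N) : Prop :=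
  ∀ (φ : TestFn N) (j : Fin N),
    ∫ x, g x j * φ x =
      -(∫ x, u x * fderiv ℝ φ x (EuclideanSpace.single j 1)) +
        ∫ x, Complex.I * potMul A u x j * φ x

section helpers

variable {N : ℕ} {A : RN N → RN N} {V : RN N → ℝ}

theorem integrable_mul_testFn {f : RN N → ℂ} (hf : LocallyIntegrable f volume) (φ : TestFn N) :
    Integrable (fun x => f x * φ x) volume := by
  have h := hf.integrable_smul_right_of_hasCompactSupport φ.continuous φ.hasCompactSupport
  simpa [smul_eq_mul] using h

theorem integrable_mul_fderiv {f : RN N → ℂ} (hf : LocallyIntegrable f volume) (φ : TestFn N)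
    (v : RN N) : Integrable (fun x => f x * fderiv ℝ φ x v) volume := by
  have hc : Continuous fun x => fderiv ℝ φ x v :=
    (φ.contDiff.continuous_fderiv (by simp)).clm_apply continuous_const
  have hs : HasCompactSupport fun x => fderiv ℝ φ x v :=
    φ.hasCompactSupport.fderiv_apply (𝕜 := ℝ) v
  simpa [smul_eq_mul] using hf.integrable_smul_right_of_hasCompactSupport hc hs

theorem L2_locallyIntegrable (u : L2 N) : LocallyIntegrable u volume :=
  (Lp.memLp u).locallyIntegrable (by norm_num)

theorem memLp_coord (g : L2vec N) (j : Fin N) : MemLp (fun x => g x j) 2 volume :=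
  (EuclideanSpace.proj (𝕜 := ℂ) j).comp_memLp' (Lp.memLp g)

theorem L2vec_locallyIntegrable (g : L2vec N) (j : Fin N) :
    LocallyIntegrable (fun x => g x j) volume :=
  (memLp_coord g j).locallyIntegrable (by norm_num)

theorem potMul_locallyIntegrable (hA : MemLpLoc A 2) (u : L2 N) (j : Fin N) :
    LocallyIntegrable (fun x => Complex.I * potMul A u x j) volume := by
  rw [locallyIntegrable_iff]
  intro K hK
  have h1 : MemLp (fun x => (A x j : ℂ)) 2 (volume.restrict K) :=
    (Complex.ofRealCLM.comp (EuclideanSpace.proj (𝕜 := ℝ) j)).comp_memLp' (hA K hK)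
  have h2 : MemLp (u : RN N → ℂ) 2 (volume.restrict K) := (Lp.memLp u).restrict K
  exact (h1.integrable_mul h2).const_mul Complex.I

theorem HasMagneticGradient.congr {u u' : RN N → ℂ} {g g' : RN N → CN N}
    (h : HasMagneticGradient A u g) (hu : u =ᵐ[volume] u') (hg : g =ᵐ[volume] g') :
    HasMagneticGradient A u' g' := by
  intro φ j
  have e1 : ∫ x, g' x j * φ x = ∫ x, g x j * φ x :=
    integral_congr_ae (by filter_upwards [hg] with x hx; rw [hx])
  have e2 : ∫ x, u' x * fderiv ℝ φ x (EuclideanSpace.single j 1) =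
      ∫ x, u x * fderiv ℝ φ x (EuclideanSpace.single j 1) :=
    integral_congr_ae (by filter_upwards [hu] with x hx; rw [hx])
  have e3 : ∫ x, Complex.I * potMul A u' x j * φ x = ∫ x, Complex.I * potMul A u x j * φ x :=
    integral_congr_ae (by filter_upwards [hu] with x hx; simp only [potMul, hx])
  rw [e1, e2, e3, h φ j]

theorem HasMagneticGradient.add (hA : MemLpLoc A 2) {u v : L2 N} {g h : L2vec N}
    (hu : HasMagneticGradient A u g) (hv : HasMagneticGradient A v h) :
    HasMagneticGradient A (u + v : L2 N) (g + h : L2vec N) := by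
  refine HasMagneticGradient.congr (u := fun x => u x + v x) (g := fun x => g x + h x) ?_
    (Lp.coeFn_add u v).symm (Lp.coeFn_add g h).symm
  intro φ j
  have e1 : ∫ x, (g x + h x) j * φ x = (∫ x, g x j * φ x) + ∫ x, h x j * φ x := by
    rw [← integral_add (integrable_mul_testFn (L2vec_locallyIntegrable g j) φ)
      (integrable_mul_testFn (L2vec_locallyIntegrable h j) φ)]
    exact integral_congr_ae (.of_forall fun x => by simp [add_mul])
  have e2 : ∫ x, (u x + v x) * fderiv ℝ φ x (EuclideanSpace.single j 1) =
      (∫ x, u x * fderiv ℝ φ x (EuclideanSpace.single j 1)) +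
        ∫ x, v x * fderiv ℝ φ x (EuclideanSpace.single j 1) := by
    rw [← integral_add (integrable_mul_fderiv (L2_locallyIntegrable u) φ _)
      (integrable_mul_fderiv (L2_locallyIntegrable v) φ _)]
    exact integral_congr_ae (.of_forall fun x => by simp [add_mul])
  have e3 : ∫ x, Complex.I * potMul A (fun x => u x + v x) x j * φ x =
      (∫ x, Complex.I * potMul A u x j * φ x) + ∫ x, Complex.I * potMul A v x j * φ x := by
    rw [← integral_add (integrable_mul_testFn (potMul_locallyIntegrable hA u j) φ)
      (integrable_mul_testFn (potMul_locallyIntegrable hA v j) φ)]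
    exact integral_congr_ae (.of_forall fun x => by simp only [potMul]; ring)
  rw [e1, e2, e3, hu φ j, hv φ j]
  ring

theorem HasMagneticGradient.smul {u : L2 N} {g : L2vec N} (c : ℝ)
    (hu : HasMagneticGradient A u g) :
    HasMagneticGradient A (c • u : L2 N) (c • g : L2vec N) := by
  refine HasMagneticGradient.congr (u := fun x => c • u x) (g := fun x => c • g x) ?_
    (Lp.coeFn_smul c u).symm (Lp.coeFn_smul c g).symm
  intro φ j
  have e1 : ∫ x, (c • g x) j * φ x = (c : ℂ) * ∫ x, g x j * φ x := by
    rw [← integral_const_mul]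
    exact integral_congr_ae (.of_forall fun x => by simp [mul_assoc])
  have e2 : ∫ x, (c • u x) * fderiv ℝ φ x (EuclideanSpace.single j 1) =
      (c : ℂ) * ∫ x, u x * fderiv ℝ φ x (EuclideanSpace.single j 1) := by
    rw [← integral_const_mul]
    exact integral_congr_ae (.of_forall fun x => by simp [mul_assoc])
  have e3 : ∫ x, Complex.I * potMul A (fun x => c • u x) x j * φ x =
      (c : ℂ) * ∫ x, Complex.I * potMul A u x j * φ x := by
    rw [← integral_const_mul]
    exact integral_congr_ae (.of_forall fun x => by
      simp only [potMul, Complex.real_smul]; ring)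
  rw [e1, e2, e3, hu φ j]
  ring

theorem HasMagneticGradient.unique {u : L2 N} {g h : L2vec N}
    (hg : HasMagneticGradient A u g) (hh : HasMagneticGradient A u h) : g = h := by
  have key : ∀ j, ∀ᵐ x, g x j = h x j := by
    intro j
    refine ae_eq_of_integral_contDiff_smul_eq (L2vec_locallyIntegrable g j)
      (L2vec_locallyIntegrable h j) ?_
    intro ψ hψ hψs
    let φ : TestFn N :=
      { toFun := fun x => (ψ x : ℂ)
        contDiff' := Complex.ofRealCLM.contDiff.comp hψ
        hasCompactSupport' := hψs.comp_left (g := Complex.ofReal) (by simp)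
        tsupport_subset' := fun _ _ => trivial }
    have := (hg φ j).trans (hh φ j).symm
    have c : ∀ f : RN N → ℂ, ∫ x, ψ x • f x = ∫ x, f x * φ x := fun f =>
      integral_congr_ae (.of_forall fun x => by
        change ψ x • f x = f x * (ψ x : ℂ)
        rw [Complex.real_smul, mul_comm])
    rw [c, c, this]
  apply Lp.ext
  filter_upwards [ae_all_iff.2 key] with x hx
  ext j
  exact hx j

theorem ae_pos (hV : ElectricCondition V) : ∀ᵐ x, 0 < V x := by
  have h := hV.2
  rw [essInf, Filter.liminf_eq] at h
  have hne : {a : ℝ | ∀ᶠ x in ae (volume : Measure (RN N)), a ≤ V x}.Nonempty := by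
    by_contra hc
    rw [Set.not_nonempty_iff_eq_empty] at hc
    rw [hc, Real.sSup_empty] at h
    exact lt_irrefl _ h
  obtain ⟨a, ha, h0⟩ := exists_lt_of_lt_csSup hne h
  filter_upwards [ha] with x hx using lt_of_lt_of_le h0 hx

theorem aesm_V (hV : ElectricCondition V) :
    AEStronglyMeasurable (fun x => (V x : ℂ)) volume :=
  Complex.continuous_ofReal.comp_aestronglyMeasurable hV.1.aestronglyMeasurable

theorem integrable_V_mul (hV : ElectricCondition V) {u v : L2 N}
    (hu : Integrable (fun x => (V x : ℂ) * u x ^ 2) volume)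
    (hv : Integrable (fun x => (V x : ℂ) * v x ^ 2) volume) :
    Integrable (fun x => (V x : ℂ) * (u x * conj (v x))) volume := by
  refine Integrable.mono' (hu.norm.add hv.norm) ((aesm_V hV).mul
    ((Lp.aestronglyMeasurable u).mul
      (Complex.continuous_conj.comp_aestronglyMeasurable (Lp.aestronglyMeasurable v)))) ?_
  refine .of_forall fun x => ?_
  simp only [Pi.add_apply, norm_mul, norm_pow, RCLike.norm_conj]
  rw [← mul_add]
  refine mul_le_mul_of_nonneg_left ?_ (norm_nonneg _)
  nlinarith [sq_nonneg (‖u x‖ - ‖v x‖), sq_nonneg (‖u x‖ + ‖v x‖)]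

theorem integrable_hdot (g h : L2vec N) : Integrable (fun x => hdot (g x) (h x)) volume := by
  refine integrable_finsetSum _ fun j _ => ?_
  exact (memLp_coord g j).integrable_mul (memLp_coord h j).star

end helpers

/-- The space `H¹_{A,V}(ℝ^N) = {u ∈ L² ; V u² ∈ L¹ and (∇ + iA) u ∈ L²(ℝ^N; ℂ^N)}`, as a real
vector subspace of `L²(ℝ^N)`. -/
def H1AVsub {N : ℕ} {A : RN N → RN N} {V : RN N → ℝ} (hA : MemLpLoc A 2)
    (hV : ElectricCondition V) : Submodule ℝ (L2 N) where
  carrier := {u | Integrable (fun x => (V x : ℂ) * u x ^ 2) volume ∧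
    ∃ g : L2vec N, HasMagneticGradient A u g}
  zero_mem' := by
    have h0 : ((0 : L2 N) : RN N → ℂ) =ᵐ[volume] 0 := Lp.coeFn_zero _ _ _
    refine ⟨(integrable_zero (RN N) ℂ volume).congr ?_, 0, ?_⟩
    · filter_upwards [h0] with x hx
      simp
    · refine HasMagneticGradient.congr (u := 0) (g := 0) ?_ h0.symm (Lp.coeFn_zero _ _ _).symm
      intro φ j
      simp [potMul]
  add_mem' := by
    rintro u v ⟨hu, g, hg⟩ ⟨hv, h, hh⟩
    refine ⟨?_, g + h, hg.add hA hh⟩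
    have hm : AEStronglyMeasurable (fun x => (V x : ℂ) * (u + v : L2 N) x ^ 2) volume :=
      (aesm_V hV).mul ((Lp.aestronglyMeasurable (u + v)).pow 2)
    refine Integrable.mono' ((hu.norm.add hv.norm).const_mul 2) hm ?_
    filter_upwards [Lp.coeFn_add u v] with x hx
    rw [hx]
    simp only [Pi.add_apply, norm_mul, norm_pow]
    have h1 := norm_add_le (u x) (v x)
    have h2 : ‖u x + v x‖ ^ 2 ≤ 2 * (‖u x‖ ^ 2 + ‖v x‖ ^ 2) := by
      nlinarith [sq_nonneg (‖u x‖ - ‖v x‖), norm_nonneg (u x + v x)]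
    nlinarith [mul_le_mul_of_nonneg_left h2 (norm_nonneg (V x : ℂ))]
  smul_mem' := by
    rintro c u ⟨hu, g, hg⟩
    refine ⟨(hu.const_mul ((c : ℂ) ^ 2)).congr ?_, c • g, hg.smul c⟩
    filter_upwards [Lp.coeFn_smul c u] with x hx
    rw [hx]
    simp only [Pi.smul_apply, Complex.real_smul]
    ring

/-- `H¹_{A,V}(ℝ^N)` as a type of its own, to be given its own norm (the subspace `H1AVsub` carries
the norm of `L²`). -/
def H1AV {N : ℕ} {A : RN N → RN N} {V : RN N → ℝ} (hA : MemLpLoc A 2)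
    (hV : ElectricCondition V) : Type :=
  ↥(H1AVsub hA hV)

namespace H1AV

variable {N : ℕ} {A : RN N → RN N} {V : RN N → ℝ} {hA : MemLpLoc A 2} {hV : ElectricCondition V}

instance : AddCommGroup (H1AV hA hV) := inferInstanceAs (AddCommGroup ↥(H1AVsub hA hV))

instance : Module ℝ (H1AV hA hV) := inferInstanceAs (Module ℝ ↥(H1AVsub hA hV))

/-- The inclusion `H¹_{A,V}(ℝ^N) ⊆ L²(ℝ^N)`. -/
def toL2 : H1AV hA hV →ₗ[ℝ] L2 N := (H1AVsub hA hV).subtype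

theorem toL2_mem (u : H1AV hA hV) : u.toL2 ∈ H1AVsub hA hV := Subtype.property _

/-- `∇_A u = (∇ + iA) u ∈ L²(ℝ^N; ℂ^N)`. -/
def grad (u : H1AV hA hV) : L2vec N := u.toL2_mem.2.choose

theorem grad_spec (u : H1AV hA hV) : HasMagneticGradient A u.toL2 u.grad :=
  u.toL2_mem.2.choose_spec

theorem grad_add (u v : H1AV hA hV) : (u + v).grad = u.grad + v.grad :=
  (grad_spec (u + v)).unique (by rw [map_add]; exact u.grad_spec.add hA v.grad_spec)

theorem grad_smul (c : ℝ) (u : H1AV hA hV) : (c • u).grad = c • u.grad :=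
  (grad_spec (c • u)).unique (by rw [map_smul]; exact u.grad_spec.smul c)

/-- The scalar product `Re ∫ V u conj(v) dx + Re ∫ ∇_A u · conj(∇_A v) dx`. -/
instance : Inner ℝ (H1AV hA hV) where
  inner u v :=
    (∫ x, (V x : ℂ) * (u.toL2 x * conj (v.toL2 x))).re + (∫ x, hdot (u.grad x) (v.grad x)).re

theorem inner_def (u v : H1AV hA hV) : inner ℝ u v =
    (∫ x, (V x : ℂ) * (u.toL2 x * conj (v.toL2 x))).re + (∫ x, hdot (u.grad x) (v.grad x)).re :=
  rfl

theorem inner_comm' (u v : H1AV hA hV) : inner ℝ v u = inner ℝ u v := by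
  rw [inner_def, inner_def]
  have e1 : ∫ x, (V x : ℂ) * (v.toL2 x * conj (u.toL2 x)) =
      conj (∫ x, (V x : ℂ) * (u.toL2 x * conj (v.toL2 x))) := by
    rw [← integral_conj]
    exact integral_congr_ae (.of_forall fun x => by simp [mul_comm])
  have e2 : ∫ x, hdot (v.grad x) (u.grad x) = conj (∫ x, hdot (u.grad x) (v.grad x)) := by
    rw [← integral_conj]
    exact integral_congr_ae (.of_forall fun x => by simp [hdot, mul_comm])
  rw [e1, e2, Complex.conj_re, Complex.conj_re]

theorem inner_add' (u v w : H1AV hA hV) :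
    inner ℝ (u + v) w = inner ℝ u w + inner ℝ v w := by
  simp only [inner_def]
  have e1 : ∫ x, (V x : ℂ) * ((u + v).toL2 x * conj (w.toL2 x)) =
      (∫ x, (V x : ℂ) * (u.toL2 x * conj (w.toL2 x))) +
        ∫ x, (V x : ℂ) * (v.toL2 x * conj (w.toL2 x)) := by
    rw [← integral_add (integrable_V_mul hV u.toL2_mem.1 w.toL2_mem.1)
      (integrable_V_mul hV v.toL2_mem.1 w.toL2_mem.1)]
    refine integral_congr_ae ?_
    rw [map_add]
    filter_upwards [Lp.coeFn_add u.toL2 v.toL2] with x hx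
    rw [hx, Pi.add_apply]
    ring
  have e2 : ∫ x, hdot ((u + v).grad x) (w.grad x) =
      (∫ x, hdot (u.grad x) (w.grad x)) + ∫ x, hdot (v.grad x) (w.grad x) := by
    rw [← integral_add (integrable_hdot _ _) (integrable_hdot _ _)]
    refine integral_congr_ae ?_
    rw [grad_add]
    filter_upwards [Lp.coeFn_add u.grad v.grad] with x hx
    rw [hx]
    simp [hdot, add_mul, Finset.sum_add_distrib]
  rw [e1, e2, Complex.add_re, Complex.add_re]
  ring

theorem inner_smul' (u v : H1AV hA hV) (c : ℝ) : inner ℝ (c • u) v = c * inner ℝ u v := by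
  simp only [inner_def]
  have e1 : ∫ x, (V x : ℂ) * ((c • u).toL2 x * conj (v.toL2 x)) =
      (c : ℂ) * ∫ x, (V x : ℂ) * (u.toL2 x * conj (v.toL2 x)) := by
    rw [← integral_const_mul]
    refine integral_congr_ae ?_
    rw [map_smul]
    filter_upwards [Lp.coeFn_smul c u.toL2] with x hx
    rw [hx, Pi.smul_apply, Complex.real_smul]
    ring
  have e2 : ∫ x, hdot ((c • u).grad x) (v.grad x) =
      (c : ℂ) * ∫ x, hdot (u.grad x) (v.grad x) := by
    rw [← integral_const_mul]
    refine integral_congr_ae ?_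
    rw [grad_smul]
    filter_upwards [Lp.coeFn_smul c u.grad] with x hx
    rw [hx]
    simp [hdot, mul_assoc, Finset.mul_sum]
  rw [e1, e2, Complex.re_ofReal_mul, Complex.re_ofReal_mul]
  ring

theorem re_V_integral (u : H1AV hA hV) :
    (∫ x, (V x : ℂ) * (u.toL2 x * conj (u.toL2 x))).re = ∫ x, V x * ‖u.toL2 x‖ ^ 2 := by
  have : ∫ x, (V x : ℂ) * (u.toL2 x * conj (u.toL2 x)) =
      ∫ x, ((V x * ‖u.toL2 x‖ ^ 2 : ℝ) : ℂ) :=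
    integral_congr_ae (.of_forall fun x => by simp [Complex.mul_conj'])
  rw [this, integral_complex_ofReal, Complex.ofReal_re]

theorem re_grad_integral_nonneg (u : H1AV hA hV) :
    0 ≤ (∫ x, hdot (u.grad x) (u.grad x)).re := by
  have : ∫ x, hdot (u.grad x) (u.grad x) = ∫ x, ((∑ j, ‖u.grad x j‖ ^ 2 : ℝ) : ℂ) :=
    integral_congr_ae (.of_forall fun x => by simp [hdot, Complex.mul_conj'])
  rw [this, integral_complex_ofReal, Complex.ofReal_re]
  exact integral_nonneg fun x => Finset.sum_nonneg fun j _ => sq_nonneg _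

theorem V_integral_nonneg (u : H1AV hA hV) : 0 ≤ ∫ x, V x * ‖u.toL2 x‖ ^ 2 :=
  integral_nonneg_of_ae (by
    filter_upwards [ae_pos hV] with x hx
    exact mul_nonneg hx.le (sq_nonneg _))

theorem inner_definite (u : H1AV hA hV) (h : inner ℝ u u = 0) : u = 0 := by
  rw [inner_def, re_V_integral] at h
  have h0 : ∫ x, V x * ‖u.toL2 x‖ ^ 2 = 0 := by
    linarith [u.V_integral_nonneg, u.re_grad_integral_nonneg]
  have hi : Integrable (fun x => V x * ‖u.toL2 x‖ ^ 2) volume := by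
    refine u.toL2_mem.1.norm.congr ?_
    filter_upwards [ae_pos hV] with x hx
    simp [abs_of_pos hx]
  rw [integral_eq_zero_iff_of_nonneg_ae (by
    filter_upwards [ae_pos hV] with x hx
    exact mul_nonneg hx.le (sq_nonneg _)) hi] at h0
  have hz : u.toL2 = 0 := by
    apply Lp.ext
    filter_upwards [h0, ae_pos hV, Lp.coeFn_zero ℂ 2 (volume : Measure (RN N))] with x hx hp hz
    rw [hz]
    simpa [hp.ne'] using hx
  exact Subtype.ext hz

/-- The scalar product of `H¹_{A,V}(ℝ^N)` makes it a real pre-Hilbert space. -/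
@[reducible] def innerCore : InnerProductSpace.Core ℝ (H1AV hA hV) where
  inner u v := inner ℝ u v
  conj_inner_symm u v := by
    simpa using inner_comm' u v
  re_inner_nonneg u := by
    change 0 ≤ inner ℝ u u
    rw [inner_def, re_V_integral]
    exact add_nonneg u.V_integral_nonneg u.re_grad_integral_nonneg
  add_left u v w := inner_add' u v w
  smul_left u v c := by
    simpa using inner_smul' u v c
  definite u h := inner_definite u h

instance : NormedAddCommGroup (H1AV hA hV) := innerCore.toNormedAddCommGroup

instance : InnerProductSpace ℝ (H1AV hA hV) := InnerProductSpace.ofCore innerCore.toCore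

end H1AV

theorem memLpLoc_zero (N : ℕ) : MemLpLoc (0 : RN N → RN N) 2 := fun _ _ => MemLp.zero

theorem electricCondition_one (N : ℕ) : ElectricCondition (1 : RN N → ℝ) := by
  refine ⟨locallyIntegrable_const 1, ?_⟩
  have h : essInf (1 : RN N → ℝ) volume = 1 :=
    essInf_const (1 : ℝ) (NeZero.ne (volume : Measure (RN N)))
  rw [h]
  exact one_pos

/-- The space `H¹(ℝ^N)` of those `u ∈ L²` whose weak gradient is in `L²`, with the scalar product
`Re ∫ u conj(v) dx + Re ∫ ∇u · conj(∇v) dx`: this is `H¹_{A,V}(ℝ^N)` for `A = 0`, `V = 1`. -/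
abbrev H1sub (N : ℕ) : Submodule ℝ (L2 N) := H1AVsub (memLpLoc_zero N) (electricCondition_one N)

/-- `H¹(ℝ^N)` with its Hilbert space structure. -/
abbrev H1 (N : ℕ) : Type := H1AV (memLpLoc_zero N) (electricCondition_one N)

/-- `u ∈ H¹(ℝ^N)` means that `u` has a weak gradient in `L²`. -/
theorem mem_H1sub_iff {N : ℕ} (u : L2 N) : u ∈ H1sub N ↔
    ∃ g : L2vec N, ∀ (φ : TestFn N) (j : Fin N),
      ∫ x, g x j * φ x = -∫ x, u x * fderiv ℝ φ x (EuclideanSpace.single j 1) := by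
  have h1 : Integrable (fun x => (((1 : RN N → ℝ) x : ℝ) : ℂ) * u x ^ 2) volume := by
    refine ((Lp.memLp u).integrable_mul (Lp.memLp u)).congr (.of_forall fun x => ?_)
    simp [pow_two]
  constructor
  · rintro ⟨_, g, hg⟩
    exact ⟨g, fun φ j => by simpa [potMul] using hg φ j⟩
  · rintro ⟨g, hg⟩
    exact ⟨h1, g, fun φ j => by simpa [potMul] using hg φ j⟩

end MagneticSobolev

end

open MagneticSobolev

namespace MagneticSobolev

open Filter Topology Set
open scoped Convolution

section Mollifiers

variable {N : ℕ} {F : Type*} [NormedAddCommGroup F] [NormedSpace ℝ F]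

/-- A sequence of smooth bumps on `ℝ^N` whose supports shrink to the origin. -/
noncomputable def bumpSeq (N n : ℕ) : ContDiffBump (0 : RN N) where
  rIn := 1 / (2 * (n + 1))
  rOut := 1 / (n + 1)
  rIn_pos := by positivity
  rIn_lt_rOut := by
    apply one_div_lt_one_div_of_lt <;> [positivity; linarith [(n.cast_nonneg : (0:ℝ) ≤ n)]]

/-- The mollification `ρ_n ⋆ f`. -/
noncomputable def mollify (n : ℕ) (f : RN N → F) : RN N → F :=
  (bumpSeq N n).normed volume ⋆[ContinuousLinearMap.lsmul ℝ ℝ, volume] f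

theorem tendsto_bumpSeq_rOut (N : ℕ) : Tendsto (fun n => (bumpSeq N n).rOut) atTop (𝓝 0) :=
  tendsto_one_div_add_atTop_nhds_zero_nat

theorem bumpSeq_rOut_le_one (N n : ℕ) : (bumpSeq N n).rOut ≤ 1 := by
  change (1 : ℝ) / (n + 1) ≤ 1
  rw [div_le_one (by positivity)]
  linarith [(n.cast_nonneg : (0:ℝ) ≤ n)]

theorem contDiff_bumpSeq_normed (N n : ℕ) {k : ℕ∞} :
    ContDiff ℝ k ((bumpSeq N n).normed volume) := (bumpSeq N n).contDiff_normed

theorem hasCompactSupport_bumpSeq_normed (N n : ℕ) :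
    HasCompactSupport ((bumpSeq N n).normed volume) := (bumpSeq N n).hasCompactSupport_normed

theorem mollify_apply (n : ℕ) (f : RN N → F) (x : RN N) :
    mollify n f x = ∫ t, (bumpSeq N n).normed volume t • f (x - t) := rfl

theorem mollify_apply' (n : ℕ) (f : RN N → F) (x : RN N) :
    mollify n f x = ∫ t, (bumpSeq N n).normed volume (x - t) • f t := by
  unfold mollify
  rw [convolution_eq_swap]
  rfl

theorem mollify_congr (n : ℕ) {f g : RN N → F} (h : f =ᵐ[volume] g) : mollify n f = mollify n g := by
  ext x
  rw [mollify_apply', mollify_apply']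
  exact integral_congr_ae (by filter_upwards [h] with t ht; rw [ht])

theorem integrable_mollify_integrand (n : ℕ) {f : RN N → F} (hf : LocallyIntegrable f volume)
    (x : RN N) : Integrable (fun t => (bumpSeq N n).normed volume t • f (x - t)) volume :=
  (hasCompactSupport_bumpSeq_normed N n).convolutionExists_left (ContinuousLinearMap.lsmul ℝ ℝ)
    (contDiff_bumpSeq_normed N n (k := 0)).continuous hf x

theorem mollify_sub (n : ℕ) {f g : RN N → F} (hf : LocallyIntegrable f volume)
    (hg : LocallyIntegrable g volume) : mollify n (f - g) = mollify n f - mollify n g := by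
  ext x
  rw [Pi.sub_apply, mollify_apply, mollify_apply, mollify_apply, ← integral_sub
    (integrable_mollify_integrand n hf x) (integrable_mollify_integrand n hg x)]
  simp [smul_sub]

theorem contDiff_mollify (n : ℕ) {f : RN N → F} (hf : LocallyIntegrable f volume) {k : ℕ∞} :
    ContDiff ℝ k (mollify n f) :=
  (hasCompactSupport_bumpSeq_normed N n).contDiff_convolution_left _
    (contDiff_bumpSeq_normed N n) hf

theorem support_mollify_subset (n : ℕ) {f : RN N → F} {K : Set (RN N)}
    (hf : Function.support f ⊆ K) :
    Function.support (mollify n f) ⊆ Metric.cthickening 1 K := by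
  intro x hx
  by_contra hK
  refine hx ?_
  rw [mollify_apply]
  refine integral_eq_zero_of_ae (.of_forall fun t => ?_)
  by_cases ht : (bumpSeq N n).normed volume t = 0
  · simp [ht]
  · have ht' : t ∈ Metric.ball (0 : RN N) (bumpSeq N n).rOut := by
      rw [← (bumpSeq N n).support_normed_eq (μ := volume)]; exact ht
    have : f (x - t) = 0 := by
      by_contra h0
      refine hK (Metric.mem_cthickening_of_dist_le x (x - t) 1 K (hf h0) ?_)
      rw [dist_eq_norm, sub_sub_cancel]
      rw [mem_ball_zero_iff] at ht'
      exact ht'.le.trans (bumpSeq_rOut_le_one N n)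
    simp [this]

theorem ae_tendsto_mollify [CompleteSpace F] {f : RN N → F} (hf : LocallyIntegrable f volume) :
    ∀ᵐ x, Tendsto (fun n => mollify n f x) atTop (𝓝 (f x)) :=
  ContDiffBump.ae_convolution_tendsto_right_of_locallyIntegrable (K := 2)
    (tendsto_bumpSeq_rOut N) (.of_forall fun n => by
      change (1 : ℝ) / (n + 1) ≤ 2 * (1 / (2 * (n + 1)))
      apply le_of_eq; field_simp) hf

/-- Mollification is averaging against a probability measure. -/
noncomputable def bumpMeasure (N n : ℕ) : Measure (RN N) :=
  volume.withDensity fun t => ENNReal.ofReal ((bumpSeq N n).normed volume t)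

theorem measurable_bumpDensity (N n : ℕ) :
    Measurable fun t => ENNReal.ofReal ((bumpSeq N n).normed volume t) :=
  ((contDiff_bumpSeq_normed N n (k := 0)).continuous.measurable).ennreal_ofReal

instance (N n : ℕ) : IsProbabilityMeasure (bumpMeasure N n) := by
  constructor
  rw [bumpMeasure, withDensity_apply _ MeasurableSet.univ, Measure.restrict_univ,
    ← ofReal_integral_eq_lintegral_ofReal (bumpSeq N n).integrable_normed
      (.of_forall (bumpSeq N n).nonneg_normed), (bumpSeq N n).integral_normed, ENNReal.ofReal_one]

theorem enorm_mollify_le (n : ℕ) {f : RN N → F} (hf : StronglyMeasurable f) (x : RN N) :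
    ‖mollify n f x‖ₑ ≤ ∫⁻ t, ‖f (x - t)‖ₑ ∂bumpMeasure N n := by
  have hm : Measurable fun t => ‖f (x - t)‖ₑ :=
    hf.enorm.comp (measurable_const.sub measurable_id)
  rw [mollify_apply, bumpMeasure, lintegral_withDensity_eq_lintegral_mul _
    (measurable_bumpDensity N n) hm]
  refine (enorm_integral_le_lintegral_enorm _).trans (lintegral_mono fun t => ?_)
  rw [enorm_smul, Real.enorm_of_nonneg ((bumpSeq N n).nonneg_normed t)]
  rfl

theorem enorm_mollify_rpow_le (n : ℕ) {p : ℝ≥0∞} (hp : 1 ≤ p) (hp' : p ≠ ∞) {f : RN N → F}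
    (hf : StronglyMeasurable f) (x : RN N) :
    ‖mollify n f x‖ₑ ^ p.toReal ≤ ∫⁻ t, ‖f (x - t)‖ₑ ^ p.toReal ∂bumpMeasure N n := by
  have hm : StronglyMeasurable fun t => f (x - t) :=
    hf.comp_measurable (measurable_const.sub measurable_id)
  have h0 : p ≠ 0 := (one_pos.trans_le hp).ne'
  have h := eLpNorm_le_eLpNorm_of_exponent_le hp (μ := bumpMeasure N n) hm.aestronglyMeasurable
  rw [eLpNorm_one_eq_lintegral_enorm] at h
  have h2 := (enorm_mollify_le n hf x).trans h
  rw [eLpNorm_eq_lintegral_rpow_enorm_toReal h0 hp'] at h2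
  have hpos : 0 < p.toReal := ENNReal.toReal_pos h0 hp'
  calc _ ≤ _ := ENNReal.rpow_le_rpow h2 hpos.le
    _ = _ := by rw [← ENNReal.rpow_mul, one_div, inv_mul_cancel₀ hpos.ne', ENNReal.rpow_one]

theorem eLpNorm_mollify_le (n : ℕ) {p : ℝ≥0∞} (hp : 1 ≤ p) (hp' : p ≠ ∞) {f : RN N → F}
    (hf : AEStronglyMeasurable f volume) :
    eLpNorm (mollify n f) p volume ≤ eLpNorm f p volume := by
  have h0 : p ≠ 0 := (one_pos.trans_le hp).ne'
  rw [mollify_congr n hf.ae_eq_mk, eLpNorm_congr_ae hf.ae_eq_mk]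
  have hg := hf.stronglyMeasurable_mk
  set g := hf.mk f
  rw [eLpNorm_eq_lintegral_rpow_enorm_toReal h0 hp', eLpNorm_eq_lintegral_rpow_enorm_toReal h0 hp']
  refine ENNReal.rpow_le_rpow ?_ (by positivity)
  calc ∫⁻ x, ‖mollify n g x‖ₑ ^ p.toReal
      ≤ ∫⁻ x, ∫⁻ t, ‖g (x - t)‖ₑ ^ p.toReal ∂bumpMeasure N n :=
        lintegral_mono fun x => enorm_mollify_rpow_le n hp hp' hg x
    _ = ∫⁻ t, (∫⁻ x, ‖g (x - t)‖ₑ ^ p.toReal) ∂bumpMeasure N n := by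
        have hm : Measurable fun z : RN N × RN N => ‖g (z.1 - z.2)‖ₑ ^ p.toReal :=
          (hg.enorm.comp (measurable_fst.sub measurable_snd)).pow_const _
        exact lintegral_lintegral_swap hm.aemeasurable
    _ = ∫⁻ x, ‖g x‖ₑ ^ p.toReal := by
        have h (t : RN N) : ∫⁻ x, ‖g (x - t)‖ₑ ^ p.toReal = ∫⁻ x, ‖g x‖ₑ ^ p.toReal :=
          lintegral_sub_right_eq_self (fun x => ‖g x‖ₑ ^ p.toReal) t
        simp [h]

theorem memLp_mollify (n : ℕ) {p : ℝ≥0∞} (hp : 1 ≤ p) (hp' : p ≠ ∞) {f : RN N → F}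
    (hf : MemLp f p volume) : MemLp (mollify n f) p volume :=
  ⟨(contDiff_mollify n (hf.locallyIntegrable hp) (k := 0)).continuous.aestronglyMeasurable,
    (eLpNorm_mollify_le n hp hp' hf.1).trans_lt hf.2⟩

theorem norm_mollify_le (n : ℕ) {f : RN N → F} {C : ℝ} (hf : ∀ x, ‖f x‖ ≤ C) (x : RN N) :
    ‖mollify n f x‖ ≤ C := by
  rw [mollify_apply]
  calc _ ≤ ∫ t, (bumpSeq N n).normed volume t * C := by
        refine norm_integral_le_of_norm_le ((bumpSeq N n).integrable_normed.mul_const C)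
          (.of_forall fun t => ?_)
        rw [norm_smul, Real.norm_of_nonneg ((bumpSeq N n).nonneg_normed t)]
        exact mul_le_mul_of_nonneg_left (hf _) ((bumpSeq N n).nonneg_normed t)
    _ = C := by rw [integral_mul_const, (bumpSeq N n).integral_normed, one_mul]

theorem eventually_norm_mollify_sub_le [CompleteSpace F] {f : RN N → F} (hf : UniformContinuous f)
    {ε : ℝ} (hε : 0 < ε) :
    ∀ᶠ n in atTop, ∀ x, ‖mollify n f x - f x‖ ≤ ε := by
  obtain ⟨δ, hδ, h⟩ := Metric.uniformContinuous_iff.1 hf ε hε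
  filter_upwards [(tendsto_bumpSeq_rOut N).eventually_lt_const hδ] with n hn x
  rw [← dist_eq_norm]
  refine ContDiffBump.dist_normed_convolution_le hf.continuous.aestronglyMeasurable
    fun y hy => (h ?_).le
  exact (Metric.mem_ball.1 hy).trans hn

theorem tendsto_eLpNorm_mollify_sub [CompleteSpace F] {p : ℝ≥0∞} (hp : 1 ≤ p) (hp' : p ≠ ∞)
    {f : RN N → F} (hf : MemLp f p volume) :
    Tendsto (fun n => eLpNorm (mollify n f - f) p volume) atTop (𝓝 0) := by
  have h0 : p ≠ 0 := (one_pos.trans_le hp).ne'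
  rw [ENNReal.tendsto_atTop_zero]
  intro ε hε
  obtain ⟨δ, hδ, hδε⟩ : ∃ δ : ℝ≥0∞, δ ≠ 0 ∧ δ + δ + δ ≤ ε := by
    refine ⟨ε / 3, (ENNReal.div_pos hε.ne' (by simp)).ne', le_of_eq ?_⟩
    exact ENNReal.add_thirds ε
  obtain ⟨g, hgs, hg, hgc, hgm⟩ := hf.exists_hasCompactSupport_eLpNorm_sub_le hp' hδ
  set K := Metric.cthickening 1 (tsupport g)
  have hK : IsCompact K := hgs.isCompact.cthickening
  have hKfin : volume K ^ p.toReal⁻¹ ≠ ∞ :=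
    ENNReal.rpow_ne_top_of_nonneg (by positivity) hK.measure_lt_top.ne
  obtain ⟨η, hη, hηδ⟩ : ∃ η : ℝ, 0 < η ∧ volume K ^ p.toReal⁻¹ * ENNReal.ofReal η ≤ δ := by
    have ht : Tendsto (fun η : ℝ => volume K ^ p.toReal⁻¹ * ENNReal.ofReal η) (𝓝[>] 0) (𝓝 0) := by
      have h1 : Tendsto (fun η : ℝ => ENNReal.ofReal η) (𝓝[>] 0) (𝓝 0) := by
        simpa using (ENNReal.continuous_ofReal.tendsto 0).mono_left nhdsWithin_le_nhds
      simpa using ENNReal.Tendsto.const_mul h1 (.inr hKfin)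
    obtain ⟨η, h1, h2⟩ := ((ht.eventually (ge_mem_nhds (pos_iff_ne_zero.2 hδ))).and
      self_mem_nhdsWithin).exists
    exact ⟨η, h2, h1⟩
  have hunif := eventually_norm_mollify_sub_le
    (hgc.uniformContinuous_of_tendsto_cocompact (x := 0) hgs.is_zero_at_infty) hη
  obtain ⟨n₀, hn₀⟩ := eventually_atTop.1 hunif
  refine ⟨n₀, fun n hn => le_trans ?_ hδε⟩
  have hfl := hf.locallyIntegrable hp
  have hgl := hgm.locallyIntegrable hp
  have hdec : mollify n f - f = mollify n (f - g) +
      (mollify n g - g) + (g - f) := by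
    rw [mollify_sub n hfl hgl]; abel
  have m1 : AEStronglyMeasurable (mollify n (f - g)) volume :=
    (memLp_mollify n hp hp' (hf.sub hgm)).1
  have m2 : AEStronglyMeasurable (mollify n g - g) volume :=
    (memLp_mollify n hp hp' hgm).1.sub hgm.1
  rw [hdec]
  refine (eLpNorm_add_le (m1.add m2) (hgm.1.sub hf.1) hp).trans ?_
  refine add_le_add ((eLpNorm_add_le m1 m2 hp).trans (add_le_add ?_ ?_)) ?_
  · exact (eLpNorm_mollify_le n hp hp' (hf.1.sub hgm.1)).trans hg
  · have hs : Function.support (mollify n g - g) ⊆ K := by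
      refine (Function.support_sub _ _).trans (union_subset ?_ ?_)
      · exact support_mollify_subset n (subset_tsupport g)
      · exact (subset_tsupport g).trans (Metric.self_subset_cthickening _)
    rw [← eLpNorm_restrict_eq_of_support_subset hs]
    refine (eLpNorm_le_of_ae_bound (.of_forall fun x => hn₀ n hn x)).trans ?_
    rwa [Measure.restrict_apply_univ]
  · rw [eLpNorm_sub_comm]; exact hg

end Mollifiers

section WeakGradient

variable {N : ℕ}

theorem tendsto_lintegral_mollify_sub_of_locallyIntegrable {F : Type*} [NormedAddCommGroup F]
    [NormedSpace ℝ F] [CompleteSpace F] {f : RN N → F}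
    (hf : LocallyIntegrable f volume) {K : Set (RN N)} (hK : IsCompact K) :
    Tendsto (fun n => ∫⁻ x in K, ‖mollify n f x - f x‖ₑ) atTop (𝓝 0) := by
  set K' := Metric.cthickening 1 K
  have hK' : IsCompact K' := hK.cthickening
  have hi : Integrable (K'.indicator f) volume :=
    (integrable_indicator_iff hK'.measurableSet).2 (hf.integrableOn_isCompact hK')
  have ht := tendsto_eLpNorm_mollify_sub le_rfl ENNReal.one_ne_top (memLp_one_iff_integrable.2 hi)
  refine tendsto_of_tendsto_of_tendsto_of_le_of_le tendsto_const_nhds ht (fun _ => zero_le)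
    fun n => ?_
  have heq : ∀ x ∈ K, mollify n f x - f x = mollify n (K'.indicator f) x - K'.indicator f x := by
    intro x hx
    rw [indicator_of_mem (Metric.self_subset_cthickening _ hx)]
    congr 1
    refine integral_congr_ae (.of_forall fun t => ?_)
    change (bumpSeq N n).normed volume t • f (x - t) =
      (bumpSeq N n).normed volume t • K'.indicator f (x - t)
    by_cases h : (bumpSeq N n).normed volume t = 0
    · simp [h]
    · have ht' : t ∈ Metric.ball (0 : RN N) (bumpSeq N n).rOut := by
        rw [← (bumpSeq N n).support_normed_eq (μ := volume)]; exact h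
      rw [indicator_of_mem]
      refine Metric.mem_cthickening_of_dist_le (x - t) x 1 K hx ?_
      rw [dist_eq_norm, sub_sub_cancel_left, norm_neg]
      rw [mem_ball_zero_iff] at ht'
      exact ht'.le.trans (bumpSeq_rOut_le_one N n)
  calc ∫⁻ x in K, ‖mollify n f x - f x‖ₑ
      = ∫⁻ x in K, ‖mollify n (K'.indicator f) x - K'.indicator f x‖ₑ :=
        setLIntegral_congr_fun hK.measurableSet fun x hx => by rw [heq x hx]
    _ ≤ ∫⁻ x, ‖mollify n (K'.indicator f) x - K'.indicator f x‖ₑ := setLIntegral_le_lintegral _ _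
    _ = _ := by rw [eLpNorm_one_eq_lintegral_enorm]; rfl

theorem locallyIntegrable_norm {F : Type*} [NormedAddCommGroup F] {f : RN N → F}
    (hf : LocallyIntegrable f volume) : LocallyIntegrable (fun x => ‖f x‖) volume := fun x =>
  let ⟨s, hs, h⟩ := hf x
  ⟨s, hs, h.norm⟩

/-- A smooth compactly supported function as a test function on the whole space. -/
noncomputable def testFnMk (f : RN N → ℂ) (hf : ContDiff ℝ (⊤ : ℕ∞) f)
    (hs : HasCompactSupport f) : TestFn N where
  toFun := f
  contDiff' := hf
  hasCompactSupport' := hs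
  tsupport_subset' := fun _ _ => trivial

theorem coe_testFnMk {f : RN N → ℂ} (hf : ContDiff ℝ (⊤ : ℕ∞) f)
    (hs : HasCompactSupport f) : (testFnMk f hf hs : RN N → ℂ) = f := rfl

/-- The unit vector `e_j`. -/
noncomputable abbrev unitVec (j : Fin N) : RN N := EuclideanSpace.single j 1

/-- `∇ u = g` in the sense of distributions. -/
def HasWeakGradient (u : RN N → ℂ) (g : RN N → CN N) : Prop :=
  ∀ (φ : TestFn N) (j : Fin N),
    ∫ x, g x j * φ x = -∫ x, u x * fderiv ℝ φ x (unitVec j)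

theorem HasWeakGradient.congr {u u' : RN N → ℂ} {g g' : RN N → CN N} (h : HasWeakGradient u g)
    (hu : u =ᵐ[volume] u') (hg : g =ᵐ[volume] g') : HasWeakGradient u' g' := by
  intro φ j
  have e1 : ∫ x, g' x j * φ x = ∫ x, g x j * φ x :=
    integral_congr_ae (by filter_upwards [hg] with x hx; rw [hx])
  have e2 : ∫ x, u' x * fderiv ℝ φ x (unitVec j) = ∫ x, u x * fderiv ℝ φ x (unitVec j) :=
    integral_congr_ae (by filter_upwards [hu] with x hx; rw [hx])
  rw [e1, e2, h φ j]

theorem hasMagneticGradient_iff {A : RN N → RN N} {u : RN N → ℂ} {g : RN N → CN N}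
    (hg : ∀ j, LocallyIntegrable (fun x => g x j) volume)
    (hA : ∀ j, LocallyIntegrable (fun x => Complex.I * potMul A u x j) volume) :
    HasMagneticGradient A u g ↔ HasWeakGradient u fun x => g x - Complex.I • potMul A u x := by
  refine forall₂_congr fun φ j => ?_
  have e : ∫ x, (g x - Complex.I • potMul A u x) j * φ x =
      (∫ x, g x j * φ x) - ∫ x, Complex.I * potMul A u x j * φ x := by
    rw [← integral_sub (integrable_mul_testFn (hg j) φ) (integrable_mul_testFn (hA j) φ)]
    exact integral_congr_ae (.of_forall fun x => by simp [sub_mul])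
  rw [e, sub_eq_iff_eq_add]

theorem fderiv_mollify_apply (n : ℕ) {u : RN N → ℂ} {g : RN N → CN N}
    (hu : LocallyIntegrable u volume) (h : HasWeakGradient u g) (x : RN N) (j : Fin N) :
    fderiv ℝ (mollify n u) x (unitVec j) = mollify n (fun y => g y j) x := by
  set ρ := (bumpSeq N n).normed (volume : Measure (RN N))
  have hρ : ContDiff ℝ (⊤ : ℕ∞) ρ := contDiff_bumpSeq_normed N n
  have hρs : HasCompactSupport ρ := hasCompactSupport_bumpSeq_normed N n
  have hd := hρs.hasFDerivAt_convolution_left (μ := volume) (ContinuousLinearMap.lsmul ℝ ℝ)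
    (hρ.of_le (by simp)) hu x
  have hd' : fderiv ℝ (mollify n u) x = _ := hd.fderiv
  rw [hd', convolution_eq_swap, ContinuousLinearMap.integral_apply]
  · set ψ : RN N → ℂ := fun t => (ρ (x - t) : ℂ)
    have hψ : ContDiff ℝ (⊤ : ℕ∞) ψ :=
      Complex.ofRealCLM.contDiff.comp (hρ.comp (contDiff_const.sub contDiff_id))
    have hψs : HasCompactSupport ψ := by
      have : HasCompactSupport fun t => ρ (x - t) :=
        hρs.comp_homeomorph (Homeomorph.subLeft x)
      exact this.comp_left (g := Complex.ofReal) (by simp)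
    have := h (testFnMk ψ hψ hψs) j
    have hder : ∀ t, fderiv ℝ ψ t (unitVec j) = -((fderiv ℝ ρ (x - t) (unitVec j) : ℝ) : ℂ) := by
      intro t
      have h1 : HasFDerivAt ρ (fderiv ℝ ρ (x - t)) (x - t) :=
        (hρ.differentiable (by simp) _).hasFDerivAt
      have h2 : HasFDerivAt (fun t => ρ (x - t)) _ t :=
        h1.comp t ((hasFDerivAt_const x t).sub (hasFDerivAt_id t))
      have h3 : HasFDerivAt ψ _ t := Complex.ofRealCLM.hasFDerivAt.comp t h2
      rw [h3.fderiv]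
      simp
    rw [mollify_apply']
    rw [coe_testFnMk] at this
    simp only [hder, mul_neg, integral_neg, neg_neg] at this
    calc _ = ∫ t, u t * ((fderiv ℝ ρ (x - t) (unitVec j) : ℝ) : ℂ) :=
          integral_congr_ae (.of_forall fun t => by
            simp [ContinuousLinearMap.precompL_apply, mul_comm])
      _ = ∫ t, g t j * ψ t := this.symm
      _ = _ := integral_congr_ae (.of_forall fun t => by
            simp [ψ, ρ, mul_comm])
  · have := (hρs.fderiv (𝕜 := ℝ)).convolutionExists_left (μ := volume)
      ((ContinuousLinearMap.lsmul ℝ ℝ).precompL (RN N)) (hρ.continuous_fderiv (by simp)) hu x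
    exact this.integrable_swap

theorem hasWeakGradient_of_contDiff {f : RN N → ℂ} (hf : ContDiff ℝ 1 f) :
    HasWeakGradient f fun x => WithLp.toLp 2 fun j => fderiv ℝ f x (unitVec j) := by
  intro φ j
  have hc : Continuous fun x => fderiv ℝ f x (unitVec j) :=
    (hf.continuous_fderiv one_ne_zero).clm_apply continuous_const
  have h := integral_mul_fderiv_eq_neg_fderiv_mul_of_integrable (μ := volume) (f := f) (g := φ)
    (v := unitVec j) (integrable_mul_testFn hc.locallyIntegrable φ)
    (integrable_mul_fderiv hf.continuous.locallyIntegrable φ _)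
    (integrable_mul_testFn hf.continuous.locallyIntegrable φ)
    (fun x _ => hf.differentiable one_ne_zero x)
    (fun x _ => φ.contDiff.differentiable (by simp) x)
  rw [h, neg_neg]

theorem HasWeakGradient.smul {u : RN N → ℂ} {g : RN N → CN N} (hu : LocallyIntegrable u volume)
    (hg : ∀ j, LocallyIntegrable (fun x => g x j) volume) (h : HasWeakGradient u g)
    {χ : RN N → ℝ} (hχ : ContDiff ℝ (⊤ : ℕ∞) χ) :
    HasWeakGradient (fun x => (χ x : ℂ) * u x)
      fun x => WithLp.toLp 2 fun j => (χ x : ℂ) * g x j + (fderiv ℝ χ x (unitVec j) : ℂ) * u x := by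
  intro φ j
  have hχ' : ContDiff ℝ (⊤ : ℕ∞) fun x => (χ x : ℂ) := Complex.ofRealCLM.contDiff.comp hχ
  have hs : HasCompactSupport fun x => (χ x : ℂ) * φ x := φ.hasCompactSupport.mul_left
  have hφ : ContDiff ℝ (⊤ : ℕ∞) φ := φ.contDiff
  have key := h (testFnMk _ (hχ'.mul hφ) hs) j
  rw [coe_testFnMk] at key
  have hcd : Continuous fun x => (fderiv ℝ χ x (unitVec j) : ℂ) := Complex.continuous_ofReal.comp
    ((hχ.continuous_fderiv (by simp)).clm_apply continuous_const)
  have hder : ∀ x, fderiv ℝ (fun x => (χ x : ℂ) * φ x) x (unitVec j) =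
      (χ x : ℂ) * fderiv ℝ φ x (unitVec j) + (fderiv ℝ χ x (unitVec j) : ℂ) * φ x := by
    intro x
    have h1 : HasFDerivAt (fun x => (χ x : ℂ)) _ x :=
      Complex.ofRealCLM.hasFDerivAt.comp x (hχ.differentiable (by simp) x).hasFDerivAt
    have h2 : HasFDerivAt φ (fderiv ℝ φ x) x := (hφ.differentiable (by simp) x).hasFDerivAt
    have h3 : HasFDerivAt (fun x => (χ x : ℂ) * φ x) _ x := h1.mul h2
    rw [h3.fderiv]
    simp [mul_comm]
  simp only [hder] at key
  have i1 : Integrable (fun x => u x * ((χ x : ℂ) * fderiv ℝ φ x (unitVec j))) volume := by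
    have := hu.integrable_smul_right_of_hasCompactSupport
      (hχ'.continuous.mul ((φ.contDiff.continuous_fderiv (by simp)).clm_apply continuous_const))
      (HasCompactSupport.mul_left (f := fun x => (χ x : ℂ))
        (φ.hasCompactSupport.fderiv_apply (𝕜 := ℝ) (unitVec j)))
    simpa [smul_eq_mul] using this
  have i2 : Integrable (fun x => u x * ((fderiv ℝ χ x (unitVec j) : ℂ) * φ x)) volume := by
    have := hu.integrable_smul_right_of_hasCompactSupport (hcd.mul φ.continuous)
      (HasCompactSupport.mul_left (f := fun x => (fderiv ℝ χ x (unitVec j) : ℂ))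
        φ.hasCompactSupport)
    simpa [smul_eq_mul] using this
  simp only [mul_add] at key
  rw [integral_add i1 i2] at key
  have hi : Integrable (fun x => g x j * ((χ x : ℂ) * φ x)) volume := by
    have := (hg j).integrable_smul_right_of_hasCompactSupport (hχ'.continuous.mul φ.continuous) hs
    simpa [smul_eq_mul] using this
  have e1 : ∫ x, ((χ x : ℂ) * g x j + (fderiv ℝ χ x (unitVec j) : ℂ) * u x) * φ x =
      (∫ x, g x j * ((χ x : ℂ) * φ x)) + ∫ x, u x * ((fderiv ℝ χ x (unitVec j) : ℂ) * φ x) := by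
    rw [← integral_add hi i2]
    exact integral_congr_ae (.of_forall fun x => by ring)
  have e2 : ∫ x, (χ x : ℂ) * u x * fderiv ℝ φ x (unitVec j) =
      ∫ x, u x * ((χ x : ℂ) * fderiv ℝ φ x (unitVec j)) :=
    integral_congr_ae (.of_forall fun x => by ring)
  change ∫ x, ((χ x : ℂ) * g x j + (fderiv ℝ χ x (unitVec j) : ℂ) * u x) * φ x = _
  rw [e1, e2, key]
  ring

/-- If `f_n → f` in `L¹(K)`, with `K` the support of a test function `φ`, and if `‖F_n - F‖` is
controlled by `‖f_n - f‖ |φ|`, then the integrals converge. -/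
theorem tendsto_integral_of_le_mul_mollify_sub {f : RN N → ℂ} (hf : LocallyIntegrable f volume)
    {φ : RN N → ℂ} (hφ : Continuous φ) (hφs : HasCompactSupport φ) {L : ℝ} {F : ℕ → RN N → ℂ}
    {G : RN N → ℂ} (hF : ∀ n, Integrable (F n) volume) (hG : Integrable G volume)
    (h : ∀ n x, ‖F n x - G x‖ ≤ L * ‖mollify n f x - f x‖ * ‖φ x‖) :
    Tendsto (fun n => ∫ x, F n x) atTop (𝓝 (∫ x, G x)) := by
  obtain ⟨C, hC⟩ := hφ.bounded_above_of_compact_support hφs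
  refine tendsto_integral_of_L1 G hG.1 (.of_forall hF) ?_
  have ht := ENNReal.Tendsto.const_mul (a := ENNReal.ofReal (|L| * C))
    (tendsto_lintegral_mollify_sub_of_locallyIntegrable hf hφs) (.inr ENNReal.ofReal_ne_top)
  rw [mul_zero] at ht
  refine tendsto_of_tendsto_of_tendsto_of_le_of_le tendsto_const_nhds ht (fun _ => zero_le)
    fun n => ?_
  rw [← lintegral_const_mul' _ _ ENNReal.ofReal_ne_top,
    ← lintegral_indicator (isClosed_tsupport φ).measurableSet]
  refine lintegral_mono fun x => ?_
  by_cases hx : x ∈ tsupport φ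
  · rw [indicator_of_mem hx]
    rw [← ofReal_norm, ← ofReal_norm, ← ENNReal.ofReal_mul
      (mul_nonneg (abs_nonneg _) ((norm_nonneg _).trans (hC x)))]
    refine ENNReal.ofReal_le_ofReal ((h n x).trans ?_)
    calc L * ‖mollify n f x - f x‖ * ‖φ x‖ ≤ |L| * ‖mollify n f x - f x‖ * C := by
          gcongr
          · exact le_abs_self L
          · exact hC x
      _ = _ := by ring
  · have h0 : φ x = 0 := image_eq_zero_of_notMem_tsupport hx
    have := h n x
    rw [h0, norm_zero, mul_zero] at this
    rw [indicator_of_notMem hx, norm_le_zero_iff.1 this, enorm_zero]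

/-- The chain rule for a `C¹` map with bounded derivative. -/
theorem HasWeakGradient.comp {u : RN N → ℂ} {g : RN N → CN N} (hu : LocallyIntegrable u volume)
    (hg : ∀ j, LocallyIntegrable (fun x => g x j) volume) (h : HasWeakGradient u g)
    {F : ℂ → ℂ} {DF : ℂ → ℂ →L[ℝ] ℂ} (hF : ∀ z, HasFDerivAt F (DF z) z) (hDF : Continuous DF)
    {L : ℝ} (hL : ∀ z, ‖DF z‖ ≤ L) :
    HasWeakGradient (fun x => F (u x)) fun x => WithLp.toLp 2 fun j => DF (u x) (g x j) := by
  intro φ j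
  have hL0 : 0 ≤ L := (norm_nonneg _).trans (hL 0)
  have hFc : Continuous F := continuous_iff_continuousAt.2 fun z => (hF z).continuousAt
  have hLip : ∀ z w, ‖F z - F w‖ ≤ L * ‖z - w‖ := fun z w =>
    Convex.norm_image_sub_le_of_norm_hasFDerivWithin_le (s := univ)
      (fun x _ => (hF x).hasFDerivWithinAt) (fun x _ => hL x) convex_univ trivial trivial
  have hum (n : ℕ) : ContDiff ℝ 1 (mollify n u) := contDiff_mollify n hu (k := 1)
  have hgm (n : ℕ) : Continuous (mollify n fun y => g y j) :=
    (contDiff_mollify n (hg j) (k := 0)).continuous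
  have hFu : LocallyIntegrable (fun x => F (u x)) volume := by
    have h1 : LocallyIntegrable (fun x => ‖F 0‖ + L * ‖u x‖) volume :=
      (locallyIntegrable_const _).add ((locallyIntegrable_norm hu).smul L)
    refine h1.mono (hFc.comp_aestronglyMeasurable hu.aestronglyMeasurable) (.of_forall fun x => ?_)
    have := hLip (u x) 0
    rw [sub_zero] at this
    calc ‖F (u x)‖ = ‖F 0 + (F (u x) - F 0)‖ := by rw [add_sub_cancel]
      _ ≤ ‖F 0‖ + L * ‖u x‖ := (norm_add_le _ _).trans (by gcongr)
      _ ≤ _ := le_abs_self _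
  have hDc : Continuous fun z : ℂ × ℂ => DF z.1 z.2 :=
    (hDF.comp continuous_fst).clm_apply continuous_snd
  have hDg {w : RN N → ℂ} (hw : AEStronglyMeasurable w volume) :
      LocallyIntegrable (fun x => DF (w x) (g x j)) volume := by
    refine ((locallyIntegrable_norm (hg j)).smul L).mono
      (hDc.comp_aestronglyMeasurable (hw.prodMk (hg j).aestronglyMeasurable))
      (.of_forall fun x => ?_)
    calc ‖DF (w x) (g x j)‖ ≤ L * ‖g x j‖ := (DF (w x)).le_of_opNorm_le (hL _) _
      _ ≤ _ := le_abs_self _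
  -- the identity for the mollifications
  have key (n : ℕ) : ∫ x, DF (mollify n u x) (mollify n (fun y => g y j) x) * φ x =
      -∫ x, F (mollify n u x) * fderiv ℝ φ x (unitVec j) := by
    have hd (x : RN N) : HasFDerivAt (fun x => F (mollify n u x))
        ((DF (mollify n u x)).comp (fderiv ℝ (mollify n u) x)) x :=
      (hF _).comp x ((hum n).differentiable one_ne_zero x).hasFDerivAt
    have hd' (x : RN N) : fderiv ℝ (fun x => F (mollify n u x)) x (unitVec j) =
        DF (mollify n u x) (mollify n (fun y => g y j) x) := by
      rw [(hd x).fderiv, ContinuousLinearMap.comp_apply, fderiv_mollify_apply n hu h]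
    have hc : Continuous fun x => DF (mollify n u x) (mollify n (fun y => g y j) x) :=
      hDc.comp ((hum n).continuous.prodMk (hgm n))
    have h := integral_mul_fderiv_eq_neg_fderiv_mul_of_integrable (μ := volume)
      (f := fun x => F (mollify n u x)) (g := φ) (v := unitVec j)
      (by simp_rw [hd']; exact integrable_mul_testFn hc.locallyIntegrable φ)
      (integrable_mul_fderiv (hFc.comp (hum n).continuous).locallyIntegrable φ _)
      (integrable_mul_testFn (hFc.comp (hum n).continuous).locallyIntegrable φ)
      (fun x _ => (hd x).differentiableAt)
      (fun x _ => φ.contDiff.differentiable (by simp) x)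
    rw [h, neg_neg]
    simp_rw [hd']
  have hdφ : Continuous fun x => fderiv ℝ φ x (unitVec j) :=
    (φ.contDiff.continuous_fderiv (by simp)).clm_apply continuous_const
  have lim1 : Tendsto (fun n => ∫ x, F (mollify n u x) * fderiv ℝ φ x (unitVec j)) atTop
      (𝓝 (∫ x, F (u x) * fderiv ℝ φ x (unitVec j))) :=
    tendsto_integral_of_le_mul_mollify_sub hu hdφ
      (φ.hasCompactSupport.fderiv_apply (𝕜 := ℝ) (unitVec j)) (L := L)
      (fun n => integrable_mul_fderiv (hFc.comp (hum n).continuous).locallyIntegrable φ _)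
      (integrable_mul_fderiv hFu φ _) fun n x => by
        rw [← sub_mul, norm_mul]
        gcongr
        exact hLip _ _
  have lim2 : Tendsto (fun n => ∫ x, (DF (mollify n u x) (mollify n (fun y => g y j) x) * φ x -
      DF (mollify n u x) (g x j) * φ x)) atTop (𝓝 (∫ _ : RN N, (0 : ℂ))) :=
    tendsto_integral_of_le_mul_mollify_sub (hg j) φ.continuous φ.hasCompactSupport (L := L)
      (fun n => (integrable_mul_testFn
        (hDc.comp ((hum n).continuous.prodMk (hgm n))).locallyIntegrable φ).sub
          (integrable_mul_testFn (hDg (hum n).continuous.aestronglyMeasurable) φ))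
      (integrable_zero _ _ _) fun n x => by
        rw [sub_zero, ← sub_mul, ← map_sub, norm_mul]
        gcongr
        exact (DF _).le_of_opNorm_le (hL _) _
  have lim3 : Tendsto (fun n => ∫ x, DF (mollify n u x) (g x j) * φ x) atTop
      (𝓝 (∫ x, DF (u x) (g x j) * φ x)) := by
    refine tendsto_integral_of_dominated_convergence (fun x => L * ‖g x j * φ x‖)
      (fun n => (integrable_mul_testFn (hDg (hum n).continuous.aestronglyMeasurable) φ).1)
      ((integrable_mul_testFn (hg j) φ).norm.const_mul L) (fun n => .of_forall fun x => ?_) ?_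
    · rw [norm_mul, norm_mul, ← mul_assoc]
      gcongr
      exact (DF _).le_of_opNorm_le (hL _) _
    · filter_upwards [ae_tendsto_mollify hu] with x hx
      exact ((hDc.tendsto (u x, g x j)).comp (hx.prodMk_nhds tendsto_const_nhds)).mul_const _
  have lim4 : Tendsto (fun n => ∫ x, DF (mollify n u x) (mollify n (fun y => g y j) x) * φ x) atTop
      (𝓝 (∫ x, DF (u x) (g x j) * φ x)) := by
    have := lim2.add lim3
    rw [integral_zero, zero_add] at this
    refine this.congr fun n => ?_
    have hc : Continuous fun x => DF (mollify n u x) (mollify n (fun y => g y j) x) :=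
      hDc.comp ((hum n).continuous.prodMk (hgm n))
    rw [integral_sub (integrable_mul_testFn hc.locallyIntegrable φ)
          (integrable_mul_testFn (hDg (hum n).continuous.aestronglyMeasurable) φ), sub_add_cancel]
  exact tendsto_nhds_unique lim4 (by simp_rw [key]; exact lim1.neg)

end WeakGradient

section Sobolev

variable {N : ℕ}

theorem eLpNorm_fderiv_le_of_support_subset_closedBall {f : RN N → ℂ} (hf : ContDiff ℝ 1 f)
    {a : RN N} {R : ℝ} (hs : Function.support f ⊆ Metric.closedBall a R) {r : ℝ≥0∞} (hr : r ≤ 2) :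
    eLpNorm (fderiv ℝ f) r volume ≤ eLpNorm (fderiv ℝ f) 2 volume *
      volume (Metric.closedBall (0 : RN N) R) ^ (1 / r.toReal - 1 / (2 : ℝ≥0∞).toReal) := by
  have hs' : Function.support (fun x => ‖fderiv ℝ f x‖) ⊆ Metric.closedBall a R := by
    refine (Function.support_comp_subset norm_zero _).trans ?_
    exact (support_fderiv_subset ℝ).trans (closure_minimal hs Metric.isClosed_closedBall)
  have e (q : ℝ≥0∞) : eLpNorm (fun x => ‖fderiv ℝ f x‖) q
      (volume.restrict (Metric.closedBall a R)) = eLpNorm (fderiv ℝ f) q volume := by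
    rw [eLpNorm_restrict_eq_of_support_subset hs', eLpNorm_norm]
  rw [← e r, ← e 2, ← Measure.addHaar_closedBall_center volume a, ← Measure.restrict_apply_univ]
  exact eLpNorm_le_eLpNorm_mul_rpow_measure_univ hr
    (hf.continuous_fderiv one_ne_zero).norm.aestronglyMeasurable

theorem eLpNorm_top_le_eLpNorm_fderiv_one {f : RN 1 → ℂ} (hf : ContDiff ℝ 1 f)
    (hs : HasCompactSupport f) : eLpNorm f ∞ volume ≤ eLpNorm (fderiv ℝ f) 1 volume := by
  let e : ℝ ≃ₗᵢ[ℝ] RN 1 :=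
    { toFun := fun t => WithLp.toLp 2 fun _ => t
      invFun := fun x => x 0
      map_add' := fun _ _ => rfl
      map_smul' := fun _ _ => rfl
      left_inv := fun _ => rfl
      right_inv := fun x => by ext i; rw [Subsingleton.elim i 0]
      norm_map' := fun t => by
        change ‖(WithLp.toLp 2 fun _ => t : RN 1)‖ = ‖t‖
        simp [EuclideanSpace.norm_eq, Real.sqrt_sq_eq_abs] }
  have he : MeasurePreserving e volume volume := e.measurePreserving
  rw [eLpNorm_exponent_top, eLpNorm_one_eq_lintegral_enorm,
    ← he.lintegral_comp_emb e.toMeasurableEquiv.measurableEmbedding]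
  refine essSup_le_of_ae_le _ (.of_forall fun x => ?_)
  have hg : ContDiff ℝ 1 (f ∘ e) := hf.comp e.contDiff
  have hgs : HasCompactSupport (f ∘ e) := hs.comp_homeomorph e.toHomeomorph
  have h1 := hgs.enorm_le_lintegral_Ici_deriv hg (e.symm x)
  simp only [Function.comp_apply, e.apply_symm_apply] at h1
  refine h1.trans ((setLIntegral_le_lintegral _ _).trans (lintegral_mono fun t => ?_))
  have h2 : HasDerivAt (f ∘ e) (fderiv ℝ f (e t) (e 1)) t := by
    have := ((hf.differentiable one_ne_zero (e t)).hasFDerivAt.comp t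
      e.toContinuousLinearEquiv.hasFDerivAt).hasDerivAt
    exact this
  rw [h2.deriv, ← ofReal_norm, ← ofReal_norm]
  refine ENNReal.ofReal_le_ofReal (((fderiv ℝ f (e t)).le_opNorm _).trans ?_)
  rw [e.norm_map, norm_one, mul_one]

theorem exists_sobolev_of_two_le (hN : 2 ≤ N) {p : ℝ} (hp : 2 < p) (hpN : N ≤ p) :
    ∃ q : ℝ≥0∞, ENNReal.HolderTriple (ENNReal.ofReal p) q 2 ∧ ∀ R : ℝ, ∃ C : ℝ≥0∞, C ≠ ∞ ∧
      ∀ (a : RN N) (f : RN N → ℂ), ContDiff ℝ 1 f → Function.support f ⊆ Metric.closedBall a R →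
        eLpNorm f q volume ≤ C * eLpNorm (fderiv ℝ f) 2 volume := by
  have hN' : (2 : ℝ) ≤ N := by exact_mod_cast hN
  have hp0 : 0 < p := by linarith
  have hs : 0 < 1 / 2 - p⁻¹ := by
    rw [sub_pos, ← one_div]; exact one_div_lt_one_div_of_lt (by norm_num) hp
  have hsN : p⁻¹ ≤ (N : ℝ)⁻¹ := inv_anti₀ (by linarith) hpN
  have hN2 : (N : ℝ)⁻¹ ≤ 1 / 2 := by rw [one_div]; exact inv_anti₀ two_pos hN'
  set q : ℝ≥0 := (1 / 2 - p⁻¹).toNNReal⁻¹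
  set r : ℝ≥0 := (1 / 2 - p⁻¹ + (N : ℝ)⁻¹).toNNReal⁻¹
  have hq : ((q : ℝ≥0) : ℝ)⁻¹ = 1 / 2 - p⁻¹ := by
    simp only [q, NNReal.coe_inv, inv_inv]
    exact Real.coe_toNNReal _ hs.le
  have hr : ((r : ℝ≥0) : ℝ)⁻¹ = 1 / 2 - p⁻¹ + (N : ℝ)⁻¹ := by
    simp only [r, NNReal.coe_inv, inv_inv]
    exact Real.coe_toNNReal _ (by positivity)
  have hr0 : 0 < (r : ℝ) := by rw [← inv_pos, hr]; positivity
  have hr1 : 1 ≤ r := by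
    have : (r : ℝ)⁻¹ ≤ 1 := by rw [hr]; linarith [inv_pos.2 hp0]
    rw [← NNReal.coe_le_coe, NNReal.coe_one]
    exact (inv_le_one₀ hr0).1 this
  have hr2 : (r : ℝ≥0∞) ≤ 2 := by
    have : (2 : ℝ)⁻¹ ≤ (r : ℝ)⁻¹ := by rw [hr]; linarith
    have h2 : (r : ℝ) ≤ 2 := (inv_le_inv₀ two_pos hr0).1 this
    exact_mod_cast h2
  refine ⟨q, ⟨?_⟩, fun R => ⟨SNormLESNormFDerivOfEqConst ℂ (volume : Measure (RN N)) r *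
    volume (Metric.closedBall (0 : RN N) R) ^
      (1 / (r : ℝ≥0∞).toReal - 1 / (2 : ℝ≥0∞).toReal), ?_, fun a f hf hsupp => ?_⟩⟩
  · have h1 : (q : ℝ≥0∞)⁻¹ = ENNReal.ofReal (1 / 2 - p⁻¹) := by
      rw [← ENNReal.coe_inv (by simpa [q] using hs), ENNReal.ofReal]
      simp [q]
    rw [h1, ← ENNReal.ofReal_inv_of_pos hp0, ← ENNReal.ofReal_add (by positivity) hs.le,
      add_sub_cancel, one_div, ENNReal.ofReal_inv_of_pos two_pos, ENNReal.ofReal_ofNat]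
  · refine ENNReal.mul_ne_top ENNReal.coe_ne_top (ENNReal.rpow_ne_top_of_nonneg ?_
      (isCompact_closedBall _ _).measure_lt_top.ne)
    simp only [ENNReal.coe_toReal, one_div, hr, ENNReal.toReal_ofNat]
    linarith
  · have hc : HasCompactSupport f :=
      HasCompactSupport.of_support_subset_isCompact (isCompact_closedBall a R) hsupp
    have h1 := eLpNorm_le_eLpNorm_fderiv_of_eq (volume : Measure (RN N)) hf hc hr1
      (p' := q) (by simp; omega) (by rw [hq, NNReal.coe_inv, hr]; simp)
    refine h1.trans ?_
    rw [mul_assoc, mul_comm (volume _ ^ _)]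
    gcongr
    exact eLpNorm_fderiv_le_of_support_subset_closedBall hf hsupp hr2

theorem MagneticExponent.exists_sobolev {p : ℝ≥0∞} (h : MagneticExponent N p) :
    ∃ q : ℝ≥0∞, ENNReal.HolderTriple p q 2 ∧ ∀ R : ℝ, ∃ C : ℝ≥0∞, C ≠ ∞ ∧
      ∀ (a : RN N) (f : RN N → ℂ), ContDiff ℝ 1 f → Function.support f ⊆ Metric.closedBall a R →
        eLpNorm f q volume ≤ C * eLpNorm (fderiv ℝ f) 2 volume := by
  rcases h with ⟨rfl, rfl⟩ | ⟨rfl, ε, hε, rfl⟩ | ⟨hN, rfl⟩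
  · refine ⟨∞, ⟨by simp⟩, fun R => ⟨volume (Metric.closedBall (0 : RN 1) R) ^
      (1 / (1 : ℝ≥0∞).toReal - 1 / (2 : ℝ≥0∞).toReal), ?_, fun a f hf hsupp => ?_⟩⟩
    · exact ENNReal.rpow_ne_top_of_nonneg (by norm_num) (isCompact_closedBall _ _).measure_lt_top.ne
    · rw [mul_comm]
      exact (eLpNorm_top_le_eLpNorm_fderiv_one hf (HasCompactSupport.of_support_subset_isCompact
        (isCompact_closedBall a R) hsupp)).trans
          (eLpNorm_fderiv_le_of_support_subset_closedBall hf hsupp (by norm_num))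
  · exact exists_sobolev_of_two_le le_rfl (by linarith) (by push_cast; linarith)
  · have : (2 : ℝ) < N := by exact_mod_cast hN
    simpa using exists_sobolev_of_two_le (by omega) this le_rfl

theorem MagneticExponent.ne_zero {p : ℝ≥0∞} (h : MagneticExponent N p) : N ≠ 0 := by
  rcases h with ⟨rfl, -⟩ | ⟨rfl, -⟩ | ⟨hN, -⟩ <;> omega

/-- A point of the lattice `ℤ^N`. -/
noncomputable def latticePt (k : Fin N → ℤ) : RN N := WithLp.toLp 2 fun j => (k j : ℝ)

theorem ae_mem_iUnion_unitCube : ∀ᵐ x : RN N, x ∈ ⋃ k : Fin N → ℤ, unitCube k := by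
  have h : ∀ᵐ y : Fin N → ℝ, ∀ (j : Fin N) (m : ℤ), y j ≠ m :=
    ae_all_iff.2 fun j => ae_all_iff.2 fun m =>
      Measure.ae_eval_ne (fun _ => (volume : Measure ℝ)) j (m : ℝ)
  have h' := (PiLp.volume_preserving_ofLp (Fin N)).quasiMeasurePreserving.ae h
  filter_upwards [h'] with x hx
  refine mem_iUnion.2 ⟨fun j => ⌊x j⌋, fun j => ⟨?_, Int.lt_floor_add_one _⟩⟩
  exact lt_of_le_of_ne (Int.floor_le _) (hx j _).symm

theorem unitCube_subset_closedBall (k : Fin N → ℤ) :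
    unitCube k ⊆ Metric.closedBall (latticePt k) N := by
  intro x hx
  rw [mem_closedBall_iff_norm, EuclideanSpace.norm_eq]
  refine Real.sqrt_le_iff.2 ⟨by positivity, ?_⟩
  calc ∑ j, ‖(x - latticePt k) j‖ ^ 2 ≤ ∑ _j : Fin N, (1 : ℝ) := by
        refine Finset.sum_le_sum fun j _ => ?_
        have h1 := hx j
        have h2 : (x - latticePt k) j = x j - k j := rfl
        rw [h2, Real.norm_eq_abs, sq_abs]
        nlinarith
    _ = N := by simp
    _ ≤ (N : ℝ) ^ 2 := by
        rcases Nat.eq_zero_or_pos N with h | h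
        · simp [h]
        · have : (1 : ℝ) ≤ N := by exact_mod_cast h
          nlinarith

theorem lintegral_le_tsum_unitCube (F : RN N → ℝ≥0∞) :
    ∫⁻ x, F x ≤ ∑' k : Fin N → ℤ, ∫⁻ x in unitCube k, F x := by
  refine le_trans (le_of_eq ?_) (lintegral_iUnion_le _ _)
  rw [Measure.restrict_eq_self_of_ae_mem ae_mem_iUnion_unitCube]

theorem tsum_lintegral_closedBall_le (R : ℕ) {h : RN N → ℝ≥0∞} (hh : Measurable h) :
    ∑' k : Fin N → ℤ, ∫⁻ x in Metric.closedBall (latticePt k) R, h x ≤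
      ((2 * R + 3) ^ N : ℕ) * ∫⁻ x, h x := by
  simp_rw [← lintegral_indicator Metric.isClosed_closedBall.measurableSet]
  rw [← lintegral_tsum fun k => (hh.indicator Metric.isClosed_closedBall.measurableSet).aemeasurable,
    ← lintegral_const_mul _ hh]
  refine lintegral_mono fun x => ?_
  set S : Finset (Fin N → ℤ) := Fintype.piFinset fun j => Finset.Icc (⌊x j⌋ - (R + 1)) (⌊x j⌋ + (R + 1))
  have hS : ∀ k ∉ S, (Metric.closedBall (latticePt k) (R : ℝ)).indicator h x = 0 := by
    intro k hk
    refine indicator_of_notMem (fun hx => hk ?_) _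
    rw [Fintype.mem_piFinset]
    intro j
    have h1 : |x j - k j| ≤ R := by
      rw [mem_closedBall_iff_norm] at hx
      exact (PiLp.norm_apply_le (x - latticePt k) j).trans hx
    rw [abs_le] at h1
    have h2 := Int.floor_le (x j)
    have h3 := Int.lt_floor_add_one (x j)
    rw [Finset.mem_Icc]
    constructor
    · have : ((⌊x j⌋ - (R + 1) : ℤ) : ℝ) ≤ k j := by push_cast; linarith
      exact_mod_cast this
    · have : (k j : ℝ) ≤ ((⌊x j⌋ + (R + 1) : ℤ) : ℝ) := by push_cast; linarith
      exact_mod_cast this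
  have hcard : S.card = (2 * R + 3) ^ N := by
    simp only [S, Fintype.card_piFinset, Int.card_Icc]
    have : ∀ j : Fin N, (⌊x j⌋ + ((R : ℤ) + 1) + 1 - (⌊x j⌋ - (R + 1))).toNat = 2 * R + 3 := by
      intro j; omega
    simp [this]
  rw [tsum_eq_sum hS, ← hcard, ← nsmul_eq_mul]
  exact Finset.sum_le_card_nsmul _ _ _ fun k _ => indicator_le_self _ _ _

end Sobolev

section Potential

variable {N : ℕ} {A : RN N → RN N}

theorem sq_eLpNorm_two {α F : Type*} {m : MeasurableSpace α} {μ : Measure α}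
    [NormedAddCommGroup F] (f : α → F) : eLpNorm f 2 μ ^ 2 = ∫⁻ x, ‖f x‖ₑ ^ 2 ∂μ := by
  have h := eLpNorm_nnreal_pow_eq_lintegral (μ := μ) (f := f) (p := 2) two_ne_zero
  rw [← ENNReal.rpow_two]
  simpa using h

theorem memLp_two_iff_lintegral {α F : Type*} {m : MeasurableSpace α} {μ : Measure α}
    [NormedAddCommGroup F] {f : α → F} :
    MemLp f 2 μ ↔ AEStronglyMeasurable f μ ∧ ∫⁻ x, ‖f x‖ₑ ^ 2 ∂μ < ∞ := by
  rw [MemLp, ← sq_eLpNorm_two]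
  simp

theorem exists_lintegral_unitCube_le (hA : MagneticCondition A)
    (hAm : AEStronglyMeasurable A volume) :
    ∃ C : ℝ≥0∞, C ≠ ∞ ∧ ∀ (k : Fin N → ℤ) (f : RN N → ℂ), ContDiff ℝ 1 f →
      ∫⁻ x in unitCube k, (‖A x‖ₑ * ‖f x‖ₑ) ^ 2 ≤
        C * ∫⁻ x in Metric.closedBall (latticePt k) (N + 1 : ℕ),
          (‖f x‖ₑ ^ 2 + ‖fderiv ℝ f x‖ₑ ^ 2) := by
  obtain ⟨p, hp, -, hsup⟩ := hA
  obtain ⟨q, hpq, hS⟩ := hp.exists_sobolev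
  obtain ⟨C, hC, hS⟩ := hS (N + 1 : ℕ)
  set M := ⨆ k : Fin N → ℤ, eLpNorm A p (volume.restrict (unitCube k))
  have hN : (0 : ℝ) < N := by exact_mod_cast Nat.pos_of_ne_zero hp.ne_zero
  let η : ContDiffBump (0 : RN N) := ⟨N, (N + 1 : ℕ), hN, by push_cast; linarith⟩
  have hη : ContDiff ℝ 1 η := η.contDiff
  obtain ⟨D, hD⟩ := (hη.continuous_fderiv one_ne_zero).bounded_above_of_compact_support
    (η.hasCompactSupport.fderiv (𝕜 := ℝ))
  have hD0 : 0 ≤ D := (norm_nonneg _).trans (hD 0)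
  refine ⟨M ^ 2 * C ^ 2 * ENNReal.ofReal (2 * (1 + D ^ 2)), by finiteness, fun k f hf => ?_⟩
  set B := Metric.closedBall (latticePt k) ((N + 1 : ℕ) : ℝ)
  have hηk : ContDiff ℝ 1 fun x => η (x - latticePt k) := hη.comp (contDiff_id.sub contDiff_const)
  let F : RN N → ℂ := fun x => η (x - latticePt k) • f x
  have hF : ContDiff ℝ 1 F := hηk.smul hf
  have hFs : Function.support F ⊆ B := by
    intro x hx
    by_contra hB
    refine hx ?_
    have : η (x - latticePt k) = 0 := by
      apply η.zero_of_le_dist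
      rw [dist_zero_right]
      exact le_of_lt (not_le.1 fun h => hB (mem_closedBall_iff_norm.2 h))
    simp [F, this]
  have hFQ : ∀ x ∈ unitCube k, F x = f x := by
    intro x hx
    have : η (x - latticePt k) = 1 := by
      apply η.one_of_mem_closedBall
      have := unitCube_subset_closedBall k hx
      rw [mem_closedBall_iff_norm] at this
      simpa using this
    simp [F, this]
  have hQm : MeasurableSet (unitCube k) := by
    have : unitCube k = ⋂ j, {x : RN N | (k j : ℝ) < x j ∧ x j < (k j : ℝ) + 1} := by
      ext x; simp [unitCube]
    rw [this]
    refine MeasurableSet.iInter fun j => ?_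
    have hc : Continuous fun x : RN N => x j := by fun_prop
    exact ((isOpen_lt continuous_const hc).inter (isOpen_lt hc continuous_const)).measurableSet
  have hDF : ∀ x, ‖fderiv ℝ F x‖ₑ ^ 2 ≤ ENNReal.ofReal (2 * (1 + D ^ 2)) *
      B.indicator (fun x => ‖f x‖ₑ ^ 2 + ‖fderiv ℝ f x‖ₑ ^ 2) x := by
    intro x
    by_cases hx : x ∈ B
    · rw [indicator_of_mem hx]
      have h1 : HasFDerivAt (fun x => η (x - latticePt k)) (fderiv ℝ η (x - latticePt k)) x := by
        have h2 := (hη.differentiable one_ne_zero (x - latticePt k)).hasFDerivAt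
        exact h2.comp x ((hasFDerivAt_id x).sub_const _)
      have h3 : fderiv ℝ F x = _ := (h1.smul (hf.differentiable one_ne_zero x).hasFDerivAt).fderiv
      have h4 : ‖fderiv ℝ F x‖ ≤ ‖fderiv ℝ f x‖ + D * ‖f x‖ := by
        rw [h3]
        refine (norm_add_le _ _).trans (add_le_add ?_ ?_)
        · rw [norm_smul, Real.norm_of_nonneg η.nonneg]
          exact mul_le_of_le_one_left (norm_nonneg _) η.le_one
        · rw [ContinuousLinearMap.norm_smulRight_apply]
          exact mul_le_mul_of_nonneg_right (hD _) (norm_nonneg _)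
      have h5 : ‖fderiv ℝ F x‖ ^ 2 ≤ 2 * (1 + D ^ 2) * (‖f x‖ ^ 2 + ‖fderiv ℝ f x‖ ^ 2) := by
        have h6 := pow_le_pow_left₀ (norm_nonneg _) h4 2
        nlinarith [sq_nonneg (‖fderiv ℝ f x‖ - D * ‖f x‖), sq_nonneg (‖f x‖),
          sq_nonneg (D * ‖fderiv ℝ f x‖)]
      rw [← ofReal_norm, ← ofReal_norm, ← ofReal_norm, ← ENNReal.ofReal_pow (norm_nonneg _),
        ← ENNReal.ofReal_pow (norm_nonneg _), ← ENNReal.ofReal_pow (norm_nonneg _),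
        ← ENNReal.ofReal_add (by positivity) (by positivity), ← ENNReal.ofReal_mul (by positivity)]
      exact ENNReal.ofReal_le_ofReal h5
    · have h0 : fderiv ℝ F x = 0 := by
        by_contra hne
        exact hx (closure_minimal hFs Metric.isClosed_closedBall
          (support_fderiv_subset ℝ (Function.mem_support.2 hne)))
      rw [← ofReal_norm, h0, norm_zero, ENNReal.ofReal_zero, zero_pow two_ne_zero]
      exact zero_le
  have hold : eLpNorm ((fun x => ‖A x‖) • F) 2 (volume.restrict (unitCube k)) ≤
      eLpNorm (fun x => ‖A x‖) p (volume.restrict (unitCube k)) *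
        eLpNorm F q (volume.restrict (unitCube k)) :=
    eLpNorm_smul_le_mul_eLpNorm (hpqr := hpq) hF.continuous.aestronglyMeasurable hAm.norm.restrict
  calc ∫⁻ x in unitCube k, (‖A x‖ₑ * ‖f x‖ₑ) ^ 2
      = eLpNorm ((fun x => ‖A x‖) • F) 2 (volume.restrict (unitCube k)) ^ 2 := by
        rw [sq_eLpNorm_two]
        refine setLIntegral_congr_fun hQm fun x hx => ?_
        simp only [Pi.smul_apply', hFQ x hx, enorm_smul, enorm_norm]
    _ ≤ (M * (C * eLpNorm (fderiv ℝ F) 2 volume)) ^ 2 := by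
        gcongr
        refine hold.trans (mul_le_mul' ?_ ?_)
        · rw [eLpNorm_norm]
          exact le_iSup (fun k : Fin N → ℤ => eLpNorm A p (volume.restrict (unitCube k))) k
        · exact (eLpNorm_mono_measure _ Measure.restrict_le_self).trans (hS _ F hF hFs)
    _ = M ^ 2 * C ^ 2 * ∫⁻ x, ‖fderiv ℝ F x‖ₑ ^ 2 := by
        rw [mul_pow, mul_pow, sq_eLpNorm_two, mul_assoc]
    _ ≤ M ^ 2 * C ^ 2 * ∫⁻ x, ENNReal.ofReal (2 * (1 + D ^ 2)) *
          B.indicator (fun x => ‖f x‖ₑ ^ 2 + ‖fderiv ℝ f x‖ₑ ^ 2) x := by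
        gcongr with x
        exact hDF x
    _ = _ := by
        rw [lintegral_const_mul' _ _ ENNReal.ofReal_ne_top,
          lintegral_indicator Metric.isClosed_closedBall.measurableSet, ← mul_assoc]

theorem exists_lintegral_potential_le_of_contDiff (hA : MagneticCondition A)
    (hAm : AEStronglyMeasurable A volume) :
    ∃ C : ℝ≥0∞, C ≠ ∞ ∧ ∀ f : RN N → ℂ, ContDiff ℝ 1 f →
      ∫⁻ x, (‖A x‖ₑ * ‖f x‖ₑ) ^ 2 ≤ C * ∫⁻ x, (‖f x‖ₑ ^ 2 + ‖fderiv ℝ f x‖ₑ ^ 2) := by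
  obtain ⟨C, hC, h⟩ := exists_lintegral_unitCube_le hA hAm
  refine ⟨C * ((2 * (N + 1) + 3) ^ N : ℕ), by finiteness, fun f hf => ?_⟩
  have hm : Measurable fun x => ‖f x‖ₑ ^ 2 + ‖fderiv ℝ f x‖ₑ ^ 2 :=
    (hf.continuous.enorm.measurable.pow_const _).add
      ((hf.continuous_fderiv one_ne_zero).enorm.measurable.pow_const _)
  calc _ ≤ _ := lintegral_le_tsum_unitCube _
    _ ≤ _ := ENNReal.tsum_le_tsum fun k => h k f hf
    _ ≤ _ := by
      rw [ENNReal.tsum_mul_left, mul_assoc]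
      exact mul_le_mul_right (tsum_lintegral_closedBall_le (N + 1) hm) _

theorem lintegral_le_of_ae_tendsto {α : Type*} {m : MeasurableSpace α} {μ : Measure α}
    {f : ℕ → α → ℝ≥0∞} {g : α → ℝ≥0∞} {B : ℝ≥0∞} (hf : ∀ n, AEMeasurable (f n) μ)
    (h : ∀ᵐ x ∂μ, Tendsto (fun n => f n x) atTop (𝓝 (g x))) (hB : ∀ n, ∫⁻ x, f n x ∂μ ≤ B) :
    ∫⁻ x, g x ∂μ ≤ B := by
  calc ∫⁻ x, g x ∂μ = ∫⁻ x, liminf (fun n => f n x) atTop ∂μ :=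
        lintegral_congr_ae (by filter_upwards [h] with x hx using hx.liminf_eq.symm)
    _ ≤ liminf (fun n => ∫⁻ x, f n x ∂μ) atTop := lintegral_liminf_le' hf
    _ ≤ B := liminf_le_of_le (by isBoundedDefault) fun b hb => by
        obtain ⟨n, hn⟩ := hb.exists
        exact hn.trans (hB n)

theorem enorm_clm_sq_le (T : RN N →L[ℝ] ℂ) : ‖T‖ₑ ^ 2 ≤ ∑ j, ‖T (unitVec j)‖ₑ ^ 2 := by
  have h : ‖T‖ ≤ √(∑ j, ‖T (unitVec j)‖ ^ 2) := by
    refine T.opNorm_le_bound (Real.sqrt_nonneg _) fun x => ?_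
    have hx : x = ∑ j, x j • unitVec j := by
      ext i
      simp [Finset.sum_apply, Pi.single_apply]
    calc ‖T x‖ = ‖∑ j, x j • T (unitVec j)‖ := by conv_lhs => rw [hx, map_sum]; simp only [map_smul]
      _ ≤ ∑ j, ‖T (unitVec j)‖ * ‖x j‖ := (norm_sum_le _ _).trans
          (Finset.sum_le_sum fun j _ => by rw [norm_smul, mul_comm])
      _ ≤ √(∑ j, ‖T (unitVec j)‖ ^ 2) * √(∑ j, ‖x j‖ ^ 2) := Real.sum_mul_le_sqrt_mul_sqrt _ _ _
      _ = _ := by rw [EuclideanSpace.norm_eq]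
  have h2 : ‖T‖ ^ 2 ≤ ∑ j, ‖T (unitVec j)‖ ^ 2 := by
    rw [← Real.sq_sqrt (Finset.sum_nonneg fun j _ => sq_nonneg ‖T (unitVec j)‖)]
    exact pow_le_pow_left₀ (norm_nonneg _) h 2
  simp_rw [← ofReal_norm, ← ENNReal.ofReal_pow (norm_nonneg _)]
  rw [← ENNReal.ofReal_sum_of_nonneg fun j _ => sq_nonneg _]
  exact ENNReal.ofReal_le_ofReal h2

theorem enorm_CN_sq (z : CN N) : ‖z‖ₑ ^ 2 = ∑ j, ‖z j‖ₑ ^ 2 := by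
  simp_rw [← ofReal_norm, ← ENNReal.ofReal_pow (norm_nonneg _)]
  rw [← ENNReal.ofReal_sum_of_nonneg fun j _ => sq_nonneg _, EuclideanSpace.norm_sq_eq]

theorem memLp_component {g : RN N → CN N} {p : ℝ≥0∞} (hg : MemLp g p volume) (j : Fin N) :
    MemLp (fun x => g x j) p volume :=
  (EuclideanSpace.proj (𝕜 := ℂ) j).comp_memLp' hg

theorem exists_lintegral_potential_le_of_hasWeakGradient (hA : MagneticCondition A)
    (hAm : AEStronglyMeasurable A volume) :
    ∃ C : ℝ≥0∞, C ≠ ∞ ∧ ∀ (w : RN N → ℂ) (g : RN N → CN N), MemLp w 2 volume → MemLp g 2 volume →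
      HasWeakGradient w g →
      ∫⁻ x, (‖A x‖ₑ * ‖w x‖ₑ) ^ 2 ≤ C * ((∫⁻ x, ‖w x‖ₑ ^ 2) + ∫⁻ x, ‖g x‖ₑ ^ 2) := by
  obtain ⟨C, hC, h⟩ := exists_lintegral_potential_le_of_contDiff hA hAm
  refine ⟨C, hC, fun w g hw hg hwg => ?_⟩
  have hwl : LocallyIntegrable w volume := hw.locallyIntegrable (by norm_num)
  have hcd (n : ℕ) : ContDiff ℝ 1 (mollify n w) := contDiff_mollify n hwl (k := 1)
  refine lintegral_le_of_ae_tendsto (f := fun n x => (‖A x‖ₑ * ‖mollify n w x‖ₑ) ^ 2)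
    (fun n => (hAm.enorm.mul (hcd n).continuous.aestronglyMeasurable.enorm).pow_const _) ?_
    fun n => (h _ (hcd n)).trans ?_
  · filter_upwards [ae_tendsto_mollify hwl] with x hx
    exact ((ENNReal.continuous_pow 2).tendsto _).comp
      (ENNReal.Tendsto.const_mul hx.enorm (.inr enorm_ne_top))
  · refine mul_le_mul_right ?_ C
    rw [lintegral_add_left' ((hcd n).continuous.aestronglyMeasurable.enorm.pow_const _)]
    refine add_le_add ?_ ?_
    · rw [← sq_eLpNorm_two, ← sq_eLpNorm_two]
      gcongr
      exact eLpNorm_mollify_le n (by norm_num) (by norm_num) hw.1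
    · have hgj (j : Fin N) : AEMeasurable (fun x => ‖g x j‖ₑ ^ 2) volume :=
        (memLp_component hg j).1.enorm.pow_const _
      calc ∫⁻ x, ‖fderiv ℝ (mollify n w) x‖ₑ ^ 2
          ≤ ∫⁻ x, ∑ j, ‖mollify n (fun y => g y j) x‖ₑ ^ 2 := lintegral_mono fun x => by
            refine (enorm_clm_sq_le _).trans (le_of_eq (Finset.sum_congr rfl fun j _ => ?_))
            rw [fderiv_mollify_apply n hwl hwg]
        _ = ∑ j, ∫⁻ x, ‖mollify n (fun y => g y j) x‖ₑ ^ 2 :=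
            lintegral_finsetSum' _ fun j _ => (memLp_mollify n (by norm_num) (by norm_num)
              (memLp_component hg j)).1.enorm.pow_const _
        _ ≤ ∑ j, ∫⁻ x, ‖g x j‖ₑ ^ 2 := by
            refine Finset.sum_le_sum fun j _ => ?_
            rw [← sq_eLpNorm_two, ← sq_eLpNorm_two]
            gcongr
            exact eLpNorm_mollify_le n (by norm_num) (by norm_num) (memLp_component hg j).1
        _ = ∫⁻ x, ‖g x‖ₑ ^ 2 := by
            rw [← lintegral_finsetSum' _ fun j _ => hgj j]
            simp_rw [enorm_CN_sq]

end Potential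

section Diamagnetic

/-- The smooth approximation `√(ε² + |z|²) - ε` of `|z|`. -/
noncomputable def smoothAbs (ε : ℝ) (z : ℂ) : ℂ := ((√(ε ^ 2 + ‖z‖ ^ 2) - ε : ℝ) : ℂ)

/-- The real derivative of `smoothAbs`. -/
noncomputable def smoothAbsDeriv (ε : ℝ) (z : ℂ) : ℂ →L[ℝ] ℂ :=
  Complex.ofRealCLM.comp ((√(ε ^ 2 + ‖z‖ ^ 2))⁻¹ • innerSL ℝ z)

theorem hasFDerivAt_sqrt_add_norm_sq {a b : ℝ} (ha : 0 < a) (hb : 0 ≤ b) (z : ℂ) :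
    HasFDerivAt (fun z : ℂ => √(a + b * ‖z‖ ^ 2))
      ((b * (√(a + b * ‖z‖ ^ 2))⁻¹) • innerSL ℝ z) z := by
  have h1 : HasFDerivAt (fun z : ℂ => a + b * ‖z‖ ^ 2) (b • (2 • innerSL ℝ z)) z := by
    have := ((hasStrictFDerivAt_norm_sq z).hasFDerivAt.const_mul b).const_add a
    exact this
  refine (h1.sqrt (by positivity)).congr_fderiv (ContinuousLinearMap.ext fun w => ?_)
  simp only [smul_apply, nsmul_eq_mul, smul_eq_mul]
  have : √(a + b * ‖z‖ ^ 2) ≠ 0 := by positivity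
  push_cast
  field_simp

theorem hasFDerivAt_smoothAbs {ε : ℝ} (hε : 0 < ε) (z : ℂ) :
    HasFDerivAt (smoothAbs ε) (smoothAbsDeriv ε z) z := by
  have h := (hasFDerivAt_sqrt_add_norm_sq (sq_pos_of_pos hε) zero_le_one z).sub_const ε
  simp only [one_mul] at h
  exact Complex.ofRealCLM.hasFDerivAt.comp z h

theorem continuous_smoothAbsDeriv {ε : ℝ} (hε : 0 < ε) : Continuous (smoothAbsDeriv ε) := by
  have h : ∀ z : ℂ, √(ε ^ 2 + ‖z‖ ^ 2) ≠ 0 := fun z => by positivity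
  have h1 : Continuous fun z : ℂ => (√(ε ^ 2 + ‖z‖ ^ 2))⁻¹ :=
    Continuous.inv₀ (by fun_prop) h
  exact continuous_const.clm_comp (h1.smul (innerSL ℝ).continuous)

theorem norm_smoothAbsDeriv_apply_le {ε : ℝ} (hε : 0 < ε) (z w : ℂ) :
    ‖smoothAbsDeriv ε z w‖ = (√(ε ^ 2 + ‖z‖ ^ 2))⁻¹ * |(conj z * w).re| := by
  simp only [smoothAbsDeriv, ContinuousLinearMap.comp_apply, smul_apply,
    innerSL_apply_apply, Complex.inner, Complex.ofRealCLM_apply, Complex.norm_real, smul_eq_mul,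
    norm_mul, Real.norm_eq_abs]
  rw [abs_of_pos (by positivity), mul_comm w]

theorem norm_le_sqrt_add (ε : ℝ) (z : ℂ) : ‖z‖ ≤ √(ε ^ 2 + ‖z‖ ^ 2) :=
  Real.le_sqrt_of_sq_le (by nlinarith [sq_nonneg ε])

theorem inv_sqrt_mul_abs_re_le {ε : ℝ} (hε : 0 < ε) (z w : ℂ) :
    (√(ε ^ 2 + ‖z‖ ^ 2))⁻¹ * |(conj z * w).re| ≤ ‖w‖ := by
  have h1 := norm_le_sqrt_add ε z
  have h2 : |(conj z * w).re| ≤ ‖z‖ * ‖w‖ := by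
    simpa using Complex.abs_re_le_norm (conj z * w)
  have h3 : 0 < √(ε ^ 2 + ‖z‖ ^ 2) := by positivity
  rw [inv_mul_le_iff₀ h3]
  exact h2.trans (mul_le_mul_of_nonneg_right h1 (norm_nonneg _))

theorem norm_smoothAbsDeriv_le {ε : ℝ} (hε : 0 < ε) (z : ℂ) : ‖smoothAbsDeriv ε z‖ ≤ 1 := by
  refine ContinuousLinearMap.opNorm_le_bound _ zero_le_one fun w => ?_
  rw [norm_smoothAbsDeriv_apply_le hε, one_mul]
  exact inv_sqrt_mul_abs_re_le hε z w

theorem norm_smoothAbs_le {ε : ℝ} (hε : 0 < ε) (z : ℂ) : ‖smoothAbs ε z‖ ≤ ‖z‖ := by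
  rw [smoothAbs, Complex.norm_real, Real.norm_eq_abs, abs_le]
  constructor
  · have : ε ≤ √(ε ^ 2 + ‖z‖ ^ 2) := Real.le_sqrt_of_sq_le (by nlinarith [sq_nonneg ‖z‖])
    linarith [norm_nonneg z]
  · rw [sub_le_iff_le_add, Real.sqrt_le_iff]
    constructor
    · positivity
    · nlinarith [norm_nonneg z]

theorem tendsto_smoothAbs (z : ℂ) :
    Tendsto (fun n : ℕ => ‖smoothAbs (1 / ((n : ℝ) + 1)) z‖) atTop (𝓝 ‖z‖) := by
  have h : Continuous fun ε : ℝ => ‖smoothAbs ε z‖ := by unfold smoothAbs; fun_prop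
  have h2 := (h.tendsto 0).comp tendsto_one_div_add_atTop_nhds_zero_nat
  have h0 : ‖smoothAbs 0 z‖ = ‖z‖ := by simp [smoothAbs]
  rw [h0] at h2
  exact h2

theorem lintegral_enorm_sq_mono {α E F : Type*} {m : MeasurableSpace α} {μ : Measure α}
    [NormedAddCommGroup E] [NormedAddCommGroup F] {f : α → E} {g : α → F}
    (h : ∀ x, ‖f x‖ ≤ ‖g x‖) : ∫⁻ x, ‖f x‖ₑ ^ 2 ∂μ ≤ ∫⁻ x, ‖g x‖ₑ ^ 2 ∂μ := by
  refine lintegral_mono fun x => ?_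
  have : ‖f x‖ₑ ≤ ‖g x‖ₑ := by
    rw [← ofReal_norm, ← ofReal_norm]; exact ENNReal.ofReal_le_ofReal (h x)
  exact pow_le_pow_left' this 2

variable {N : ℕ} {A : RN N → RN N} {V : RN N → ℝ}

theorem norm_potMul (A : RN N → RN N) (u : RN N → ℂ) (x : RN N) :
    ‖potMul A u x‖ = ‖A x‖ * ‖u x‖ := by
  rw [EuclideanSpace.norm_eq, EuclideanSpace.norm_eq (A x)]
  simp only [potMul, norm_mul, mul_pow, ← Finset.sum_mul, Complex.norm_real]
  rw [Real.sqrt_mul (Finset.sum_nonneg fun _ _ => sq_nonneg _), Real.sqrt_sq (norm_nonneg _)]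

theorem MemLpLoc.locallyIntegrable (hA : MemLpLoc A 2) : LocallyIntegrable A volume := by
  rw [locallyIntegrable_iff]
  intro K hK
  have : IsFiniteMeasure (volume.restrict K) := ⟨by simpa using hK.measure_lt_top⟩
  exact (hA K hK).integrable (by norm_num)

theorem MemLpLoc.aestronglyMeasurable (hA : MemLpLoc A 2) : AEStronglyMeasurable A volume :=
  hA.locallyIntegrable.aestronglyMeasurable

theorem aestronglyMeasurable_potMul (hA : AEStronglyMeasurable A volume) {u : RN N → ℂ}
    (hu : AEStronglyMeasurable u volume) : AEStronglyMeasurable (potMul A u) volume := by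
  have hc : Continuous fun z : RN N × ℂ => (WithLp.toLp 2 fun j => (z.1 j : ℂ) * z.2 : CN N) := by
    fun_prop
  exact hc.comp_aestronglyMeasurable (hA.prodMk hu)

theorem memLp_potMul_iff (hA : AEStronglyMeasurable A volume) {u : RN N → ℂ}
    (hu : AEStronglyMeasurable u volume) :
    MemLp (potMul A u) 2 volume ↔ ∫⁻ x, (‖A x‖ₑ * ‖u x‖ₑ) ^ 2 < ∞ := by
  rw [memLp_two_iff_lintegral]
  have : ∀ x, ‖potMul A u x‖ₑ = ‖A x‖ₑ * ‖u x‖ₑ := fun x => by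
    rw [← ofReal_norm, norm_potMul, ENNReal.ofReal_mul (norm_nonneg _), ofReal_norm, ofReal_norm]
  simp_rw [this]
  exact and_iff_right (aestronglyMeasurable_potMul hA hu)

theorem aestronglyMeasurable_deriv_apply {DF : ℂ → ℂ →L[ℝ] ℂ} (hDF : Continuous DF)
    {u v : RN N → ℂ} (hu : AEStronglyMeasurable u volume) (hv : AEStronglyMeasurable v volume) :
    AEStronglyMeasurable (fun x => DF (u x) (v x)) volume := by
  have hc : Continuous fun z : ℂ × ℂ => DF z.1 z.2 :=
    (hDF.comp continuous_fst).clm_apply continuous_snd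
  exact hc.comp_aestronglyMeasurable (hu.prodMk hv)

theorem memLp_toLp_pi {f : Fin N → RN N → ℂ} {p : ℝ≥0∞} (hf : ∀ j, MemLp (f j) p volume) :
    MemLp (fun x => (WithLp.toLp 2 fun j => f j x : CN N)) p volume := by
  have : MemLp (fun x => fun j => f j x) p volume := MemLp.of_eval hf
  exact (PiLp.continuousLinearEquiv 2 ℂ (fun _ : Fin N => ℂ)).symm.toContinuousLinearMap.comp_memLp'
    this

/-- The diamagnetic inequality and the Sobolev inequality: if `u` and `(∇ + iA) u` belong to `L²`,
then so does `A u`. -/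
theorem HasMagneticGradient.memLp_potMul (hA : MemLpLoc A 2) (hA' : MagneticCondition A)
    {u : L2 N} {G : L2vec N} (h : HasMagneticGradient A u G) : MemLp (potMul A u) 2 volume := by
  have hAm := hA.aestronglyMeasurable
  have hum := Lp.aestronglyMeasurable u
  obtain ⟨C, hC, key⟩ := exists_lintegral_potential_le_of_hasWeakGradient hA' hAm
  rw [memLp_potMul_iff hAm hum]
  have hGl := L2vec_locallyIntegrable G
  have hAl := potMul_locallyIntegrable hA u
  have hw := (hasMagneticGradient_iff hGl hAl).1 h
  have hgl (j : Fin N) : LocallyIntegrable (fun x => (G x - Complex.I • potMul A u x) j) volume :=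
    (hGl j).sub (hAl j)
  have bound (n : ℕ) : ∫⁻ x, (‖A x‖ₑ * ‖smoothAbs (1 / ((n : ℝ) + 1)) (u x)‖ₑ) ^ 2 ≤
      C * ((∫⁻ x, ‖u x‖ₑ ^ 2) + ∫⁻ x, ‖G x‖ₑ ^ 2) := by
    set ε : ℝ := 1 / ((n : ℝ) + 1)
    have hε : 0 < ε := by positivity
    have hc : Continuous (smoothAbs ε) :=
      continuous_iff_continuousAt.2 fun z => (hasFDerivAt_smoothAbs hε z).continuousAt
    have hwg := hw.comp (L2_locallyIntegrable u) hgl (hasFDerivAt_smoothAbs hε)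
      (continuous_smoothAbsDeriv hε) (norm_smoothAbsDeriv_le hε)
    have hD : ∀ x j, ‖smoothAbsDeriv ε (u x) ((G x - Complex.I • potMul A u x) j)‖ ≤ ‖G x j‖ := by
      intro x j
      rw [norm_smoothAbsDeriv_apply_le hε]
      have : (conj (u x) * (G x - Complex.I • potMul A u x) j).re = (conj (u x) * G x j).re := by
        simp [potMul]
        ring
      rw [this]
      exact inv_sqrt_mul_abs_re_le hε _ _
    have hDm (j : Fin N) : AEStronglyMeasurable
        (fun x => smoothAbsDeriv ε (u x) ((G x - Complex.I • potMul A u x) j)) volume :=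
      aestronglyMeasurable_deriv_apply (continuous_smoothAbsDeriv hε) hum
        (hgl j).aestronglyMeasurable
    have m1 : MemLp (fun x => smoothAbs ε (u x)) 2 volume :=
      (Lp.memLp u).mono (hc.comp_aestronglyMeasurable hum)
        (.of_forall fun x => norm_smoothAbs_le hε _)
    have m2 := memLp_toLp_pi (p := 2)
      (f := fun j x => smoothAbsDeriv ε (u x) ((G x - Complex.I • potMul A u x) j)) fun j =>
        (memLp_coord G j).mono (hDm j) (.of_forall fun x => hD x j)
    refine (key _ _ m1 m2 hwg).trans ?_
    refine mul_le_mul_right (add_le_add (lintegral_enorm_sq_mono fun x => norm_smoothAbs_le hε _)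
      (lintegral_enorm_sq_mono fun x => ?_)) C
    rw [EuclideanSpace.norm_eq, EuclideanSpace.norm_eq]
    refine Real.sqrt_le_sqrt (Finset.sum_le_sum fun j _ => ?_)
    exact pow_le_pow_left₀ (norm_nonneg _) (hD x j) 2
  refine (lintegral_le_of_ae_tendsto (g := fun x => (‖A x‖ₑ * ‖u x‖ₑ) ^ 2) (fun n => ?_)
    (.of_forall fun x => ?_) bound).trans_lt ?_
  · have hc : Continuous (smoothAbs (1 / ((n : ℝ) + 1))) := continuous_iff_continuousAt.2 fun z =>
      (hasFDerivAt_smoothAbs (by positivity) z).continuousAt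
    exact (hAm.enorm.mul (hc.comp_aestronglyMeasurable hum).enorm).pow_const _
  · refine ((ENNReal.continuous_pow 2).tendsto _).comp
      (ENNReal.Tendsto.const_mul ?_ (.inr enorm_ne_top))
    simp_rw [← ofReal_norm]
    exact (ENNReal.continuous_ofReal.tendsto _).comp (tendsto_smoothAbs (u x))
  · refine ENNReal.mul_lt_top hC.lt_top (ENNReal.add_lt_top.2 ⟨?_, ?_⟩)
    · exact (memLp_two_iff_lintegral.1 (Lp.memLp u)).2
    · exact (memLp_two_iff_lintegral.1 (Lp.memLp G)).2

theorem mem_H1sub_iff_hasWeakGradient (u : L2 N) :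
    u ∈ H1sub N ↔ ∃ g : L2vec N, HasWeakGradient u g := mem_H1sub_iff u

theorem HasMagneticGradient.hasWeakGradient (hA : MemLpLoc A 2) {u : L2 N} {G : L2vec N}
    (h : HasMagneticGradient A u G) :
    HasWeakGradient u fun x => G x - Complex.I • potMul A u x :=
  (hasMagneticGradient_iff (L2vec_locallyIntegrable G) (potMul_locallyIntegrable hA u)).1 h

theorem mem_H1AVsub_iff (hA : MemLpLoc A 2) (hA' : MagneticCondition A) (hV : ElectricCondition V)
    (u : L2 N) : u ∈ H1AVsub hA hV ↔
      u ∈ H1sub N ∧ Integrable (fun x => (V x : ℂ) * u x ^ 2) volume ∧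
        MemLp (potMul A u) 2 volume := by
  constructor
  · rintro ⟨hVu, G, hG⟩
    have hAu := hG.memLp_potMul hA hA'
    have hm : MemLp (fun x => G x - Complex.I • potMul A u x) 2 volume :=
      (Lp.memLp G).sub (hAu.const_smul Complex.I)
    exact ⟨(mem_H1sub_iff_hasWeakGradient u).2 ⟨hm.toLp _,
      (hG.hasWeakGradient hA).congr .rfl hm.coeFn_toLp.symm⟩, hVu, hAu⟩
  · rintro ⟨hu, hVu, hAu⟩
    obtain ⟨g, hg⟩ := (mem_H1sub_iff_hasWeakGradient u).1 hu
    have hm : MemLp (fun x => g x + Complex.I • potMul A u x) 2 volume :=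
      (Lp.memLp g).add (hAu.const_smul Complex.I)
    refine ⟨hVu, hm.toLp _, (hasMagneticGradient_iff (L2vec_locallyIntegrable _)
      (potMul_locallyIntegrable hA u)).2 (hg.congr .rfl ?_)⟩
    filter_upwards [hm.coeFn_toLp] with x hx
    rw [hx, add_sub_cancel_right]

end Diamagnetic

section Completeness

variable {N : ℕ} {A : RN N → RN N} {V : RN N → ℝ}

theorem ElectricCondition.exists_ae_le (hV : ElectricCondition V) :
    ∃ c : ℝ, 0 < c ∧ ∀ᵐ x, c ≤ V x := by
  have h := hV.2
  rw [essInf, Filter.liminf_eq] at h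
  have hne : {a : ℝ | ∀ᶠ x in ae (volume : Measure (RN N)), a ≤ V x}.Nonempty := by
    by_contra hc
    rw [Set.not_nonempty_iff_eq_empty] at hc
    rw [hc, Real.sSup_empty] at h
    exact lt_irrefl _ h
  obtain ⟨a, ha, h0⟩ := exists_lt_of_lt_csSup hne h
  exact ⟨a, h0, ha⟩

theorem aestronglyMeasurable_sqrt (hV : ElectricCondition V) :
    AEStronglyMeasurable (fun x => √(V x)) volume :=
  Real.continuous_sqrt.comp_aestronglyMeasurable hV.1.aestronglyMeasurable

theorem integrable_V_sq_iff (hV : ElectricCondition V) {u : RN N → ℂ}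
    (hu : AEStronglyMeasurable u volume) :
    Integrable (fun x => (V x : ℂ) * u x ^ 2) volume ↔
      MemLp (fun x => (√(V x) : ℂ) * u x) 2 volume := by
  have hm : AEStronglyMeasurable (fun x => (√(V x) : ℂ) * u x) volume :=
    (Complex.continuous_ofReal.comp_aestronglyMeasurable (aestronglyMeasurable_sqrt hV)).mul hu
  rw [memLp_two_iff_integrable_sq_norm hm]
  have hm' : AEStronglyMeasurable (fun x => (V x : ℂ) * u x ^ 2) volume :=
    (aesm_V hV).mul (hu.pow 2)
  rw [← integrable_norm_iff hm']
  refine integrable_congr ?_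
  filter_upwards [ae_pos hV] with x hx
  rw [norm_mul, norm_mul, mul_pow, norm_pow, Complex.norm_real, Complex.norm_real,
    Real.norm_of_nonneg hx.le, Real.norm_of_nonneg (Real.sqrt_nonneg _), Real.sq_sqrt hx.le]

theorem norm_sq_L2_eq_integral {α F : Type*} {m : MeasurableSpace α} {μ : Measure α}
    [NormedAddCommGroup F] [InnerProductSpace ℂ F] (f : Lp F 2 μ) :
    ‖f‖ ^ 2 = ∫ x, ‖f x‖ ^ 2 ∂μ := by
  have h := L2.inner_def (𝕜 := ℂ) f f
  simp only [inner_self_eq_norm_sq_to_K] at h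
  have h2 : ((‖f‖ ^ 2 : ℝ) : ℂ) = ((∫ x, ‖f x‖ ^ 2 ∂μ : ℝ) : ℂ) := by
    rw [← integral_complex_ofReal]
    simpa using h
  exact_mod_cast h2

namespace H1AV

variable {hA : MemLpLoc A 2} {hV : ElectricCondition V}

theorem memLp_sqrt_mul (u : H1AV hA hV) : MemLp (fun x => (√(V x) : ℂ) * u.toL2 x) 2 volume :=
  (integrable_V_sq_iff hV (Lp.aestronglyMeasurable _)).1 u.toL2_mem.1

/-- The weighted function `√V u`, an element of `L²`. -/
noncomputable def weighted (u : H1AV hA hV) : L2 N := u.memLp_sqrt_mul.toLp _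

theorem coeFn_weighted (u : H1AV hA hV) :
    (u.weighted : RN N → ℂ) =ᵐ[volume] fun x => (√(V x) : ℂ) * u.toL2 x :=
  u.memLp_sqrt_mul.coeFn_toLp

theorem weighted_add (u v : H1AV hA hV) : (u + v).weighted = u.weighted + v.weighted := by
  apply Lp.ext
  have h := Lp.coeFn_add u.toL2 v.toL2
  rw [← map_add] at h
  filter_upwards [coeFn_weighted (u + v), coeFn_weighted u, coeFn_weighted v, h,
    Lp.coeFn_add u.weighted v.weighted] with x h1 h2 h3 h4 h5
  rw [h1, h5, Pi.add_apply, h2, h3, h4, Pi.add_apply, mul_add]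

theorem weighted_smul (c : ℝ) (u : H1AV hA hV) : (c • u).weighted = c • u.weighted := by
  apply Lp.ext
  have h := Lp.coeFn_smul c u.toL2
  rw [← map_smul] at h
  filter_upwards [coeFn_weighted (c • u), coeFn_weighted u, h,
    Lp.coeFn_smul c u.weighted] with x h1 h2 h4 h5
  rw [h1, h5, Pi.smul_apply, h2, h4, Pi.smul_apply, mul_smul_comm]

theorem norm_sq_eq (u : H1AV hA hV) : ‖u‖ ^ 2 = ‖u.weighted‖ ^ 2 + ‖u.grad‖ ^ 2 := by
  rw [← real_inner_self_eq_norm_sq, inner_def, re_V_integral, norm_sq_L2_eq_integral,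
    norm_sq_L2_eq_integral]
  congr 1
  · refine integral_congr_ae ?_
    filter_upwards [coeFn_weighted u, ae_pos hV] with x hx hp
    rw [hx, norm_mul, mul_pow, Complex.norm_real, Real.norm_of_nonneg (Real.sqrt_nonneg _),
      Real.sq_sqrt hp.le]
  · have : ∫ x, hdot (u.grad x) (u.grad x) = ∫ x, ((‖u.grad x‖ ^ 2 : ℝ) : ℂ) :=
      integral_congr_ae (.of_forall fun x => by
        simp [hdot, Complex.mul_conj', EuclideanSpace.norm_sq_eq])
    rw [this, integral_complex_ofReal, Complex.ofReal_re]

/-- The isometry `u ↦ (√V u, ∇_A u)` into `L² × L²`. -/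
noncomputable def isom : H1AV hA hV →ₗᵢ[ℝ] WithLp 2 (L2 N × L2vec N) where
  toFun u := WithLp.toLp 2 (u.weighted, u.grad)
  map_add' u v := by rw [weighted_add, grad_add]; rfl
  map_smul' c u := by rw [weighted_smul, grad_smul]; rfl
  norm_map' u := by
    rw [← sq_eq_sq₀ (norm_nonneg _) (norm_nonneg _), norm_sq_eq, WithLp.prod_norm_sq_eq_of_L2]
    rfl

theorem isom_apply (u : H1AV hA hV) : isom u = WithLp.toLp 2 (u.weighted, u.grad) := rfl

instance : SecondCountableTopology (H1AV hA hV) :=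
  have : Fact ((2 : ℝ≥0∞) ≠ ∞) := ⟨by norm_num⟩
  have : SecondCountableTopology (L2 N) := Lp.SecondCountableTopology
  have : SecondCountableTopology (L2vec N) := Lp.SecondCountableTopology
  have : SecondCountableTopology (WithLp 2 (L2 N × L2vec N)) :=
    (WithLp.homeomorphProd 2 (L2 N) (L2vec N)).secondCountableTopology
  (isom (hA := hA) (hV := hV)).isometry.isEmbedding.isInducing.secondCountableTopology

end H1AV

theorem memLp_inv_sqrt_mul (hV : ElectricCondition V) {a : RN N → ℂ} (ha : MemLp a 2 volume) :
    MemLp (fun x => ((√(V x))⁻¹ : ℂ) * a x) 2 volume := by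
  obtain ⟨c, hc, h⟩ := hV.exists_ae_le
  have hm : AEStronglyMeasurable (fun x => ((√(V x))⁻¹ : ℂ)) volume := by
    have := (aestronglyMeasurable_sqrt hV).aemeasurable.inv.aestronglyMeasurable
    have h2 := Complex.continuous_ofReal.comp_aestronglyMeasurable this
    simpa using h2
  refine MemLp.of_le_mul (c := (√c)⁻¹) ha (hm.mul ha.1) ?_
  filter_upwards [h] with x hx
  rw [norm_mul, norm_inv, Complex.norm_real, Real.norm_of_nonneg (Real.sqrt_nonneg _)]
  gcongr

/-- Multiplication by `V^{-1/2}` on `L²`. -/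
noncomputable def invSqrtMul (hV : ElectricCondition V) : L2 N →ₗ[ℝ] L2 N where
  toFun a := (memLp_inv_sqrt_mul hV (Lp.memLp a)).toLp _
  map_add' a b := by
    apply Lp.ext
    filter_upwards [(memLp_inv_sqrt_mul hV (Lp.memLp (a + b))).coeFn_toLp,
      (memLp_inv_sqrt_mul hV (Lp.memLp a)).coeFn_toLp,
      (memLp_inv_sqrt_mul hV (Lp.memLp b)).coeFn_toLp, Lp.coeFn_add a b,
      Lp.coeFn_add ((memLp_inv_sqrt_mul hV (Lp.memLp a)).toLp _)
        ((memLp_inv_sqrt_mul hV (Lp.memLp b)).toLp _)] with x h1 h2 h3 h4 h5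
    rw [h1, h5, Pi.add_apply, h2, h3, h4, Pi.add_apply, mul_add]
  map_smul' c a := by
    apply Lp.ext
    filter_upwards [(memLp_inv_sqrt_mul hV (Lp.memLp (c • a))).coeFn_toLp,
      (memLp_inv_sqrt_mul hV (Lp.memLp a)).coeFn_toLp, Lp.coeFn_smul c a,
      Lp.coeFn_smul c ((memLp_inv_sqrt_mul hV (Lp.memLp a)).toLp _)] with x h1 h2 h4 h5
    rw [RingHom.id_apply, h1, h5, Pi.smul_apply, h2, h4, Pi.smul_apply, mul_smul_comm]

theorem coeFn_invSqrtMul (hV : ElectricCondition V) (a : L2 N) :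
    (invSqrtMul hV a : RN N → ℂ) =ᵐ[volume] fun x => ((√(V x))⁻¹ : ℂ) * a x :=
  (memLp_inv_sqrt_mul hV (Lp.memLp a)).coeFn_toLp

theorem continuous_invSqrtMul (hV : ElectricCondition V) : Continuous (invSqrtMul hV) := by
  obtain ⟨c, hc, h⟩ := hV.exists_ae_le
  refine AddMonoidHomClass.continuous_of_bound _ (√c)⁻¹ fun a => ?_
  refine Lp.norm_le_mul_norm_of_ae_le_mul ?_
  filter_upwards [h, coeFn_invSqrtMul hV a] with x hx hx'
  rw [hx', norm_mul, norm_inv, Complex.norm_real, Real.norm_of_nonneg (Real.sqrt_nonneg _)]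
  gcongr

theorem continuous_integral_mul {h : RN N → ℂ} (hh : MemLp h 2 volume) :
    Continuous fun u : L2 N => ∫ x, u x * h x := by
  have hs : MemLp (fun x => conj (h x)) 2 volume := hh.star
  have e : (fun u : L2 N => ∫ x, u x * h x) = fun u => inner ℂ (hs.toLp _) u := by
    ext u
    rw [L2.inner_def]
    refine integral_congr_ae ?_
    filter_upwards [hs.coeFn_toLp] with x hx
    rw [hx]
    simp [mul_comm]
  rw [e]
  exact continuous_const.inner continuous_id

theorem memLp_mul_testFn {a : RN N → ℂ} (ha : ∀ K, IsCompact K → MemLp a 2 (volume.restrict K))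
    {φ : RN N → ℂ} (hφ : Continuous φ) (hs : HasCompactSupport φ) :
    MemLp (fun x => a x * φ x) 2 volume := by
  have h1 : MemLp (fun x => a x * φ x) 2 (volume.restrict (tsupport φ)) := by
    have h2 : MemLp φ ∞ (volume.restrict (tsupport φ)) :=
      (hφ.memLp_top_of_hasCompactSupport hs volume).restrict _
    exact MemLp.mul' h2 (ha _ hs)
  rw [← memLp_indicator_iff_restrict (isClosed_tsupport φ).measurableSet] at h1
  refine h1.ae_eq (.of_forall fun x => ?_)
  by_cases hx : x ∈ tsupport φ
  · rw [indicator_of_mem hx]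
  · beta_reduce
    rw [indicator_of_notMem hx, show φ x = 0 from image_eq_zero_of_notMem_tsupport hx, mul_zero]

theorem MemLpLoc.memLp_coord (hA : MemLpLoc A 2) (j : Fin N) (K : Set (RN N)) (hK : IsCompact K) :
    MemLp (fun x => (A x j : ℂ)) 2 (volume.restrict K) :=
  (Complex.ofRealCLM.comp (EuclideanSpace.proj (𝕜 := ℝ) j)).comp_memLp' (hA K hK)

theorem isClosed_hasMagneticGradient (hA : MemLpLoc A 2) :
    IsClosed {z : L2 N × L2vec N | HasMagneticGradient A z.1 z.2} := by
  simp only [HasMagneticGradient, ofPred_forall]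
  refine isClosed_iInter fun φ => isClosed_iInter fun j => isClosed_eq ?_ ?_
  · have hφ : MemLp φ 2 volume := φ.continuous.memLp_of_hasCompactSupport φ.hasCompactSupport
    let P := (EuclideanSpace.proj j : CN N →L[ℂ] ℂ).compLpL 2
      (volume : Measure (RN N))
    have : (fun z : L2 N × L2vec N => ∫ x, z.2 x j * φ x) = fun z => ∫ x, P z.2 x * φ x := by
      ext z
      refine integral_congr_ae ?_
      filter_upwards [ContinuousLinearMap.coeFn_compLpL
        (EuclideanSpace.proj j : CN N →L[ℂ] ℂ) z.2] with x hx
      rw [hx]; rfl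
    rw [this]
    exact (continuous_integral_mul hφ).comp (P.continuous.comp continuous_snd)
  · have hd : MemLp (fun x => fderiv ℝ φ x (EuclideanSpace.single j 1)) 2 volume :=
      Continuous.memLp_of_hasCompactSupport
        ((φ.contDiff.continuous_fderiv (by simp)).clm_apply continuous_const)
        (φ.hasCompactSupport.fderiv_apply (𝕜 := ℝ) _)
    have hAφ : MemLp (fun x => Complex.I * ((A x j : ℂ) * φ x)) 2 volume :=
      (memLp_mul_testFn (hA.memLp_coord j) φ.continuous φ.hasCompactSupport).const_mul _
    have : (fun z : L2 N × L2vec N => ∫ x, Complex.I * potMul A z.1 x j * φ x) =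
        fun z => ∫ x, z.1 x * (Complex.I * ((A x j : ℂ) * φ x)) := by
      ext z
      exact integral_congr_ae (.of_forall fun x => by simp [potMul]; ring)
    exact ((continuous_integral_mul hd).comp continuous_fst).neg.add
      (this ▸ (continuous_integral_mul hAφ).comp continuous_fst)

namespace H1AV

variable {hA : MemLpLoc A 2} {hV : ElectricCondition V}

/-- An element of the subspace `H1AVsub`, as an element of the Hilbert space. -/
def ofMem (u : L2 N) (hu : u ∈ H1AVsub hA hV) : H1AV hA hV := ⟨u, hu⟩

@[simp] theorem toL2_ofMem (u : L2 N) (hu : u ∈ H1AVsub hA hV) : (ofMem u hu).toL2 = u := rfl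

theorem toL2_injective : Function.Injective (toL2 : H1AV hA hV →ₗ[ℝ] L2 N) :=
  Subtype.val_injective

theorem toL2_eq (u : H1AV hA hV) : u.toL2 = invSqrtMul hV u.weighted := by
  apply Lp.ext
  filter_upwards [coeFn_invSqrtMul hV u.weighted, coeFn_weighted u, ae_pos hV] with x h1 h2 h3
  have : (√(V x) : ℂ) ≠ 0 := by exact_mod_cast (Real.sqrt_pos.2 h3).ne'
  rw [h1, h2, inv_mul_cancel_left₀ this]

theorem range_isom : range (isom (hA := hA) (hV := hV)) =
    {z | HasMagneticGradient A (invSqrtMul hV z.fst) z.snd} := by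
  ext z
  constructor
  · rintro ⟨u, rfl⟩
    change HasMagneticGradient A (invSqrtMul hV u.weighted) u.grad
    rw [← toL2_eq]
    exact u.grad_spec
  · intro hz
    have hm : (fun x => (√(V x) : ℂ) * invSqrtMul hV z.fst x) =ᵐ[volume] z.fst := by
      filter_upwards [coeFn_invSqrtMul hV z.fst, ae_pos hV] with x h1 h3
      have : (√(V x) : ℂ) ≠ 0 := by exact_mod_cast (Real.sqrt_pos.2 h3).ne'
      rw [h1, mul_inv_cancel_left₀ this]
    have hmem : invSqrtMul hV z.fst ∈ H1AVsub hA hV :=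
      ⟨(integrable_V_sq_iff hV (Lp.aestronglyMeasurable _)).2 ((Lp.memLp z.fst).ae_eq hm.symm),
        z.snd, hz⟩
    refine ⟨ofMem _ hmem, ?_⟩
    have h1 : (ofMem _ hmem).weighted = z.fst := Lp.ext ((coeFn_weighted _).trans hm)
    have h2 : (ofMem _ hmem).grad = z.snd := (grad_spec _).unique hz
    rw [isom_apply, h1, h2]
    rfl

instance : CompleteSpace (H1AV hA hV) := by
  have hcl : IsClosed (range (isom (hA := hA) (hV := hV))) := by
    rw [range_isom]
    have hc : Continuous fun z : WithLp 2 (L2 N × L2vec N) => (invSqrtMul hV z.fst, z.snd) :=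
      ((continuous_invSqrtMul hV).comp (WithLp.prod_continuous_ofLp 2 _ _).fst).prodMk
        (WithLp.prod_continuous_ofLp 2 _ _).snd
    exact (isClosed_hasMagneticGradient hA).preimage hc
  exact (completeSpace_iff_isComplete_range
    (isom (hA := hA) (hV := hV)).isometry.isUniformInducing).2 hcl.isComplete

theorem continuous_toL2 : Continuous (toL2 : H1AV hA hV →ₗ[ℝ] L2 N) := by
  have : (toL2 : H1AV hA hV → L2 N) = fun u => invSqrtMul hV (isom u).fst := by
    ext1 u
    rw [toL2_eq]; rfl
  have hc : Continuous fun u : H1AV hA hV => invSqrtMul hV (isom u).fst :=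
    (continuous_invSqrtMul hV).comp
      ((WithLp.prod_continuous_ofLp 2 _ _).fst.comp (isom (hA := hA) (hV := hV)).continuous)
  exact this ▸ hc

end H1AV

end Completeness

section Pairs

variable {N : ℕ}

/-- `u ∈ H¹` with weak gradient `g`, and `√V u`, `A u` belong to `L²`. -/
structure IsH1Pair (A : RN N → RN N) (V : RN N → ℝ) (u : RN N → ℂ) (g : RN N → CN N) : Prop where
  memLp : MemLp u 2 volume
  memLp_grad : MemLp g 2 volume
  hasWeakGradient : HasWeakGradient u g
  memLp_sqrt : MemLp (fun x => (√(V x) : ℂ) * u x) 2 volume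
  memLp_potMul : MemLp (potMul A u) 2 volume

variable {A : RN N → RN N} {V : RN N → ℝ}

theorem potMul_sub (u v : RN N → ℂ) : potMul A (u - v) = potMul A u - potMul A v := by
  ext x j
  simp [potMul, mul_sub]

theorem HasWeakGradient.sub {u v : RN N → ℂ} {g h : RN N → CN N} (hu : HasWeakGradient u g)
    (hv : HasWeakGradient v h) (mu : LocallyIntegrable u volume) (mv : LocallyIntegrable v volume)
    (mg : ∀ j, LocallyIntegrable (fun x => g x j) volume)
    (mh : ∀ j, LocallyIntegrable (fun x => h x j) volume) : HasWeakGradient (u - v) (g - h) := by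
  intro φ j
  have e1 : ∫ x, (g - h) x j * φ x = (∫ x, g x j * φ x) - ∫ x, h x j * φ x := by
    rw [← integral_sub (integrable_mul_testFn (mg j) φ) (integrable_mul_testFn (mh j) φ)]
    exact integral_congr_ae (.of_forall fun x => by simp [sub_mul])
  have e2 : ∫ x, (u - v) x * fderiv ℝ φ x (unitVec j) =
      (∫ x, u x * fderiv ℝ φ x (unitVec j)) - ∫ x, v x * fderiv ℝ φ x (unitVec j) := by
    rw [← integral_sub (integrable_mul_fderiv mu φ _) (integrable_mul_fderiv mv φ _)]
    exact integral_congr_ae (.of_forall fun x => by simp [sub_mul])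
  rw [e1, e2, hu φ j, hv φ j]
  ring

namespace IsH1Pair

variable {u v : RN N → ℂ} {g h : RN N → CN N}

theorem locallyIntegrable (p : IsH1Pair A V u g) : LocallyIntegrable u volume :=
  p.memLp.locallyIntegrable (by norm_num)

theorem locallyIntegrable_grad (p : IsH1Pair A V u g) (j : Fin N) :
    LocallyIntegrable (fun x => g x j) volume :=
  (memLp_component p.memLp_grad j).locallyIntegrable (by norm_num)

protected theorem sub (p : IsH1Pair A V u g) (q : IsH1Pair A V v h) :
    IsH1Pair A V (u - v) (g - h) where
  memLp := p.memLp.sub q.memLp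
  memLp_grad := p.memLp_grad.sub q.memLp_grad
  hasWeakGradient := p.hasWeakGradient.sub q.hasWeakGradient p.locallyIntegrable
    q.locallyIntegrable p.locallyIntegrable_grad q.locallyIntegrable_grad
  memLp_sqrt := (p.memLp_sqrt.sub q.memLp_sqrt).ae_eq (.of_forall fun x => by simp [mul_sub])
  memLp_potMul := by
    rw [potMul_sub]
    exact p.memLp_potMul.sub q.memLp_potMul

theorem memLp_magnetic (p : IsH1Pair A V u g) :
    MemLp (fun x => g x + Complex.I • potMul A u x) 2 volume :=
  p.memLp_grad.add (p.memLp_potMul.const_smul Complex.I)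

theorem hasMagneticGradient (p : IsH1Pair A V u g) :
    HasMagneticGradient A u fun x => g x + Complex.I • potMul A u x := by
  rw [hasMagneticGradient_iff]
  · simpa using p.hasWeakGradient
  · exact fun j => (memLp_component p.memLp_magnetic j).locallyIntegrable (by norm_num)
  · exact fun j => ((memLp_component p.memLp_potMul j).const_mul _).locallyIntegrable (by norm_num)

variable {hA : MemLpLoc A 2} {hV : ElectricCondition V}

theorem toLp_mem (hA : MemLpLoc A 2) (hV : ElectricCondition V) (p : IsH1Pair A V u g) :
    p.memLp.toLp u ∈ H1AVsub hA hV := by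
  refine ⟨(integrable_V_sq_iff hV (Lp.aestronglyMeasurable _)).2 (p.memLp_sqrt.ae_eq ?_),
    p.memLp_magnetic.toLp _, p.hasMagneticGradient.congr p.memLp.coeFn_toLp.symm
      p.memLp_magnetic.coeFn_toLp.symm⟩
  filter_upwards [p.memLp.coeFn_toLp] with x hx
  rw [hx]

/-- The element of `H¹_{A,V}` represented by a function. -/
noncomputable def toH1AV (hA : MemLpLoc A 2) (hV : ElectricCondition V) (p : IsH1Pair A V u g) :
    H1AV hA hV := H1AV.ofMem _ (p.toLp_mem hA hV)

theorem coeFn_toH1AV (p : IsH1Pair A V u g) : ((p.toH1AV hA hV).toL2 : RN N → ℂ) =ᵐ[volume] u :=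
  p.memLp.coeFn_toLp

theorem grad_toH1AV (p : IsH1Pair A V u g) :
    (p.toH1AV hA hV).grad = p.memLp_magnetic.toLp _ :=
  (H1AV.grad_spec _).unique (p.hasMagneticGradient.congr p.coeFn_toH1AV.symm
    p.memLp_magnetic.coeFn_toLp.symm)

theorem toH1AV_eq_iff (p : IsH1Pair A V u g) (w : H1AV hA hV) :
    p.toH1AV hA hV = w ↔ (w.toL2 : RN N → ℂ) =ᵐ[volume] u := by
  constructor
  · rintro rfl
    exact p.coeFn_toH1AV
  · intro hw
    exact H1AV.toL2_injective (Lp.ext (p.coeFn_toH1AV.trans hw.symm))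

theorem toH1AV_sub (p : IsH1Pair A V u g) (q : IsH1Pair A V v h) :
    (p.sub q).toH1AV hA hV = p.toH1AV hA hV - q.toH1AV hA hV := by
  rw [toH1AV_eq_iff, map_sub]
  filter_upwards [Lp.coeFn_sub (p.toH1AV hA hV).toL2 (q.toH1AV hA hV).toL2,
    p.coeFn_toH1AV (hA := hA) (hV := hV), q.coeFn_toH1AV (hA := hA) (hV := hV)] with x h1 h2 h3
  rw [h1, Pi.sub_apply, Pi.sub_apply, h2, h3]

theorem enorm_toH1AV_le (p : IsH1Pair A V u g) :
    ‖p.toH1AV hA hV‖ₑ ≤ eLpNorm (fun x => (√(V x) : ℂ) * u x) 2 volume +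
      (eLpNorm g 2 volume + eLpNorm (potMul A u) 2 volume) := by
  have h1 : ‖p.toH1AV hA hV‖ ≤ ‖(p.toH1AV hA hV).weighted‖ + ‖(p.toH1AV hA hV).grad‖ := by
    have h := H1AV.norm_sq_eq (p.toH1AV hA hV)
    refine abs_le_of_sq_le_sq' ?_ (by positivity) |>.2
    rw [h]
    nlinarith [norm_nonneg (p.toH1AV hA hV).weighted, norm_nonneg (p.toH1AV hA hV).grad]
  have h2 : ‖p.toH1AV hA hV‖ₑ ≤
      ‖(p.toH1AV hA hV).weighted‖ₑ + ‖(p.toH1AV hA hV).grad‖ₑ := by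
    rw [← ofReal_norm, ← ofReal_norm, ← ofReal_norm, ← ENNReal.ofReal_add (norm_nonneg _)
      (norm_nonneg _)]
    exact ENNReal.ofReal_le_ofReal h1
  refine h2.trans (add_le_add ?_ ?_)
  · rw [Lp.enorm_def]
    refine le_of_eq (eLpNorm_congr_ae ?_)
    filter_upwards [H1AV.coeFn_weighted (p.toH1AV hA hV), p.coeFn_toH1AV (hA := hA) (hV := hV)]
      with x h1 h2
    rw [h1, h2]
  · rw [grad_toH1AV, Lp.enorm_def, eLpNorm_congr_ae p.memLp_magnetic.coeFn_toLp]
    refine (eLpNorm_add_le p.memLp_grad.1 (p.memLp_potMul.const_smul Complex.I).1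
      (by norm_num)).trans (add_le_add le_rfl (le_of_eq ?_))
    refine eLpNorm_congr_norm_ae (.of_forall fun x => ?_)
    rw [Pi.smul_apply, norm_smul, Complex.norm_I, one_mul]

theorem tendsto_toH1AV {u : ℕ → RN N → ℂ} {g : ℕ → RN N → CN N}
    (p : ∀ n, IsH1Pair A V (u n) (g n)) (q : IsH1Pair A V v h)
    (h1 : Tendsto (fun n => eLpNorm (fun x => (√(V x) : ℂ) * u n x - (√(V x) : ℂ) * v x) 2 volume)
      atTop (𝓝 0))
    (h2 : Tendsto (fun n => eLpNorm (g n - h) 2 volume) atTop (𝓝 0))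
    (h3 : Tendsto (fun n => eLpNorm (potMul A (u n) - potMul A v) 2 volume) atTop (𝓝 0)) :
    Tendsto (fun n => (p n).toH1AV hA hV) atTop (𝓝 (q.toH1AV hA hV)) := by
  rw [tendsto_iff_edist_tendsto_0]
  have ht := h1.add (h2.add h3)
  simp only [add_zero] at ht
  refine tendsto_of_tendsto_of_tendsto_of_le_of_le tendsto_const_nhds ht (fun _ => zero_le)
    fun n => ?_
  rw [edist_eq_enorm_sub, ← toH1AV_sub]
  refine (enorm_toH1AV_le _).trans (le_of_eq ?_)
  simp only [potMul_sub, Pi.sub_apply, mul_sub]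

end IsH1Pair

theorem H1AV.isH1Pair {hA : MemLpLoc A 2} {hV : ElectricCondition V} (hA' : MagneticCondition A)
    (u : H1AV hA hV) :
    IsH1Pair A V u.toL2 fun x => u.grad x - Complex.I • potMul A u.toL2 x where
  memLp := Lp.memLp _
  memLp_grad := (Lp.memLp _).sub ((u.grad_spec.memLp_potMul hA hA').const_smul Complex.I)
  hasWeakGradient := u.grad_spec.hasWeakGradient hA
  memLp_sqrt := u.memLp_sqrt_mul
  memLp_potMul := u.grad_spec.memLp_potMul hA hA'

/-- Dominated convergence in `L²`. -/
theorem tendsto_eLpNorm_two_sub_of_dominated {α F : Type*} {m : MeasurableSpace α} {μ : Measure α}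
    [NormedAddCommGroup F] {f : ℕ → α → F} {f₀ : α → F} {b : α → ℝ} (hb : MemLp b 2 μ)
    (hf : ∀ n, AEStronglyMeasurable (f n) μ) (h : ∀ n, ∀ᵐ x ∂μ, ‖f n x‖ ≤ b x)
    (hlim : ∀ᵐ x ∂μ, Tendsto (fun n => f n x) atTop (𝓝 (f₀ x))) :
    Tendsto (fun n => eLpNorm (f n - f₀) 2 μ) atTop (𝓝 0) := by
  have hf₀ : AEStronglyMeasurable f₀ μ := aestronglyMeasurable_of_tendsto_ae atTop hf hlim
  have key : Tendsto (fun n => ∫⁻ x, ‖(f n - f₀) x‖ₑ ^ 2 ∂μ) atTop (𝓝 (∫⁻ _, 0 ∂μ)) := by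
    refine tendsto_lintegral_of_dominated_convergence' (fun x => (2 * ‖b x‖ₑ) ^ 2)
      (fun n => ((hf n).sub hf₀).enorm.pow_const _) (fun n => ?_) ?_ ?_
    · filter_upwards [h n, ae_all_iff.2 h, hlim] with x hx hall hl
      have h0 : ‖f₀ x‖ ≤ b x := le_of_tendsto hl.norm (.of_forall hall)
      have hbx : 0 ≤ b x := (norm_nonneg _).trans hx
      have h1 : ‖(f n - f₀) x‖ₑ ≤ 2 * ‖b x‖ₑ := by
        rw [Real.enorm_of_nonneg hbx, ← ofReal_norm, ← ENNReal.ofReal_ofNat,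
          ← ENNReal.ofReal_mul (by norm_num)]
        refine ENNReal.ofReal_le_ofReal ((norm_sub_le _ _).trans ?_)
        linarith
      exact pow_le_pow_left' h1 2
    · simp_rw [mul_pow]
      rw [lintegral_const_mul' _ _ (by norm_num)]
      exact ENNReal.mul_ne_top (by norm_num) (memLp_two_iff_lintegral.1 hb).2.ne
    · filter_upwards [hlim] with x hx
      have h1 : Tendsto (fun n => ‖(f n - f₀) x‖ₑ) atTop (𝓝 0) := by
        have := (hx.sub_const (f₀ x)).enorm
        simpa using this
      have h2 := ((ENNReal.continuous_pow 2).tendsto 0).comp h1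
      rw [zero_pow two_ne_zero] at h2
      exact h2
  rw [lintegral_zero] at key
  have h2 := ((ENNReal.continuous_rpow_const (y := 1 / 2)).tendsto 0).comp key
  rw [ENNReal.zero_rpow_of_pos (by norm_num)] at h2
  refine h2.congr fun n => ?_
  rw [Function.comp_apply, ← sq_eLpNorm_two, ← ENNReal.rpow_two, ← ENNReal.rpow_mul]
  norm_num

end Pairs

section TestFunctions

variable {N : ℕ} {A : RN N → RN N} {V : RN N → ℝ}

/-- The gradient of a differentiable function. -/
noncomputable def gradient (f : RN N → ℂ) (x : RN N) : CN N :=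
  WithLp.toLp 2 fun j => fderiv ℝ f x (unitVec j)

theorem norm_CN_le_sum (z : CN N) : ‖z‖ ≤ ∑ j, ‖z j‖ := by
  rw [EuclideanSpace.norm_eq, Real.sqrt_le_iff]
  exact ⟨Finset.sum_nonneg fun _ _ => norm_nonneg _,
    Finset.sum_sq_le_sq_sum_of_nonneg fun _ _ => norm_nonneg _⟩

theorem norm_gradient_le (f : RN N → ℂ) (x : RN N) : ‖gradient f x‖ ≤ N * ‖fderiv ℝ f x‖ := by
  refine (norm_CN_le_sum _).trans ?_
  calc ∑ j, ‖gradient f x j‖ ≤ ∑ _j : Fin N, ‖fderiv ℝ f x‖ := by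
        refine Finset.sum_le_sum fun j _ => ?_
        refine ((fderiv ℝ f x).le_opNorm _).trans (le_of_eq ?_)
        rw [PiLp.norm_single, norm_one, mul_one]
    _ = _ := by simp

theorem memLp_sqrt_restrict (hV : ElectricCondition V) (K : Set (RN N)) (hK : IsCompact K) :
    MemLp (fun x => (√(V x) : ℂ)) 2 (volume.restrict K) := by
  have hm : AEStronglyMeasurable (fun x => (√(V x) : ℂ)) volume :=
    Complex.continuous_ofReal.comp_aestronglyMeasurable (aestronglyMeasurable_sqrt hV)
  rw [memLp_two_iff_integrable_sq_norm hm.restrict]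
  refine (hV.1.integrableOn_isCompact hK).integrable.congr (ae_restrict_of_ae ?_)
  filter_upwards [ae_pos hV] with x hx
  rw [Complex.norm_real, Real.norm_of_nonneg (Real.sqrt_nonneg _), Real.sq_sqrt hx.le]

theorem isH1Pair_of_contDiff (hA : MemLpLoc A 2) (hV : ElectricCondition V) {f : RN N → ℂ}
    (hf : ContDiff ℝ 1 f) (hs : HasCompactSupport f) : IsH1Pair A V f (gradient f) where
  memLp := hf.continuous.memLp_of_hasCompactSupport hs
  memLp_grad := memLp_toLp_pi fun _ => Continuous.memLp_of_hasCompactSupport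
    ((hf.continuous_fderiv one_ne_zero).clm_apply continuous_const) (hs.fderiv_apply (𝕜 := ℝ) _)
  hasWeakGradient := hasWeakGradient_of_contDiff hf
  memLp_sqrt := memLp_mul_testFn (memLp_sqrt_restrict hV) hf.continuous hs
  memLp_potMul := memLp_toLp_pi fun j => memLp_mul_testFn (hA.memLp_coord j) hf.continuous hs

theorem TestFn.isH1Pair (hA : MemLpLoc A 2) (hV : ElectricCondition V) (φ : TestFn N) :
    IsH1Pair A V φ (gradient φ) :=
  isH1Pair_of_contDiff hA hV (φ.contDiff.of_le (by simp)) φ.hasCompactSupport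

/-- The inclusion `𝒟 → H¹_{A,V}` as a linear map. -/
noncomputable def testFnToH1AVLM (hA : MemLpLoc A 2) (hV : ElectricCondition V) :
    TestFn N →ₗ[ℝ] H1AV hA hV where
  toFun φ := (TestFn.isH1Pair hA hV φ).toH1AV hA hV
  map_add' φ ψ := by
    rw [IsH1Pair.toH1AV_eq_iff, map_add]
    filter_upwards [Lp.coeFn_add ((TestFn.isH1Pair hA hV φ).toH1AV hA hV).toL2
      ((TestFn.isH1Pair hA hV ψ).toH1AV hA hV).toL2,
      (TestFn.isH1Pair hA hV φ).coeFn_toH1AV (hA := hA) (hV := hV),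
      (TestFn.isH1Pair hA hV ψ).coeFn_toH1AV (hA := hA) (hV := hV)] with x h1 h2 h3
    rw [h1, Pi.add_apply, h2, h3]
    rfl
  map_smul' c φ := by
    rw [IsH1Pair.toH1AV_eq_iff, map_smul]
    filter_upwards [Lp.coeFn_smul c ((TestFn.isH1Pair hA hV φ).toH1AV hA hV).toL2,
      (TestFn.isH1Pair hA hV φ).coeFn_toH1AV (hA := hA) (hV := hV)] with x h1 h2
    rw [RingHom.id_apply, h1, Pi.smul_apply, h2]
    rfl

/-- A function in `L²(K)` dominating, up to a constant `c`, a function supported in `K`. -/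
theorem eLpNorm_two_le_of_support {F G : Type*} [NormedAddCommGroup F] [NormedAddCommGroup G]
    {K : Set (RN N)} (hK : MeasurableSet K) {f : RN N → F} {b : RN N → G} {c : ℝ}
    (hs : ∀ x ∉ K, f x = 0) (hb : ∀ x, ‖f x‖ ≤ c * ‖b x‖) :
    eLpNorm f 2 volume ≤ ENNReal.ofReal c * eLpNorm b 2 (volume.restrict K) := by
  rw [← eLpNorm_indicator_eq_eLpNorm_restrict hK]
  refine eLpNorm_le_mul_eLpNorm_of_ae_le_mul (.of_forall fun x => ?_) 2
  by_cases hx : x ∈ K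
  · rw [indicator_of_mem hx]; exact hb x
  · rw [indicator_of_notMem hx, hs x hx, norm_zero, norm_zero, mul_zero]

theorem continuous_testFnToH1AVLM (hA : MemLpLoc A 2) (hV : ElectricCondition V) :
    Continuous (testFnToH1AVLM hA hV) := by
  rw [TestFunction.continuous_iff_continuous_comp]
  intro K hK
  have hKm : MeasurableSet (K : Set (RN N)) := K.isCompact.measurableSet
  set a := eLpNorm (fun x => (√(V x) : ℂ)) 2 (volume.restrict (K : Set (RN N)))
  set b := eLpNorm (fun _ : RN N => (N : ℝ)) 2 (volume.restrict (K : Set (RN N)))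
  set c := eLpNorm A 2 (volume.restrict (K : Set (RN N)))
  have ha : a ≠ ∞ := (memLp_sqrt_restrict hV K K.isCompact).2.ne
  have hb : b ≠ ∞ := by
    have : IsFiniteMeasure (volume.restrict (K : Set (RN N))) :=
      ⟨by simpa using K.isCompact.measure_lt_top⟩
    exact (memLp_const (N : ℝ)).2.ne
  have hc : c ≠ ∞ := (hA K K.isCompact).2.ne
  let Φ := ContDiffMapSupportedIn.mkCLMtoNormedSpace (𝕜 := ℝ)
    (fun f : ContDiffMapSupportedIn (RN N) ℂ ⊤ K =>
      testFnToH1AVLM hA hV (TestFunction.ofSupportedIn hK f))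
    (fun f g => map_add (testFnToH1AVLM hA hV) (TestFunction.ofSupportedIn hK f)
      (TestFunction.ofSupportedIn hK g))
    (fun r f => map_smul (testFnToH1AVLM hA hV) r (TestFunction.ofSupportedIn hK f)) ?_
  · exact Φ.continuous
  refine ⟨{0, 1}, (a + (b + c)).toReal, ENNReal.toReal_nonneg, fun f => ?_⟩
  set s := (Finset.sup {0, 1} fun i => ContDiffMapSupportedIn.seminorm ℝ (RN N) ℂ ⊤ K i) f
  have hs0 : 0 ≤ s := apply_nonneg _ _
  have h0 (x : RN N) : ‖f x‖ ≤ s :=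
    (ContDiffMapSupportedIn.norm_apply_le_seminorm ℝ).trans
      (Seminorm.le_def.1 (Finset.le_sup (f := fun i =>
        ContDiffMapSupportedIn.seminorm ℝ (RN N) ℂ ⊤ K i) (b := 0) (by simp)) f)
  have h1 (x : RN N) : ‖fderiv ℝ f x‖ ≤ s := by
    rw [← norm_iteratedFDeriv_one]
    exact (ContDiffMapSupportedIn.norm_iteratedFDeriv_apply_le_seminorm_top ℝ).trans
      (Seminorm.le_def.1 (Finset.le_sup (f := fun i =>
        ContDiffMapSupportedIn.seminorm ℝ (RN N) ℂ ⊤ K i) (b := 1) (by simp)) f)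
  have hz (x : RN N) (hx : x ∉ (K : Set (RN N))) : f x = 0 := f.zero_on_compl hx
  have hz' (x : RN N) (hx : x ∉ (K : Set (RN N))) : gradient f x = 0 := by
    have : fderiv ℝ f x = 0 := by
      by_contra hne
      exact hx (f.tsupport_subset (support_fderiv_subset ℝ (Function.mem_support.2 hne)))
    ext j
    simp [gradient, this]
  have key := (TestFn.isH1Pair hA hV (TestFunction.ofSupportedIn hK f)).enorm_toH1AV_le
    (hA := hA) (hV := hV)
  have key2 : ‖testFnToH1AVLM hA hV (TestFunction.ofSupportedIn hK f)‖ₑ ≤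
      (a + (b + c)) * ENNReal.ofReal s := by
    refine key.trans ?_
    rw [mul_comm, mul_add, mul_add]
    refine add_le_add ?_ (add_le_add ?_ ?_)
    · refine eLpNorm_two_le_of_support hKm (fun x hx => ?_) fun x => ?_
      · change (√(V x) : ℂ) * f x = 0
        rw [hz x hx, mul_zero]
      · rw [norm_mul, mul_comm]
        exact mul_le_mul_of_nonneg_right (h0 x) (norm_nonneg _)
    · refine eLpNorm_two_le_of_support hKm hz' fun x => ?_
      refine (norm_gradient_le _ x).trans ?_
      rw [Real.norm_of_nonneg (Nat.cast_nonneg _), mul_comm]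
      exact mul_le_mul_of_nonneg_right (h1 x) (Nat.cast_nonneg _)
    · refine eLpNorm_two_le_of_support hKm (fun x hx => ?_) fun x => ?_
      · have : (TestFunction.ofSupportedIn hK f) x = 0 := hz x hx
        ext j
        simp [potMul, this]
      · rw [norm_potMul, mul_comm]
        exact mul_le_mul_of_nonneg_right (h0 x) (norm_nonneg _)
  have hfin : (a + (b + c)) ≠ ∞ := by finiteness
  have h3 := ENNReal.toReal_mono (by finiteness) key2
  rwa [toReal_enorm, ENNReal.toReal_mul, ENNReal.toReal_ofReal hs0] at h3

/-- The inclusion `𝒟 → H¹_{A,V}`. -/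
noncomputable def testFnToH1AV (hA : MemLpLoc A 2) (hV : ElectricCondition V) :
    TestFn N →L[ℝ] H1AV hA hV := ⟨testFnToH1AVLM hA hV, continuous_testFnToH1AVLM hA hV⟩

theorem coeFn_testFnToH1AV (hA : MemLpLoc A 2) (hV : ElectricCondition V) (φ : TestFn N) :
    ((testFnToH1AV hA hV φ).toL2 : RN N → ℂ) =ᵐ[volume] φ :=
  (TestFn.isH1Pair hA hV φ).coeFn_toH1AV

theorem testFnToH1AV_eq {hA : MemLpLoc A 2} {hV : ElectricCondition V} {u : RN N → ℂ}
    {g : RN N → CN N} (p : IsH1Pair A V u g) (hu : ContDiff ℝ (⊤ : ℕ∞) u)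
    (hs : HasCompactSupport u) : testFnToH1AV hA hV (testFnMk u hu hs) = p.toH1AV hA hV :=
  ((p.toH1AV_eq_iff _).2 (coeFn_testFnToH1AV hA hV _)).symm

theorem testFnToH1AV_injective (hA : MemLpLoc A 2) (hV : ElectricCondition V) :
    Function.Injective (testFnToH1AV hA hV) := by
  intro φ ψ h
  have h1 : (φ : RN N → ℂ) =ᵐ[volume] ψ := by
    have h2 := coeFn_testFnToH1AV hA hV φ
    rw [h] at h2
    exact h2.symm.trans (coeFn_testFnToH1AV hA hV ψ)
  exact DFunLike.coe_injective (Continuous.ae_eq_iff_eq volume φ.continuous ψ.continuous |>.1 h1)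

end TestFunctions

section Density

variable {N : ℕ} {A : RN N → RN N} {V : RN N → ℝ} {hA : MemLpLoc A 2} {hV : ElectricCondition V}

theorem mollify_coord (n : ℕ) {g : RN N → CN N} (hg : LocallyIntegrable g volume) (x : RN N)
    (j : Fin N) : mollify n g x j = mollify n (fun y => g y j) x := by
  have h := ((EuclideanSpace.proj j : CN N →L[ℂ] ℂ).restrictScalars ℝ).integral_comp_comm
    (integrable_mollify_integrand n hg x)
  rw [mollify_apply, mollify_apply]
  exact h.symm

theorem HasWeakGradient.gradient_mollify (n : ℕ) {u : RN N → ℂ} {g : RN N → CN N}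
    (hu : LocallyIntegrable u volume) (hg : LocallyIntegrable g volume)
    (h : HasWeakGradient u g) : gradient (mollify n u) = mollify n g := by
  ext x j
  rw [mollify_coord n hg]
  exact fderiv_mollify_apply n hu h x j

theorem norm_mul_indicator_le {K : Set (RN N)} {v a : ℂ} {M : ℝ} {x : RN N} (hv : ‖v‖ ≤ M)
    (hs : x ∉ K → v = 0) : ‖a * v‖ ≤ ‖K.indicator (fun _ => a) x‖ * M := by
  by_cases hx : x ∈ K
  · rw [indicator_of_mem hx, norm_mul]
    exact mul_le_mul_of_nonneg_left hv (norm_nonneg _)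
  · rw [hs hx, indicator_of_notMem hx]
    simp

/-- The elements of `H¹_{A,V}` that are bounded and of compact support are limits of test
functions. -/
theorem IsH1Pair.mem_closure_range_of_bounded {u : RN N → ℂ} {g : RN N → CN N}
    (p : IsH1Pair A V u g) {M : ℝ} (hM : ∀ x, ‖u x‖ ≤ M) {K : Set (RN N)} (hK : IsCompact K)
    (hs : Function.support u ⊆ K) :
    p.toH1AV hA hV ∈ closure (range (testFnToH1AV hA hV)) := by
  have hul := p.locallyIntegrable
  have hgl : LocallyIntegrable g volume := p.memLp_grad.locallyIntegrable (by norm_num)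
  set K' := Metric.cthickening 1 K
  have hK' : IsCompact K' := hK.cthickening
  have hsn (n : ℕ) : Function.support (mollify n u) ⊆ K' := support_mollify_subset n hs
  have hcs (n : ℕ) : HasCompactSupport (mollify n u) :=
    HasCompactSupport.of_support_subset_isCompact hK' (hsn n)
  have hcd (n : ℕ) : ContDiff ℝ (⊤ : ℕ∞) (mollify n u) := contDiff_mollify n hul
  have q (n : ℕ) : IsH1Pair A V (mollify n u) (mollify n g) := by
    rw [← p.hasWeakGradient.gradient_mollify n hul hgl]
    exact isH1Pair_of_contDiff hA hV ((hcd n).of_le (by simp)) (hcs n)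
  have hz (n : ℕ) (x : RN N) (hx : x ∉ K') : mollify n u x = 0 := by
    by_contra h0
    exact hx (hsn n h0)
  have hMn (n : ℕ) (x : RN N) : ‖mollify n u x‖ ≤ M := norm_mollify_le n hM x
  refine mem_closure_of_tendsto (b := atTop) (f := fun n => (q n).toH1AV hA hV)
    (IsH1Pair.tendsto_toH1AV q p ?_ ?_ ?_)
    (.of_forall fun n => ⟨testFnMk _ (hcd n) (hcs n), testFnToH1AV_eq (q n) _ _⟩)
  · have hb : MemLp (fun x => (√(V x) : ℂ)) 2 (volume.restrict K') := memLp_sqrt_restrict hV K' hK'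
    rw [← memLp_indicator_iff_restrict hK'.measurableSet] at hb
    refine tendsto_eLpNorm_two_sub_of_dominated (hb.norm.mul_const M)
      (fun n => (q n).memLp_sqrt.1) (fun n => .of_forall fun x => ?_) ?_
    · exact norm_mul_indicator_le (K := K') (x := x) (hMn n x) (hz n x)
    · filter_upwards [ae_tendsto_mollify hul] with x hx using hx.const_mul _
  · exact tendsto_eLpNorm_mollify_sub (by norm_num) (by norm_num) p.memLp_grad
  · have hb : MemLp A 2 (volume.restrict K') := hA K' hK'
    rw [← memLp_indicator_iff_restrict hK'.measurableSet] at hb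
    refine tendsto_eLpNorm_two_sub_of_dominated (hb.norm.mul_const M)
      (fun n => (q n).memLp_potMul.1) (fun n => .of_forall fun x => ?_) ?_
    · rw [norm_potMul]
      by_cases hx : x ∈ K'
      · rw [indicator_of_mem hx]
        exact mul_le_mul_of_nonneg_left (hMn n x) (norm_nonneg _)
      · rw [hz n x hx, indicator_of_notMem hx]
        simp
    · filter_upwards [ae_tendsto_mollify hul] with x hx
      have hc : Continuous fun z : ℂ => (WithLp.toLp 2 fun j => (A x j : ℂ) * z : CN N) := by
        fun_prop
      exact (hc.tendsto _).comp hx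

/-- The smooth truncation `z / √(1 + δ² |z|²)`. -/
noncomputable def truncate (δ : ℝ) (z : ℂ) : ℂ := (√(1 + δ ^ 2 * ‖z‖ ^ 2))⁻¹ • z

/-- The real derivative of `truncate`. -/
noncomputable def truncateDeriv (δ : ℝ) (z : ℂ) : ℂ →L[ℝ] ℂ :=
  (√(1 + δ ^ 2 * ‖z‖ ^ 2))⁻¹ • ContinuousLinearMap.id ℝ ℂ -
    ((δ ^ 2 * (√(1 + δ ^ 2 * ‖z‖ ^ 2))⁻¹ ^ 3) • innerSL ℝ z).smulRight z

theorem hasFDerivAt_truncate (δ : ℝ) (z : ℂ) : HasFDerivAt (truncate δ) (truncateDeriv δ z) z := by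
  have hS : √(1 + δ ^ 2 * ‖z‖ ^ 2) ≠ 0 := by positivity
  have h1 := (hasDerivAt_inv hS).comp_hasFDerivAt z
    (hasFDerivAt_sqrt_add_norm_sq one_pos (sq_nonneg δ) z)
  refine (h1.smul (hasFDerivAt_id z)).congr_fderiv (ContinuousLinearMap.ext fun w => ?_)
  have h2 : (-(√(1 + δ ^ 2 * ‖z‖ ^ 2) ^ 2)⁻¹ * (δ ^ 2 * (√(1 + δ ^ 2 * ‖z‖ ^ 2))⁻¹)) =
      -(δ ^ 2 * (√(1 + δ ^ 2 * ‖z‖ ^ 2))⁻¹ ^ 3) := by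
    rw [inv_pow, pow_succ _ 2, mul_inv]; ring
  change (√(1 + δ ^ 2 * ‖z‖ ^ 2))⁻¹ • w +
    (-(√(1 + δ ^ 2 * ‖z‖ ^ 2) ^ 2)⁻¹ * (δ ^ 2 * (√(1 + δ ^ 2 * ‖z‖ ^ 2))⁻¹ * inner ℝ z w)) • z =
    (√(1 + δ ^ 2 * ‖z‖ ^ 2))⁻¹ • w - (δ ^ 2 * (√(1 + δ ^ 2 * ‖z‖ ^ 2))⁻¹ ^ 3 * inner ℝ z w) • z
  rw [← mul_assoc, h2, neg_mul, neg_smul, ← sub_eq_add_neg]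

theorem one_le_sqrt_truncate (δ : ℝ) (z : ℂ) : 1 ≤ √(1 + δ ^ 2 * ‖z‖ ^ 2) :=
  Real.one_le_sqrt.2 (by nlinarith [mul_nonneg (sq_nonneg δ) (sq_nonneg ‖z‖)])

theorem continuous_inv_sqrt_truncate (z : ℂ) :
    Continuous fun δ : ℝ => (√(1 + δ ^ 2 * ‖z‖ ^ 2))⁻¹ :=
  Continuous.inv₀ (by fun_prop) fun δ => (one_pos.trans_le (one_le_sqrt_truncate δ z)).ne'

theorem continuous_truncateDeriv (δ : ℝ) : Continuous (truncateDeriv δ) := by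
  have h1 : Continuous fun z : ℂ => (√(1 + δ ^ 2 * ‖z‖ ^ 2))⁻¹ :=
    Continuous.inv₀ (by fun_prop) fun z => (one_pos.trans_le (one_le_sqrt_truncate δ z)).ne'
  refine (h1.smul continuous_const).sub ?_
  have h2 : Continuous fun z : ℂ =>
      (δ ^ 2 * (√(1 + δ ^ 2 * ‖z‖ ^ 2))⁻¹ ^ 3) • innerSL ℝ z :=
    (continuous_const.mul (h1.pow 3)).smul (innerSL ℝ).continuous
  exact (ContinuousLinearMap.smulRightL ℝ ℂ ℂ).continuous₂.comp (h2.prodMk continuous_id)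

theorem norm_truncate_le (δ : ℝ) (z : ℂ) : ‖truncate δ z‖ ≤ ‖z‖ := by
  rw [truncate, norm_smul, norm_inv, Real.norm_of_nonneg (Real.sqrt_nonneg _)]
  exact mul_le_of_le_one_left (norm_nonneg _) (inv_le_one_of_one_le₀ (one_le_sqrt_truncate δ z))

theorem mul_norm_le_sqrt (δ : ℝ) (z : ℂ) :
    δ * ‖z‖ ≤ √(1 + δ ^ 2 * ‖z‖ ^ 2) :=
  Real.le_sqrt_of_sq_le (by rw [mul_pow]; linarith)

theorem norm_truncate_le_inv {δ : ℝ} (hδ : 0 < δ) (z : ℂ) : ‖truncate δ z‖ ≤ δ⁻¹ := by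
  rw [truncate, norm_smul, norm_inv, Real.norm_of_nonneg (Real.sqrt_nonneg _),
    inv_mul_le_iff₀ (one_pos.trans_le (one_le_sqrt_truncate δ z)), ← div_eq_mul_inv,
    le_div_iff₀ hδ, mul_comm]
  exact mul_norm_le_sqrt δ z

theorem norm_truncateDeriv_le {δ : ℝ} (hδ : 0 ≤ δ) (z : ℂ) : ‖truncateDeriv δ z‖ ≤ 2 := by
  have h1 := one_le_sqrt_truncate δ z
  have h2 := mul_norm_le_sqrt δ z
  set S := √(1 + δ ^ 2 * ‖z‖ ^ 2)
  have hS : 0 < S := one_pos.trans_le h1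
  have h3 : S⁻¹ ≤ 1 := inv_le_one_of_one_le₀ h1
  refine ContinuousLinearMap.opNorm_le_bound _ zero_le_two fun w => ?_
  have h4 : ‖S⁻¹ • w‖ ≤ ‖w‖ := by
    rw [norm_smul, Real.norm_of_nonneg (inv_nonneg.2 hS.le)]
    exact mul_le_of_le_one_left (norm_nonneg _) h3
  have h5 : ‖(δ ^ 2 * S⁻¹ ^ 3 * inner ℝ z w) • z‖ ≤ ‖w‖ := by
    rw [norm_smul, norm_mul, Real.norm_of_nonneg (by positivity)]
    have h6 : ‖inner ℝ z w‖ ≤ ‖z‖ * ‖w‖ := norm_inner_le_norm z w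
    have h7 : δ * ‖z‖ * S⁻¹ ≤ 1 := by
      rw [← div_eq_mul_inv]; exact (div_le_one hS).2 h2
    calc δ ^ 2 * S⁻¹ ^ 3 * ‖inner ℝ z w‖ * ‖z‖ ≤ δ ^ 2 * S⁻¹ ^ 3 * (‖z‖ * ‖w‖) * ‖z‖ := by gcongr
      _ = (δ * ‖z‖ * S⁻¹) * (δ * ‖z‖ * S⁻¹) * S⁻¹ * ‖w‖ := by ring
      _ ≤ 1 * 1 * 1 * ‖w‖ := by gcongr
      _ = ‖w‖ := by ring
  calc ‖truncateDeriv δ z w‖ = ‖S⁻¹ • w - (δ ^ 2 * S⁻¹ ^ 3 * inner ℝ z w) • z‖ := rfl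
    _ ≤ ‖w‖ + ‖w‖ := (norm_sub_le _ _).trans (add_le_add h4 h5)
    _ = 2 * ‖w‖ := by ring

theorem tendsto_truncate (z : ℂ) :
    Tendsto (fun n : ℕ => truncate (1 / ((n : ℝ) + 1)) z) atTop (𝓝 z) := by
  have h : Continuous fun δ : ℝ => truncate δ z :=
    (continuous_inv_sqrt_truncate z).smul continuous_const
  have h2 := (h.tendsto 0).comp tendsto_one_div_add_atTop_nhds_zero_nat
  have h0 : truncate 0 z = z := by simp [truncate]
  rw [h0] at h2
  exact h2

theorem tendsto_truncateDeriv (z w : ℂ) :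
    Tendsto (fun n : ℕ => truncateDeriv (1 / ((n : ℝ) + 1)) z w) atTop (𝓝 w) := by
  have h : Continuous fun δ : ℝ => truncateDeriv δ z w := by
    have h1 := continuous_inv_sqrt_truncate z
    change Continuous fun δ : ℝ => (√(1 + δ ^ 2 * ‖z‖ ^ 2))⁻¹ • w -
      (δ ^ 2 * (√(1 + δ ^ 2 * ‖z‖ ^ 2))⁻¹ ^ 3 * inner ℝ z w) • z
    exact (h1.smul continuous_const).sub
      ((((continuous_id.pow 2).mul (h1.pow 3)).mul continuous_const).smul continuous_const)
  have h2 := (h.tendsto 0).comp tendsto_one_div_add_atTop_nhds_zero_nat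
  have h0 : truncateDeriv 0 z w = w := by simp [truncateDeriv]
  rw [h0] at h2
  exact h2

/-- A fixed smooth cutoff function. -/
noncomputable def cutoff (N : ℕ) : ContDiffBump (0 : RN N) := ⟨1, 2, one_pos, one_lt_two⟩

theorem denseRange_testFnToH1AV (hA : MemLpLoc A 2) (hA' : MagneticCondition A)
    (hV : ElectricCondition V) : DenseRange (testFnToH1AV hA hV) := by
  intro w
  have hw := w.isH1Pair hA'
  set u : RN N → ℂ := (w.toL2 : RN N → ℂ) with hu_def
  set g : RN N → CN N := fun x => w.grad x - Complex.I • potMul A u x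
  have hu := hw.locallyIntegrable
  have hg := hw.locallyIntegrable_grad
  set χ := cutoff N
  have hχ : ContDiff ℝ (⊤ : ℕ∞) χ := χ.contDiff
  obtain ⟨D, hD⟩ := (hχ.continuous_fderiv (by simp)).bounded_above_of_compact_support
    (χ.hasCompactSupport.fderiv (𝕜 := ℝ))
  have hD0 : 0 ≤ D := (norm_nonneg _).trans (hD 0)
  let δ : ℕ → ℝ := fun n => 1 / ((n : ℝ) + 1)
  have hδ (n : ℕ) : 0 < δ n := by positivity
  have hδ1 (n : ℕ) : δ n ≤ 1 := by
    rw [div_le_one (by positivity)]; linarith [(n.cast_nonneg : (0:ℝ) ≤ n)]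
  have hδ0 : Tendsto δ atTop (𝓝 0) := tendsto_one_div_add_atTop_nhds_zero_nat
  let η : ℕ → RN N → ℝ := fun n x => χ (δ n • x)
  have hη (n : ℕ) : ContDiff ℝ (⊤ : ℕ∞) (η n) := hχ.comp (contDiff_id.const_smul (δ n))
  have hη1 (n : ℕ) (x : RN N) : ‖(η n x : ℂ)‖ ≤ 1 := by
    rw [Complex.norm_real, Real.norm_of_nonneg χ.nonneg]; exact χ.le_one
  have hηd (n : ℕ) (x : RN N) (j : Fin N) :
      fderiv ℝ (η n) x (unitVec j) = δ n * fderiv ℝ χ (δ n • x) (unitVec j) := by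
    have h1 : HasFDerivAt (fun x : RN N => δ n • x) (δ n • ContinuousLinearMap.id ℝ (RN N)) x :=
      (hasFDerivAt_id x).const_smul (δ n)
    have h2 : HasFDerivAt (χ ∘ fun x => δ n • x) _ x :=
      (hχ.differentiable (by simp) (δ n • x)).hasFDerivAt.comp x h1
    change fderiv ℝ (χ ∘ fun x => δ n • x) x _ = _
    rw [h2.fderiv]
    simp
  have hηd' (n : ℕ) (x : RN N) (j : Fin N) :
      ‖(fderiv ℝ (η n) x (unitVec j) : ℂ)‖ ≤ δ n * D := by
    rw [Complex.norm_real, hηd, norm_mul, Real.norm_of_nonneg (hδ n).le]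
    refine mul_le_mul_of_nonneg_left ?_ (hδ n).le
    refine ((fderiv ℝ χ (δ n • x)).le_of_opNorm_le (hD _) _).trans (le_of_eq ?_)
    rw [PiLp.norm_single, norm_one, mul_one]
  have hηlim (x : RN N) : Tendsto (fun n => (η n x : ℂ)) atTop (𝓝 1) := by
    have h1 : Tendsto (fun n => η n x) atTop (𝓝 (χ ((0 : ℝ) • x))) :=
      (hχ.continuous.tendsto _).comp (hδ0.smul_const x)
    have h2 : χ ((0 : ℝ) • x) = 1 := by
      rw [zero_smul]
      exact χ.one_of_mem_closedBall (Metric.mem_closedBall_self zero_le_one)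
    rw [h2] at h1
    exact_mod_cast (Complex.continuous_ofReal.tendsto 1).comp h1
  have hum := hw.memLp.1
  have htc (n : ℕ) : Continuous (truncate (δ n)) :=
    continuous_iff_continuousAt.2 fun z => (hasFDerivAt_truncate (δ n) z).continuousAt
  let v : ℕ → RN N → ℂ := fun n x => (η n x : ℂ) * truncate (δ n) (u x)
  let h : ℕ → RN N → CN N := fun n x => WithLp.toLp 2 fun j =>
    (η n x : ℂ) * truncateDeriv (δ n) (u x) (g x j) +
      (fderiv ℝ (η n) x (unitVec j) : ℂ) * truncate (δ n) (u x)
  have htm (n : ℕ) : MemLp (fun x => truncate (δ n) (u x)) 2 volume :=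
    hw.memLp.mono ((htc n).comp_aestronglyMeasurable hum) (.of_forall fun x => norm_truncate_le _ _)
  have hgm (n : ℕ) (j : Fin N) : MemLp (fun x => truncateDeriv (δ n) (u x) (g x j)) 2 volume := by
    refine MemLp.of_le_mul (c := 2) (memLp_component hw.memLp_grad j)
      (aestronglyMeasurable_deriv_apply (continuous_truncateDeriv _) hum
        (hg j).aestronglyMeasurable) (.of_forall fun x => ?_)
    exact (truncateDeriv (δ n) (u x)).le_of_opNorm_le (norm_truncateDeriv_le (hδ n).le _) _
  have hηm (n : ℕ) : AEStronglyMeasurable (fun x => (η n x : ℂ)) volume :=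
    (Complex.continuous_ofReal.comp (hη n).continuous).aestronglyMeasurable
  have hvu (n : ℕ) (x : RN N) : ‖v n x‖ ≤ ‖u x‖ := by
    rw [norm_mul]
    exact (mul_le_of_le_one_left (norm_nonneg _) (hη1 n x)).trans (norm_truncate_le _ _)
  have hvc (n : ℕ) (x : RN N) (c : ℂ) : ‖c * v n x‖ ≤ ‖c * u x‖ := by
    rw [norm_mul c, norm_mul c]
    exact mul_le_mul_of_nonneg_left (hvu n x) (norm_nonneg _)
  have hvm (n : ℕ) : AEStronglyMeasurable (v n) volume := (hηm n).mul (htm n).1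
  have hvlim (x : RN N) : Tendsto (fun n => v n x) atTop (𝓝 (u x)) := by
    have := (hηlim x).mul (tendsto_truncate (u x))
    rwa [one_mul] at this
  let b : RN N → ℝ := fun x => ∑ j, (2 * ‖g x j‖ + D * ‖u x‖)
  have hb : MemLp b 2 volume := by
    refine memLp_finsetSum _ fun j _ => MemLp.add ?_ ?_
    · exact (memLp_component hw.memLp_grad j).norm.const_mul 2
    · exact hw.memLp.norm.const_mul D
  have hhm (n : ℕ) : AEStronglyMeasurable (h n) volume := by
    refine (memLp_toLp_pi (p := 0) fun j => ?_).1
    rw [memLp_zero_iff_aestronglyMeasurable]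
    refine ((hηm n).mul (hgm n j).1).add (AEStronglyMeasurable.mul ?_ (htm n).1)
    exact (Complex.continuous_ofReal.comp (((hη n).continuous_fderiv (by simp)).clm_apply
      continuous_const)).aestronglyMeasurable
  have hhb (n : ℕ) (x : RN N) : ‖h n x‖ ≤ b x := by
    refine (norm_CN_le_sum _).trans (Finset.sum_le_sum fun j _ => ?_)
    refine (norm_add_le _ _).trans (add_le_add ?_ ?_)
    · rw [norm_mul]
      refine (mul_le_of_le_one_left (norm_nonneg _) (hη1 n x)).trans ?_
      exact (truncateDeriv (δ n) (u x)).le_of_opNorm_le (norm_truncateDeriv_le (hδ n).le _) _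
    · rw [norm_mul]
      refine mul_le_mul ((hηd' n x j).trans ?_) (norm_truncate_le _ _) (norm_nonneg _) hD0
      exact mul_le_of_le_one_left hD0 (hδ1 n)
  have hhlim (x : RN N) : Tendsto (fun n => h n x) atTop (𝓝 (g x)) := by
    have hj (j : Fin N) : Tendsto (fun n => h n x j) atTop (𝓝 (g x j)) := by
      have h1 := (hηlim x).mul (tendsto_truncateDeriv (u x) (g x j))
      have h2 : Tendsto (fun n => (fderiv ℝ (η n) x (unitVec j) : ℂ)) atTop (𝓝 0) := by
        refine squeeze_zero_norm (fun n => hηd' n x j) ?_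
        simpa using hδ0.mul_const D
      have h3 := h1.add (h2.mul (tendsto_truncate (u x)))
      rwa [one_mul, zero_mul, add_zero] at h3
    exact ((PiLp.continuous_toLp 2 _).tendsto _).comp (tendsto_pi_nhds.2 hj)
  have q (n : ℕ) : IsH1Pair A V (v n) (h n) :=
    { memLp := hw.memLp.mono (hvm n) (.of_forall (hvu n))
      memLp_grad := hb.mono (hhm n) (.of_forall fun x => (hhb n x).trans (le_abs_self _))
      hasWeakGradient := by
        have h1 := hw.hasWeakGradient.comp hu hg (hasFDerivAt_truncate (δ n))
          (continuous_truncateDeriv (δ n)) (norm_truncateDeriv_le (hδ n).le)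
        exact h1.smul ((htm n).locallyIntegrable (by norm_num))
          (fun j => (hgm n j).locallyIntegrable (by norm_num)) (hη n)
      memLp_sqrt := by
        refine hw.memLp_sqrt.mono ?_ (.of_forall fun x => ?_)
        · exact (Complex.continuous_ofReal.comp_aestronglyMeasurable
            (aestronglyMeasurable_sqrt hV)).mul (hvm n)
        · exact hvc n x _
      memLp_potMul := by
        refine hw.memLp_potMul.mono (aestronglyMeasurable_potMul hA.aestronglyMeasurable (hvm n))
          (.of_forall fun x => ?_)
        rw [norm_potMul, norm_potMul]
        exact mul_le_mul_of_nonneg_left (hvu n x) (norm_nonneg _) }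
  have hmem (n : ℕ) : (q n).toH1AV hA hV ∈ closure (range (testFnToH1AV hA hV)) := by
    refine (q n).mem_closure_range_of_bounded (M := (δ n)⁻¹) (fun x => ?_)
      (isCompact_closedBall (0 : RN N) (2 / δ n)) fun x hx => ?_
    · rw [norm_mul]
      exact (mul_le_of_le_one_left (norm_nonneg _) (hη1 n x)).trans (norm_truncate_le_inv (hδ n) _)
    · by_contra hc
      refine hx ?_
      have h0 : η n x = 0 := by
        apply χ.zero_of_le_dist
        rw [dist_zero_right, norm_smul, Real.norm_of_nonneg (hδ n).le]
        rw [mem_closedBall_zero_iff, not_le, div_lt_iff₀ (hδ n)] at hc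
        change (2 : ℝ) ≤ _
        linarith
      simp [v, h0]
  have hlim : Tendsto (fun n => (q n).toH1AV hA hV) atTop (𝓝 (hw.toH1AV hA hV)) := by
    refine IsH1Pair.tendsto_toH1AV q hw ?_ ?_ ?_
    · refine tendsto_eLpNorm_two_sub_of_dominated hw.memLp_sqrt.norm
        (fun n => (q n).memLp_sqrt.1) (fun n => .of_forall fun x => ?_)
        (.of_forall fun x => (hvlim x).const_mul _)
      exact hvc n x _
    · exact tendsto_eLpNorm_two_sub_of_dominated hb hhm (fun n => .of_forall (hhb n))
        (.of_forall hhlim)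
    · refine tendsto_eLpNorm_two_sub_of_dominated hw.memLp_potMul.norm
        (fun n => (q n).memLp_potMul.1) (fun n => .of_forall fun x => ?_)
        (.of_forall fun x => ?_)
      · rw [norm_potMul, norm_potMul]
        exact mul_le_mul_of_nonneg_left (hvu n x) (norm_nonneg _)
      · have hc : Continuous fun z : ℂ => (WithLp.toLp 2 fun j => (A x j : ℂ) * z : CN N) := by
          fun_prop
        exact (hc.tendsto _).comp (hvlim x)
  have hww : hw.toH1AV hA hV = w := (hw.toH1AV_eq_iff w).2 .rfl
  rw [← hww]
  exact isClosed_closure.mem_of_tendsto hlim (.of_forall hmem)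

end Density

section Inclusion

variable {N : ℕ} {A : RN N → RN N} {V : RN N → ℝ}

theorem exists_magneticExponent (hN : 1 ≤ N) : ∃ p, MagneticExponent N p := by
  obtain rfl | rfl | h : N = 1 ∨ N = 2 ∨ 3 ≤ N := by omega
  · exact ⟨_, .inl ⟨rfl, rfl⟩⟩
  · exact ⟨_, .inr (.inl ⟨rfl, 1, one_pos, rfl⟩)⟩
  · exact ⟨_, .inr (.inr ⟨h, rfl⟩)⟩

theorem magneticCondition_zero (hN : 1 ≤ N) : MagneticCondition (0 : RN N → RN N) := by
  obtain ⟨p, hp⟩ := exists_magneticExponent hN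
  exact ⟨p, hp, fun _ _ => MemLp.zero, by simp⟩

/-- The inclusion `H¹_{A,V} → H¹` as a linear map. -/
noncomputable def toH1LM (hA : MemLpLoc A 2) (hA' : MagneticCondition A)
    (hV : ElectricCondition V) : H1AV hA hV →ₗ[ℝ] H1 N where
  toFun u := H1AV.ofMem u.toL2 ((mem_H1AVsub_iff hA hA' hV _).1 u.toL2_mem).1
  map_add' u v := H1AV.toL2_injective (by simp)
  map_smul' c u := H1AV.toL2_injective (by simp)

/-- The inclusion `H¹_{A,V} → H¹`; it is continuous by the closed graph theorem. -/
noncomputable def toH1 (hA : MemLpLoc A 2) (hA' : MagneticCondition A)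
    (hV : ElectricCondition V) : H1AV hA hV →L[ℝ] H1 N where
  toLinearMap := toH1LM hA hA' hV
  cont := LinearMap.continuous_of_seq_closed_graph _ fun u x y hu hy => by
    refine H1AV.toL2_injective (tendsto_nhds_unique
      ((H1AV.continuous_toL2.tendsto y).comp hy) ?_)
    exact (H1AV.continuous_toL2.tendsto x).comp hu

variable (hA : MemLpLoc A 2) (hA' : MagneticCondition A) (hV : ElectricCondition V)

@[simp] theorem toL2_toH1 (u : H1AV hA hV) : (toH1 hA hA' hV u).toL2 = u.toL2 := rfl

theorem toH1_injective : Function.Injective (toH1 hA hA' hV) := fun u v h => by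
  have h1 := congrArg H1AV.toL2 h
  exact H1AV.toL2_injective h1

theorem toH1_testFnToH1AV (φ : TestFn N) : toH1 hA hA' hV (testFnToH1AV hA hV φ) =
    testFnToH1AV (memLpLoc_zero N) (electricCondition_one N) φ :=
  H1AV.toL2_injective (Lp.ext ((coeFn_testFnToH1AV hA hV φ).trans
    (coeFn_testFnToH1AV _ _ φ).symm))

theorem denseRange_toH1 (hN : 1 ≤ N) : DenseRange (toH1 hA hA' hV) := by
  refine (denseRange_testFnToH1AV (memLpLoc_zero N) (magneticCondition_zero hN)
    (electricCondition_one N)).mono ?_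
  rintro _ ⟨φ, rfl⟩
  exact ⟨_, toH1_testFnToH1AV hA hA' hV φ⟩

theorem grad_ae_eq (u : H1AV hA hV) : (u.grad : RN N → CN N) =ᵐ[volume]
    fun x => (toH1 hA hA' hV u).grad x + Complex.I • potMul A u.toL2 x := by
  have p := u.isH1Pair hA'
  have h1 : (toH1 hA hA' hV u).grad = p.memLp_grad.toLp _ := by
    refine (H1AV.grad_spec _).unique ?_
    have h2 := p.hasWeakGradient.congr .rfl p.memLp_grad.coeFn_toLp.symm
    intro φ j
    simpa [potMul] using h2 φ j
  rw [h1]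
  filter_upwards [p.memLp_grad.coeFn_toLp] with x hx
  rw [hx, sub_add_cancel]

theorem integrable_hdot_of_memLp {f g : RN N → CN N} (hf : MemLp f 2 volume)
    (hg : MemLp g 2 volume) : Integrable (fun x => hdot (f x) (g x)) volume :=
  integrable_finsetSum _ fun j _ =>
    (memLp_component hf j).integrable_mul (memLp_component hg j).star

end Inclusion

section Duality

variable {E F : Type*} [NormedAddCommGroup E] [InnerProductSpace ℝ E] [NormedAddCommGroup F]
  [NormedSpace ℝ F]

/-- The transpose of a continuous linear map. -/
noncomputable def transpose {E F : Type*} [NormedAddCommGroup E] [NormedSpace ℝ E]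
    [NormedAddCommGroup F] [NormedSpace ℝ F] (L : E →L[ℝ] F) :
    StrongDual ℝ F →L[ℝ] StrongDual ℝ E :=
  (ContinuousLinearMap.compL ℝ E F ℝ).flip L

theorem transpose_injective {L : E →L[ℝ] F} (hL : DenseRange L) :
    Function.Injective (transpose L) := fun S T h =>
  ContinuousLinearMap.ext fun y => congrFun (hL.equalizer S.continuous T.continuous
    (funext fun x => DFunLike.congr_fun h x)) y

theorem denseRange_transpose [CompleteSpace E] {L : E →L[ℝ] F} (hL : Function.Injective L) :
    DenseRange (transpose L) := by
  let J := InnerProductSpace.toDual ℝ E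
  have h : (LinearMap.range (J.symm.toContinuousLinearEquiv.toContinuousLinearMap.comp
      (transpose L)).toLinearMap).topologicalClosure = ⊤ := by
    rw [Submodule.topologicalClosure_eq_top_iff, Submodule.eq_bot_iff]
    intro x hx
    apply hL
    rw [map_zero]
    refine SeparatingDual.eq_zero_of_forall_dual_eq_zero (R := ℝ) fun T => ?_
    have h1 := (Submodule.mem_orthogonal _ _).1 hx _ ⟨T, rfl⟩
    change inner ℝ (J.symm (transpose L T)) x = 0 at h1
    rwa [InnerProductSpace.toDual_symm_apply] at h1
  have h2 : DenseRange (J.symm ∘ transpose L) := by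
    have h3 := Submodule.dense_iff_topologicalClosure_eq_top.2 h
    exact h3
  have h3 := J.surjective.denseRange.comp h2 J.continuous
  convert h3 using 1
  ext T x
  simp

end Duality

section Derivatives

variable {N : ℕ}

/-- The derivatives of a convolution with a fixed smooth kernel are controlled by the `L¹` norm. -/
theorem exists_norm_iteratedFDeriv_convolution_le (m : ℕ) {E₁ E₂ E₃ : Type}
    [NormedAddCommGroup E₁] [NormedSpace ℝ E₁] [NormedAddCommGroup E₂] [NormedSpace ℝ E₂]
    [NormedAddCommGroup E₃] [NormedSpace ℝ E₃] [CompleteSpace E₃] (L : E₁ →L[ℝ] E₂ →L[ℝ] E₃)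
    {k : RN N → E₁} (hk : ContDiff ℝ (⊤ : ℕ∞) k) (hks : HasCompactSupport k) :
    ∃ C : ℝ, 0 ≤ C ∧ ∀ f : RN N → E₂, Integrable f volume → ∀ x,
      ‖iteratedFDeriv ℝ m (k ⋆[L, volume] f) x‖ ≤ C * ∫ t, ‖f t‖ := by
  induction m generalizing E₁ E₃ with
  | zero =>
    obtain ⟨D, hD⟩ := hk.continuous.bounded_above_of_compact_support hks
    have hD0 : 0 ≤ D := (norm_nonneg _).trans (hD 0)
    refine ⟨‖L‖ * D, by positivity, fun f hf x => ?_⟩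
    rw [norm_iteratedFDeriv_zero, convolution_eq_swap, ← integral_const_mul]
    refine norm_integral_le_of_norm_le (hf.norm.const_mul _) (.of_forall fun t => ?_)
    exact (L.le_opNorm₂ _ _).trans (by gcongr; exact hD _)
  | succ m ih =>
    obtain ⟨C, hC0, hC⟩ := ih (L.precompL (RN N)) (hk.fderiv_right (m := (⊤ : ℕ∞)) (by simp))
      (hks.fderiv (𝕜 := ℝ))
    refine ⟨C, hC0, fun f hf x => ?_⟩
    have h : fderiv ℝ (k ⋆[L, volume] f) = fderiv ℝ k ⋆[L.precompL (RN N), volume] f :=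
      funext fun y => (hks.hasFDerivAt_convolution_left L (hk.of_le (by simp))
        hf.locallyIntegrable y).fderiv
    rw [← norm_iteratedFDeriv_fderiv, h]
    exact hC f hf x

variable {F : Type} [NormedAddCommGroup F] [NormedSpace ℝ F]

theorem fderiv_mollify (n : ℕ) {f : RN N → F} (hf : ContDiff ℝ 1 f) (hs : HasCompactSupport f) :
    fderiv ℝ (mollify n f) = mollify n (fderiv ℝ f) := by
  ext1 x
  have h := hs.hasFDerivAt_convolution_right (ContinuousLinearMap.lsmul ℝ ℝ)
    ((contDiff_bumpSeq_normed N n (k := 0)).continuous.locallyIntegrable (μ := volume)) hf x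
  exact h.fderiv

theorem norm_iteratedFDeriv_mollify_le (n m : ℕ) {f : RN N → F} (hf : ContDiff ℝ (⊤ : ℕ∞) f)
    (hs : HasCompactSupport f) {C : ℝ} (hC : ∀ x, ‖iteratedFDeriv ℝ m f x‖ ≤ C) (x : RN N) :
    ‖iteratedFDeriv ℝ m (mollify n f) x‖ ≤ C := by
  induction m generalizing F with
  | zero =>
    simp only [norm_iteratedFDeriv_zero] at hC ⊢
    exact norm_mollify_le n hC x
  | succ m ih =>
    rw [← norm_iteratedFDeriv_fderiv, fderiv_mollify n (hf.of_le (by simp)) hs]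
    refine ih (hf.fderiv_right (by simp)) (hs.fderiv (𝕜 := ℝ)) fun y => ?_
    rw [norm_iteratedFDeriv_fderiv]
    exact hC y

theorem eventually_norm_iteratedFDeriv_mollify_sub_le [CompleteSpace F] (m : ℕ) {f : RN N → F}
    (hf : ContDiff ℝ (⊤ : ℕ∞) f) (hs : HasCompactSupport f) {ε : ℝ} (hε : 0 < ε) :
    ∀ᶠ n in atTop, ∀ x, ‖iteratedFDeriv ℝ m (mollify n f - f) x‖ ≤ ε := by
  induction m generalizing F with
  | zero =>
    filter_upwards [eventually_norm_mollify_sub_le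
      (hs.uniformContinuous_of_continuous hf.continuous) hε] with n hn x
    rw [norm_iteratedFDeriv_zero]
    exact hn x
  | succ m ih =>
    filter_upwards [ih (hf.fderiv_right (m := (⊤ : ℕ∞)) (by simp)) (hs.fderiv (𝕜 := ℝ))]
      with n hn x
    have hd : Differentiable ℝ f := hf.differentiable (by simp)
    have hd' : Differentiable ℝ (mollify n f) :=
      (contDiff_mollify n (hf.continuous.locallyIntegrable (μ := volume)) (k := ⊤)).differentiable
        (by simp)
    have h : fderiv ℝ (mollify n f - f) = mollify n (fderiv ℝ f) - fderiv ℝ f := by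
      ext1 y
      rw [fderiv_sub (hd' y) (hd y), fderiv_mollify n (hf.of_le (by simp)) hs]
      rfl
    rw [← norm_iteratedFDeriv_fderiv, h]
    exact hn x

end Derivatives

section Regularization

variable {N : ℕ}

theorem mollify_add (n : ℕ) {f g : RN N → ℂ} (hf : LocallyIntegrable f volume)
    (hg : LocallyIntegrable g volume) : mollify n (f + g) = mollify n f + mollify n g := by
  ext x
  rw [Pi.add_apply, mollify_apply, mollify_apply, mollify_apply,
    ← integral_add (integrable_mollify_integrand n hf x) (integrable_mollify_integrand n hg x)]
  simp only [Pi.add_apply, smul_add]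

theorem mollify_smul (n : ℕ) (c : ℝ) (f : RN N → ℂ) : mollify n (c • f) = c • mollify n f := by
  ext x
  rw [Pi.smul_apply, mollify_apply, mollify_apply, ← integral_smul]
  exact integral_congr_ae (.of_forall fun t => smul_comm ((bumpSeq N n).normed volume t) c (f (x - t)))

open TopologicalSpace (Compacts)

/-- The closed `1`-neighbourhood of a compact set. -/
noncomputable def thicken (K : Compacts (RN N)) : Compacts (RN N) :=
  ⟨Metric.cthickening 1 K, K.isCompact.cthickening⟩

/-- Mollification of smooth functions supported in `K`. -/
noncomputable def mollifyIn (n : ℕ) (K : Compacts (RN N)) (f : ContDiffMapSupportedIn (RN N) ℂ ⊤ K) :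
    ContDiffMapSupportedIn (RN N) ℂ ⊤ (thicken K) :=
  .of_support_subset (contDiff_mollify n (f.continuous.locallyIntegrable (μ := volume)) (k := ⊤))
    (support_mollify_subset n f.support_subset)

/-- Functions supported in `K` as functions supported in the neighbourhood of `K`. -/
noncomputable def thickenIncl (K : Compacts (RN N)) (f : ContDiffMapSupportedIn (RN N) ℂ ⊤ K) :
    ContDiffMapSupportedIn (RN N) ℂ ⊤ (thicken K) :=
  .of_support_subset f.contDiff (f.support_subset.trans (Metric.self_subset_cthickening _))

theorem seminorm_mollifyIn_le (n i : ℕ) {K : Compacts (RN N)}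
    (f : ContDiffMapSupportedIn (RN N) ℂ ⊤ K) :
    ContDiffMapSupportedIn.seminorm ℝ (RN N) ℂ ⊤ (thicken K) i (mollifyIn n K f) ≤
      ContDiffMapSupportedIn.seminorm ℝ (RN N) ℂ ⊤ K i f :=
  (ContDiffMapSupportedIn.seminorm_top_le_iff ℝ (apply_nonneg _ _) i _).2 fun x _ =>
    norm_iteratedFDeriv_mollify_le n i f.contDiff f.hasCompactSupport
      (fun _ => ContDiffMapSupportedIn.norm_iteratedFDeriv_apply_le_seminorm_top ℝ) x

theorem tendsto_mollifyIn {K : Compacts (RN N)} (f : ContDiffMapSupportedIn (RN N) ℂ ⊤ K) :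
    Tendsto (fun n => mollifyIn n K f) atTop (𝓝 (thickenIncl K f)) := by
  rw [(ContDiffMapSupportedIn.withSeminorms ℝ (RN N) ℂ ⊤ (thicken K)).tendsto_nhds]
  intro i ε hε
  filter_upwards [eventually_norm_iteratedFDeriv_mollify_sub_le i f.contDiff f.hasCompactSupport
    (half_pos hε)] with n hn
  refine lt_of_le_of_lt ?_ (half_lt_self hε)
  exact (ContDiffMapSupportedIn.seminorm_top_le_iff ℝ (half_pos hε).le i _).2 fun x _ => hn x

/-- Every continuous linear form on `𝓓_{K'}`, `K'` the neighbourhood of `K`, is small on all the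
mollifications of small functions supported in `K`. -/
theorem eventually_forall_norm_mollifyIn_le {K : Compacts (RN N)}
    (T : ContDiffMapSupportedIn (RN N) ℂ ⊤ (thicken K) →L[ℝ] ℝ) {ε : ℝ} (hε : 0 < ε) :
    ∀ᶠ f in 𝓝 (0 : ContDiffMapSupportedIn (RN N) ℂ ⊤ K), ∀ n, ‖T (mollifyIn n K f)‖ ≤ ε := by
  have h : {g | ‖T g‖ ≤ ε} ∈ 𝓝 (0 : ContDiffMapSupportedIn (RN N) ℂ ⊤ (thicken K)) := by
    have h1 := (T.continuous.norm.tendsto 0).eventually_le_const (u := ε) (by simpa using hε)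
    exact h1
  obtain ⟨s, r, hr, hsr⟩ := ((ContDiffMapSupportedIn.withSeminorms ℝ (RN N) ℂ ⊤
    (thicken K)).mem_nhds_iff 0 _).1 h
  refine ((ContDiffMapSupportedIn.withSeminorms ℝ (RN N) ℂ ⊤ K).mem_nhds_iff 0 _).2
    ⟨s, r, hr, fun f hf n => hsr ?_⟩
  rw [Seminorm.mem_ball_zero] at hf ⊢
  refine lt_of_le_of_lt ?_ hf
  refine Seminorm.finset_sup_apply_le (apply_nonneg _ _) fun i hi => ?_
  exact (seminorm_mollifyIn_le n i f).trans (Seminorm.le_def.1 (Finset.le_sup (f := fun i =>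
    ContDiffMapSupportedIn.seminorm ℝ (RN N) ℂ ⊤ K i) hi) f)

/-- The closed ball of radius `n`. -/
noncomputable def ballCompacts (N n : ℕ) : Compacts (RN N) :=
  ⟨Metric.closedBall 0 n, isCompact_closedBall 0 n⟩

theorem integrable_indicator_ball (n : ℕ) (u : L2 N) :
    Integrable ((ballCompacts N n : Set (RN N)).indicator u) volume := by
  rw [integrable_indicator_iff (ballCompacts N n).isCompact.measurableSet]
  exact (L2_locallyIntegrable u).integrableOn_isCompact (ballCompacts N n).isCompact

theorem exists_integral_norm_indicator_le (N n : ℕ) : ∃ C : ℝ≥0, ∀ u : L2 N,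
    ∫ x, ‖(ballCompacts N n : Set (RN N)).indicator u x‖ ≤ C * ‖u‖ := by
  set B : Set (RN N) := (ballCompacts N n : Set (RN N))
  have hB : volume B < ∞ := (ballCompacts N n).isCompact.measure_lt_top
  have hBm : MeasurableSet B := (ballCompacts N n).isCompact.measurableSet
  refine ⟨((volume B) ^ (1 - 1 / 2 : ℝ)).toNNReal, fun u => ?_⟩
  have h1 := eLpNorm_le_eLpNorm_mul_rpow_measure_univ (μ := volume.restrict B) (p := 1) (q := 2)
    (by norm_num) (Lp.aestronglyMeasurable u).restrict
  have h2 : eLpNorm u 2 (volume.restrict B) ≤ ‖u‖ₑ := by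
    rw [Lp.enorm_def]; exact eLpNorm_restrict_le _ _ _ _
  rw [integral_norm_eq_lintegral_enorm (integrable_indicator_ball n u).1,
    ← eLpNorm_one_eq_lintegral_enorm, eLpNorm_indicator_eq_eLpNorm_restrict hBm]
  have h3 : eLpNorm u 1 (volume.restrict B) ≤ ‖u‖ₑ * (volume B) ^ (1 - 1 / 2 : ℝ) := by
    refine h1.trans ?_
    rw [Measure.restrict_apply_univ]
    norm_num
    gcongr
  have h4 := ENNReal.toReal_mono (by finiteness) h3
  rw [ENNReal.toReal_mul, toReal_enorm, mul_comm] at h4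
  exact h4

/-- The regularization `u ↦ ρ_n ⋆ (1_{B_n} u)`, as a linear map. -/
noncomputable def regularizeLM (N n : ℕ) :
    L2 N →ₗ[ℝ] ContDiffMapSupportedIn (RN N) ℂ ⊤ (thicken (ballCompacts N n)) where
  toFun u := .of_support_subset
    (contDiff_mollify n (integrable_indicator_ball n u).locallyIntegrable (k := ⊤))
    (support_mollify_subset n support_indicator_subset)
  map_add' u v := by
    ext x
    change mollify n _ x = (mollify n ((ballCompacts N n : Set (RN N)).indicator u) +
      mollify n ((ballCompacts N n : Set (RN N)).indicator v)) x
    rw [← mollify_add n (integrable_indicator_ball n u).locallyIntegrable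
      (integrable_indicator_ball n v).locallyIntegrable, ← indicator_add']
    exact congrFun (mollify_congr n (Lp.coeFn_add u v).indicator) x
  map_smul' c u := by
    ext x
    change mollify n _ x = (c • mollify n ((ballCompacts N n : Set (RN N)).indicator u)) x
    rw [← mollify_smul]
    refine congrFun (mollify_congr n ?_) x
    filter_upwards [Lp.coeFn_smul c u] with t ht
    by_cases h : t ∈ (ballCompacts N n : Set (RN N))
    · simp only [indicator_of_mem h, ht, Pi.smul_apply]
    · simp only [indicator_of_notMem h, Pi.smul_apply, smul_zero]

/-- The regularization `u ↦ ρ_n ⋆ (1_{B_n} u)`. -/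
noncomputable def regularize (N n : ℕ) :
    L2 N →L[ℝ] ContDiffMapSupportedIn (RN N) ℂ ⊤ (thicken (ballCompacts N n)) where
  toLinearMap := regularizeLM N n
  cont := by
    refine WithSeminorms.continuous_normedSpace_dom _
      (ContDiffMapSupportedIn.withSeminorms ℝ (RN N) ℂ ⊤ (thicken (ballCompacts N n))) _ fun i => ?_
    obtain ⟨C, hC0, hC⟩ := exists_norm_iteratedFDeriv_convolution_le i
      (ContinuousLinearMap.lsmul ℝ ℝ : ℝ →L[ℝ] ℂ →L[ℝ] ℂ) (contDiff_bumpSeq_normed N n (k := ⊤))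
      (hasCompactSupport_bumpSeq_normed N n)
    obtain ⟨D, hD⟩ := exists_integral_norm_indicator_le N n
    refine ⟨C.toNNReal * D, fun u => ?_⟩
    change ContDiffMapSupportedIn.seminorm ℝ (RN N) ℂ ⊤ _ i (regularizeLM N n u) ≤
      (C.toNNReal * D : ℝ≥0) * ‖u‖
    refine (ContDiffMapSupportedIn.seminorm_top_le_iff ℝ (by positivity) i _).2 fun x _ => ?_
    refine (hC _ (integrable_indicator_ball n u) x).trans ?_
    rw [NNReal.coe_mul, Real.coe_toNNReal C hC0, mul_assoc]
    exact mul_le_mul_of_nonneg_left (hD u) hC0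

end Regularization

section Restriction

variable {N : ℕ}

open TopologicalSpace (Compacts)

/-- The restriction of continuous linear forms to test functions. -/
noncomputable def restrictDistr {X : Type*} [NormedAddCommGroup X] [NormedSpace ℝ X]
    (L : TestFn N →L[ℝ] X) : StrongDual ℝ X →L[ℝ] Distr N where
  toFun T := T.comp L
  map_add' _ _ := rfl
  map_smul' _ _ := rfl
  cont := by
    let Φ : StrongDual ℝ X →ₗ[ℝ] Distr N :=
      { toFun := fun T => T.comp L, map_add' := fun _ _ => rfl, map_smul' := fun _ _ => rfl }
    refine continuous_of_continuousAt_zero Φ ?_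
    rw [ContinuousAt, map_zero, (CompactConvergenceCLM.hasBasis_nhds_zero_of_basis
      Metric.nhds_basis_ball).tendsto_right_iff]
    rintro ⟨K, ε⟩ ⟨hK, hε⟩
    obtain ⟨R, hR0, hR⟩ := (hK.image L.continuous).isBounded.exists_pos_norm_le
    filter_upwards [Metric.ball_mem_nhds (0 : StrongDual ℝ X) (div_pos hε hR0)] with T hT φ hφ
    rw [mem_ball_zero_iff, lt_div_iff₀ hR0] at hT
    rw [mem_ball_zero_iff]
    exact ((T.le_opNorm _).trans (by gcongr; exact hR _ (mem_image_of_mem L hφ))).trans_lt hT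

theorem restrictDistr_injective {X : Type*} [NormedAddCommGroup X] [NormedSpace ℝ X]
    {L : TestFn N →L[ℝ] X} (hL : DenseRange L) : Function.Injective (restrictDistr L) :=
  fun S T h => ContinuousLinearMap.ext fun y => congrFun (hL.equalizer S.continuous T.continuous
    (funext fun φ => by
      have := DFunLike.congr_fun h φ
      exact this)) y

/-- The distribution `φ ↦ T (ρ_n ⋆ (1_{B_n} φ))`, as a continuous linear form on `L²`. -/
noncomputable def regularizeDistr (n : ℕ) (T : TestFn N →L[ℝ] ℝ) : L2 N →L[ℝ] ℝ :=
  (T.comp (TestFunction.ofSupportedInCLM ℝ (Ω := ⊤) (subset_univ _))).comp (regularize N n)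

theorem regularizeDistr_apply {n : ℕ} (T : TestFn N →L[ℝ] ℝ) {K : Compacts (RN N)}
    (hK : (K : Set (RN N)) ⊆ Metric.closedBall 0 n) (f : ContDiffMapSupportedIn (RN N) ℂ ⊤ K)
    {u : L2 N} (hu : (u : RN N → ℂ) =ᵐ[volume] f) :
    regularizeDistr n T u =
      T (TestFunction.ofSupportedIn (Ω := ⊤) (subset_univ _) (mollifyIn n K f)) := by
  refine congrArg T (TestFunction.ext fun x => congrFun (mollify_congr n ?_) x)
  refine hu.indicator.trans (.of_eq ?_)
  rw [indicator_eq_self]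
  exact f.support_subset.trans hK

theorem exists_subset_closedBall (K : Compacts (RN N)) :
    ∃ n₀ : ℕ, ∀ n ≥ n₀, (K : Set (RN N)) ⊆ Metric.closedBall 0 n := by
  obtain ⟨R, hR⟩ := K.isCompact.isBounded.subset_closedBall 0
  obtain ⟨n₀, hn₀⟩ := exists_nat_ge R
  exact ⟨n₀, fun n hn => hR.trans (Metric.closedBall_subset_closedBall
    (hn₀.trans (by exact_mod_cast hn)))⟩

/-- If `T_n → T` pointwise and the `T_n` are equicontinuous on each `𝓓_K`, then `T_n → T` uniformly
on compact sets. -/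
theorem tendsto_distr {T : ℕ → Distr N} {S : Distr N}
    (hlim : ∀ φ, Tendsto (fun n => T n φ) atTop (𝓝 (S φ)))
    (heq : ∀ (K : Compacts (RN N)) (ε : ℝ), 0 < ε →
      ∀ᶠ f in 𝓝 (0 : ContDiffMapSupportedIn (RN N) ℂ ⊤ K), ∀ n,
        ‖(T n - S) (TestFunction.ofSupportedIn (Ω := ⊤) (subset_univ _) f)‖ ≤ ε) :
    Tendsto T atTop (𝓝 S) := by
  have hb (φ : TestFn N) : ∃ C, ∀ n, ‖(T n - S) φ‖ ≤ C := by
    obtain ⟨C, hC⟩ := ((hlim φ).sub_const (S φ)).norm.bddAbove_range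
    exact ⟨C, fun n => hC ⟨n, rfl⟩⟩
  let Φ : TestFn N →ₗ[ℝ] BoundedContinuousFunction ℕ ℝ :=
    { toFun := fun φ => BoundedContinuousFunction.ofNormedAddCommGroupDiscrete
        (fun n => (T n - S) φ) (hb φ).choose (hb φ).choose_spec
      map_add' := fun φ ψ => by ext n; exact map_add (T n - S) φ ψ
      map_smul' := fun c φ => by ext n; exact map_smul (T n - S) c φ }
  have hΦ : Continuous Φ := by
    rw [TestFunction.continuous_iff_continuous_comp]
    intro K hK
    refine continuous_of_continuousAt_zero
      (Φ.comp (TestFunction.ofSupportedInCLM ℝ hK).toLinearMap) ?_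
    rw [ContinuousAt, map_zero, Metric.nhds_basis_closedBall.tendsto_right_iff]
    intro ε hε
    filter_upwards [heq K ε hε] with f hf
    rw [mem_closedBall_zero_iff, BoundedContinuousFunction.norm_le hε.le]
    exact hf
  rw [← tendsto_sub_nhds_zero_iff, (CompactConvergenceCLM.hasBasis_nhds_zero_of_basis
      Metric.nhds_basis_ball).tendsto_right_iff]
  rintro ⟨K, ε⟩ ⟨hK, hε⟩
  obtain ⟨t, htK, htf, ht⟩ := ((hK.image hΦ).finite_cover_balls (half_pos hε))
  have h1 : ∀ᶠ n in atTop, ∀ g ∈ t, ‖g n‖ < ε / 2 := by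
    refine (htf.eventually_all).2 fun g hg => ?_
    obtain ⟨φ, _, rfl⟩ := htK hg
    have h2 := ((hlim φ).sub_const (S φ)).norm
    rw [sub_self, norm_zero] at h2
    exact h2.eventually_lt_const (half_pos hε)
  filter_upwards [h1] with n hn φ hφ
  obtain ⟨g, hg, hgφ⟩ := mem_iUnion₂.1 (ht (mem_image_of_mem Φ hφ))
  rw [mem_ball_zero_iff]
  have h3 : ‖(Φ φ - g) n‖ < ε / 2 :=
    (BoundedContinuousFunction.norm_coe_le_norm _ n).trans_lt (mem_ball_iff_norm.1 hgφ)
  calc ‖Φ φ n‖ = ‖(Φ φ - g) n + g n‖ := by simp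
    _ ≤ ‖(Φ φ - g) n‖ + ‖g n‖ := norm_add_le _ _
    _ < ε / 2 + ε / 2 := add_lt_add h3 (hn g hg)
    _ = ε := add_halves ε

theorem denseRange_restrictDistr {A : RN N → RN N} {V : RN N → ℝ} (hA : MemLpLoc A 2)
    (hV : ElectricCondition V) : DenseRange (restrictDistr (testFnToH1AV hA hV)) := by
  intro S
  let T : ℕ → StrongDual ℝ (H1AV hA hV) := fun n =>
    (regularizeDistr n S).comp ⟨H1AV.toL2, H1AV.continuous_toL2⟩
  have hT {K : Compacts (RN N)} {n : ℕ} (hn : (K : Set (RN N)) ⊆ Metric.closedBall 0 n)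
      (f : ContDiffMapSupportedIn (RN N) ℂ ⊤ K) : restrictDistr (testFnToH1AV hA hV) (T n)
        (TestFunction.ofSupportedIn (Ω := ⊤) (subset_univ _) f) =
      S (TestFunction.ofSupportedIn (Ω := ⊤) (subset_univ _) (mollifyIn n K f)) :=
    regularizeDistr_apply S hn f (coeFn_testFnToH1AV hA hV _)
  have hc (K : Compacts (RN N)) (R : Distr N) : Continuous fun f =>
      R (TestFunction.ofSupportedIn (Ω := ⊤) (K := K) (subset_univ _) f) :=
    (ContinuousLinearMap.continuous (R : TestFn N →L[ℝ] ℝ)).comp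
      (TestFunction.continuous_ofSupportedIn _)
  have h0 (K : Compacts (RN N)) (R : Distr N) {ε : ℝ} (hε : 0 < ε) :
      ∀ᶠ f in 𝓝 0, ‖R (TestFunction.ofSupportedIn (Ω := ⊤) (K := K) (subset_univ _) f)‖ ≤ ε := by
    have h1 := ((hc K R).norm.tendsto 0)
    have h2 : R (TestFunction.ofSupportedIn (Ω := ⊤) (K := K) (subset_univ _) 0) = 0 := map_zero R
    rw [h2, norm_zero] at h1
    exact h1.eventually_le_const hε
  refine mem_closure_of_tendsto (tendsto_distr (T := fun n =>
    restrictDistr (testFnToH1AV hA hV) (T n)) (fun φ => ?_) fun K ε hε => ?_)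
    (.of_forall fun n => ⟨T n, rfl⟩)
  · let K : Compacts (RN N) := ⟨tsupport φ, φ.hasCompactSupport⟩
    let f : ContDiffMapSupportedIn (RN N) ℂ ⊤ K := .of_support_subset φ.contDiff subset_closure
    obtain ⟨n₀, hn₀⟩ := exists_subset_closedBall K
    refine (((hc _ S).tendsto _).comp (tendsto_mollifyIn f)).congr' ?_
    filter_upwards [eventually_ge_atTop n₀] with n hn
    exact (hT (hn₀ n hn) f).symm
  · obtain ⟨n₀, hn₀⟩ := exists_subset_closedBall K
    have h1 : ∀ᶠ f in 𝓝 (0 : ContDiffMapSupportedIn (RN N) ℂ ⊤ K), ∀ n ∈ Finset.range n₀,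
        ‖(restrictDistr (testFnToH1AV hA hV) (T n) - S)
          (TestFunction.ofSupportedIn (Ω := ⊤) (subset_univ _) f)‖ ≤ ε :=
      (Finset.eventually_all _).2 fun n _ => h0 K _ hε
    filter_upwards [h1, h0 K S (half_pos hε), eventually_forall_norm_mollifyIn_le
      ((S : TestFn N →L[ℝ] ℝ).comp (TestFunction.ofSupportedInCLM ℝ (Ω := ⊤) (subset_univ _)))
      (half_pos hε)] with f hf1 hf2 hf3 n
    by_cases hn : n < n₀
    · exact hf1 n (Finset.mem_range.2 hn)
    · have h2 : (restrictDistr (testFnToH1AV hA hV) (T n) - S)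
          (TestFunction.ofSupportedIn (Ω := ⊤) (subset_univ _) f) =
        S (TestFunction.ofSupportedIn (Ω := ⊤) (subset_univ _) (mollifyIn n K f)) -
          S (TestFunction.ofSupportedIn (Ω := ⊤) (subset_univ _) f) := by
        rw [← hT (hn₀ n (not_lt.1 hn)) f]
        rfl
      rw [h2, ← add_halves ε]
      exact (norm_sub_le _ _).trans (add_le_add (hf3 n) hf2)

end Restriction

end MagneticSobolev

theorem mainTheorem4 {N : ℕ} (hN : 1 ≤ N) (A : RN N → RN N) (V : RN N → ℝ)
    (hA : MemLpLoc A 2) (hA' : MagneticCondition A) (hV : ElectricCondition V) :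
    -- the identity `H¹_{A,V} = {u ∈ H¹ ; V u² ∈ L¹, A u ∈ L²}`
    (∀ u : L2 N, u ∈ H1AVsub hA hV ↔
      u ∈ H1sub N ∧ Integrable (fun x => (V x : ℂ) * u x ^ 2) volume ∧
        MemLp (potMul A u) 2 volume) ∧
    -- `H¹_{A,V}` is a separable Hilbert space
    CompleteSpace (H1AV hA hV) ∧ TopologicalSpace.SeparableSpace (H1AV hA hV) ∧
    -- the dense continuous embeddings `ι : 𝒟 → H¹_{A,V}` and `κ : H¹_{A,V} → H¹`
    ∃ (ι : TestFn N →L[ℝ] H1AV hA hV) (κ : H1AV hA hV →L[ℝ] H1 N),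
      (∀ φ : TestFn N, ((ι φ).toL2 : RN N → ℂ) =ᵐ[volume] φ) ∧
      (∀ u : H1AV hA hV, (κ u).toL2 = u.toL2) ∧
      Function.Injective ι ∧ DenseRange ι ∧ Function.Injective κ ∧ DenseRange κ ∧
      -- each term of the integrals in the scalar product is integrable
      (∀ u : H1AV hA hV, (u.grad : RN N → CN N) =ᵐ[volume]
        fun x => (κ u).grad x + Complex.I • potMul A u.toL2 x) ∧
      (∀ u v : H1AV hA hV,
        Integrable (fun x => (V x : ℂ) * (u.toL2 x * conj (v.toL2 x))) volume ∧
        Integrable (fun x => hdot (u.grad x) (v.grad x)) volume ∧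
        Integrable (fun x => hdot ((κ u).grad x) ((κ v).grad x)) volume ∧
        Integrable (fun x => hdot ((κ u).grad x) (Complex.I • potMul A v.toL2 x)) volume ∧
        Integrable (fun x => hdot (Complex.I • potMul A u.toL2 x) ((κ v).grad x)) volume ∧
        Integrable (fun x => hdot (Complex.I • potMul A u.toL2 x)
          (Complex.I • potMul A v.toL2 x)) volume) ∧
      -- the dense continuous embeddings `H⁻¹ → H⁻¹_{A,V} → 𝒟'`, given by restriction
      ∃ (κ' : StrongDual ℝ (H1 N) →L[ℝ] StrongDual ℝ (H1AV hA hV))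
        (ι' : StrongDual ℝ (H1AV hA hV) →L[ℝ] Distr N),
        (∀ (T : StrongDual ℝ (H1 N)) (u : H1AV hA hV), κ' T u = T (κ u)) ∧
        (∀ (T : StrongDual ℝ (H1AV hA hV)) (φ : TestFn N), ι' T φ = T (ι φ)) ∧
        Function.Injective κ' ∧ DenseRange κ' ∧ Function.Injective ι' ∧ DenseRange ι' := by
  have hm (u : H1AV hA hV) : MemLp (fun x => Complex.I • potMul A u.toL2 x) 2 volume :=
    (u.isH1Pair hA').memLp_potMul.const_smul Complex.I
  exact ⟨mem_H1AVsub_iff hA hA' hV, inferInstance, inferInstance, testFnToH1AV hA hV,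
    toH1 hA hA' hV, coeFn_testFnToH1AV hA hV, toL2_toH1 hA hA' hV, testFnToH1AV_injective hA hV,
    denseRange_testFnToH1AV hA hA' hV, toH1_injective hA hA' hV, denseRange_toH1 hA hA' hV hN,
    grad_ae_eq hA hA' hV, fun u v =>
      ⟨integrable_V_mul hV u.toL2_mem.1 v.toL2_mem.1, integrable_hdot _ _, integrable_hdot _ _,
        integrable_hdot_of_memLp (Lp.memLp _) (hm v), integrable_hdot_of_memLp (hm u) (Lp.memLp _),
        integrable_hdot_of_memLp (hm u) (hm v)⟩,
    transpose (toH1 hA hA' hV), restrictDistr (testFnToH1AV hA hV), fun _ _ => rfl,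
    fun _ _ => rfl, transpose_injective (denseRange_toH1 hA hA' hV hN),
    denseRange_transpose (toH1_injective hA hA' hV),
    restrictDistr_injective (denseRange_testFnToH1AV hA hA' hV), denseRange_restrictDistr hA hV⟩
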